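/- Let $(M^{2n},\omega)$ be a compact symplectic manifold (without boundary) and let $J$ be an almost complex structure on $M$ compatible with $\omega$. For all real numbers $C>0$ and $\eta>0$ there exist $\delta>0$ and an integral symplectic form $\bar\omega$ on $M$ (that is, $[\bar\omega]$ lies in the image of $H^2(M;\mathbb Z)\to H^2(M;\mathbb R)$), together with an almost complex structure $\bar J$ compatible with $\bar\omega$, such that the following holds. Let $g$ be the metric $g_{\bar J}=\bar\omega(\cdot,\bar J\cdot)$, or any positive constant multiple of it. Let $E\to M$ be a smooth complex vector bundle of complex rank $k$, with a smooth metric and a smooth connection $\nabla$, and let $s$ be a smooth section of $E$ such that * $s$ is $\eta$-transverse to $0$: at every point $x$ with $|s(x)|\le\eta$ the map $\nabla s(x):T_xM\to E_x$ is surjective and has a right inverse of operator norm less than $\eta^{-1}$; * $s$ is $C^2$-approximately holomorphic with bounds $\{(C,\delta),(C,\delta)\}$: for $r=1,2$, everywhere on $M$, $$|\nabla^r s|\le C,\qquad |\nabla^{r-1}\bar\partial_{\bar J}s|\le C\,\delta^{-1/2},$$ where $\bar\partial_{\bar J}s=\tfrac12(\nabla s+i\,\nabla s\circ\bar J)$ is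 the $(0,1)$-part of $\nabla s$. Here all norms on tangent spaces are taken with respect to $g$, and $T^*M\otimes E$ carries the connection induced by $\nabla$ and the Levi-Civita connection of $g$. Then the zero set $s^{-1}(0)$ is a symplectic submanifold, of real codimension $2k$, of both $(M,\omega)$ and $(M,\bar\omega)$. -/

import Mathlib

open Bundle Manifold
open scoped Manifold ContDiff Topology

noncomputable section

namespace SymplecticSections

/-! Throughout, `M` is a smooth manifold without boundary of dimension `d`, modelled on `ℝ^d`. -/

section Manifolds

variable {d : ℕ} {M : Type*} [TopologicalSpace M] [ChartedSpace (EuclideanSpace ℝ (Fin d)) M]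

/-! ### Differential forms -/

/-- A (not necessarily smooth) differential `k`-form on `M`. -/
abbrev DForm (d k : ℕ) (M : Type*) [TopologicalSpace M]
    [ChartedSpace (EuclideanSpace ℝ (Fin d)) M] : Type _ :=
  (x : M) → (TangentSpace (𝓡 d) x) [⋀^Fin k]→L[ℝ] ℝ

/-- The expression of a form in the chart of `M` at `p`: the pull-back of the form under the
inverse of that chart (it is meaningful on the target of the chart). -/
def DForm.inChart {k : ℕ} (α : DForm d k M) (p : M) :
    EuclideanSpace ℝ (Fin d) → (EuclideanSpace ℝ (Fin d)) [⋀^Fin k]→L[ℝ] ℝ :=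
  fun y => (α ((extChartAt (𝓡 d) p).symm y)).compContinuousLinearMap
    (mfderiv 𝓘(ℝ, EuclideanSpace ℝ (Fin d)) (𝓡 d) (extChartAt (𝓡 d) p).symm y)

/-- The form `α` is smooth on the open set `U`. -/
def DForm.SmoothOn {k : ℕ} (α : DForm d k M) (U : Set M) : Prop :=
  ∀ p : M, ContDiffOn ℝ ∞ (α.inChart p)
    ((extChartAt (𝓡 d) p).target ∩ (extChartAt (𝓡 d) p).symm ⁻¹' U)

/-- `dα = β` on the open set `U`, the exterior derivative being computed in charts. -/
def DForm.HasExtDerivOn {k : ℕ} (α : DForm d k M) (β : DForm d (k + 1) M) (U : Set M) : Prop :=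
  ∀ p : M, ∀ y ∈ (extChartAt (𝓡 d) p).target, (extChartAt (𝓡 d) p).symm y ∈ U →
    extDeriv (α.inChart p) y = β.inChart p y

/-- A symplectic form: a smooth, closed, nondegenerate `2`-form. -/
structure IsSymplectic (Ω : DForm d 2 M) : Prop where
  smooth : Ω.SmoothOn Set.univ
  closed : Ω.HasExtDerivOn 0 Set.univ
  nondegenerate : ∀ (x : M) (u : TangentSpace (𝓡 d) x), (∀ v, Ω x ![u, v] = 0) → u = 0

/-- The closed `2`-form `Ω` is integral: its class lies in the image of
`H²(M; ℤ) → H²(M; ℝ)`. This is expressed through the Čech–de Rham isomorphism: for some open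
cover `U` there are primitives `θ i` of `Ω` on `U i` and functions `f i j` on `U i ∩ U j` with
`θ j - θ i = d (f i j)`, such that the Čech `2`-cocycle `f i j + f j k - f i k` representing the
class of `Ω` takes integer values. -/
def IsIntegral (Ω : DForm d 2 M) : Prop :=
  ∃ (ι : Type) (U : ι → Set M) (θ : ι → DForm d 1 M) (f : ι → ι → M → ℝ),
    (∀ i, IsOpen (U i)) ∧ (⋃ i, U i) = Set.univ ∧
    (∀ i, (θ i).SmoothOn (U i)) ∧
    (∀ i, (θ i).HasExtDerivOn Ω (U i)) ∧
    (∀ i j, ContMDiffOn (𝓡 d) 𝓘(ℝ, ℝ) ∞ (f i j) (U i ∩ U j)) ∧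
    (∀ i j, ∀ x ∈ U i ∩ U j, ∀ v : TangentSpace (𝓡 d) x,
      θ j x ![v] - θ i x ![v] = mvfderiv (𝓡 d) (f i j) x v) ∧
    (∀ i j k, ∀ x ∈ U i ∩ U j ∩ U k, ∃ m : ℤ, f i j x + f j k x - f i k x = m)

/-! ### Almost complex structures and metrics -/

/-- A field of endomorphisms of the tangent spaces. -/
abbrev EndField (d : ℕ) (M : Type*) [TopologicalSpace M]
    [ChartedSpace (EuclideanSpace ℝ (Fin d)) M] : Type _ :=
  (x : M) → TangentSpace (𝓡 d) x →L[ℝ] TangentSpace (𝓡 d) x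

/-- `J` is a smooth almost complex structure compatible with the `2`-form `Ω`: `J² = -1`, `Ω` is
`J`-invariant, and `Ω(u, J u) > 0` for `u ≠ 0`. -/
structure IsCompatible [IsManifold (𝓡 d) ∞ M] (Ω : DForm d 2 M) (J : EndField d M) : Prop where
  smooth : ContMDiff (𝓡 d)
    ((𝓡 d).prod 𝓘(ℝ, EuclideanSpace ℝ (Fin d) →L[ℝ] EuclideanSpace ℝ (Fin d))) ∞
    (fun x => TotalSpace.mk' (EuclideanSpace ℝ (Fin d) →L[ℝ] EuclideanSpace ℝ (Fin d))
      (E := fun x : M => TangentSpace (𝓡 d) x →L[ℝ] TangentSpace (𝓡 d) x) x (J x))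
  sq : ∀ (x : M) (u : TangentSpace (𝓡 d) x), J x (J x u) = -u
  invariant : ∀ (x : M) (u v : TangentSpace (𝓡 d) x), Ω x ![J x u, J x v] = Ω x ![u, v]
  pos : ∀ (x : M) (u : TangentSpace (𝓡 d) x), u ≠ 0 → 0 < Ω x ![u, J x u]

/-- A field of bilinear forms on the tangent spaces, as a bare function. -/
abbrev Tensor2 (d : ℕ) (M : Type*) [TopologicalSpace M]
    [ChartedSpace (EuclideanSpace ℝ (Fin d)) M] : Type _ :=
  (x : M) → TangentSpace (𝓡 d) x → TangentSpace (𝓡 d) x → ℝ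

/-- The constant multiple `t g_J` of the metric `g_J(u, v) = Ω(u, J v)`. -/
def scaledMetric (t : ℝ) (Ω : DForm d 2 M) (J : EndField d M) : Tensor2 d M :=
  fun x u v => t * Ω x ![u, J x v]

/-- The length of a tangent vector. -/
def tnorm (g : Tensor2 d M) {x : M} (v : TangentSpace (𝓡 d) x) : ℝ := √(g x v v)

/-- `D` is the Levi-Civita connection of `g`: it is torsion-free and metric. -/
structure IsLeviCivita [IsManifold (𝓡 d) ∞ M] (g : Tensor2 d M)
    (D : CovariantDerivative (𝓡 d) (EuclideanSpace ℝ (Fin d))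
      (fun x : M => TangentSpace (𝓡 d) x)) : Prop where
  torsion_eq_zero : D.torsion = 0
  metric : ∀ (x : M) (X Y Z : (y : M) → TangentSpace (𝓡 d) y),
    MDifferentiableAt (𝓡 d) ((𝓡 d).prod 𝓘(ℝ, EuclideanSpace ℝ (Fin d)))
      (fun y => TotalSpace.mk' (EuclideanSpace ℝ (Fin d)) y (X y)) x →
    MDifferentiableAt (𝓡 d) ((𝓡 d).prod 𝓘(ℝ, EuclideanSpace ℝ (Fin d)))
      (fun y => TotalSpace.mk' (EuclideanSpace ℝ (Fin d)) y (Y y)) x →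
    MDifferentiableAt (𝓡 d) ((𝓡 d).prod 𝓘(ℝ, EuclideanSpace ℝ (Fin d)))
      (fun y => TotalSpace.mk' (EuclideanSpace ℝ (Fin d)) y (Z y)) x →
    mvfderiv (𝓡 d) (fun y => g y (Y y) (Z y)) x (X x) =
      g x (D Y x (X x)) (Z x) + g x (Y x) (D Z x (X x))

/-! ### Symplectic submanifolds -/

/-- `Z` is a symplectic submanifold of `(M, Ω)` of codimension `c`: it is an embedded smooth
submanifold (near each of its points, some smooth chart `φ` maps it to an affine subspace
with direction `V`), and `Ω` is nondegenerate on its tangent spaces `T_z Z = (dφ_z)⁻¹ V`. -/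
def IsSymplecticSubmanifold (Ω : DForm d 2 M) (Z : Set M) (c : ℕ) : Prop :=
  ∀ z ∈ Z, ∃ φ ∈ IsManifold.maximalAtlas (𝓡 d) ∞ M, z ∈ φ.source ∧
    ∃ V : Submodule ℝ (EuclideanSpace ℝ (Fin d)),
      Module.finrank ℝ V + c = d ∧
      (∀ y ∈ φ.source, y ∈ Z ↔ φ y - φ z ∈ V) ∧
      ∀ u : TangentSpace (𝓡 d) z, mvfderiv (𝓡 d) φ z u ∈ V →
        (∀ v : TangentSpace (𝓡 d) z, mvfderiv (𝓡 d) φ z v ∈ V → Ω z ![u, v] = 0) → u = 0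

end Manifolds

/-! ### Sections of complex vector bundles

A complex vector bundle is a smooth real vector bundle `E` together with a smooth field `j` of
endomorphisms of its fibres with `j² = -1`. It carries a fibre metric `h` and a connection `cov`
(`cov s x v` is `∇_v s` at `x`). No relation between `j`, `h` and `cov` is required, so
that Hermitian metrics and complex linear or unitary connections are special cases. -/

section Sections

variable {d : ℕ} {M : Type*} [TopologicalSpace M] [ChartedSpace (EuclideanSpace ℝ (Fin d)) M]
  [IsManifold (𝓡 d) ∞ M]
  {F : Type*} [NormedAddCommGroup F] [NormedSpace ℝ F]
  {E : M → Type*} [TopologicalSpace (TotalSpace F E)]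
  [∀ x, AddCommGroup (E x)] [∀ x, Module ℝ (E x)] [∀ x, TopologicalSpace (E x)]
  [∀ x, IsTopologicalAddGroup (E x)] [∀ x, ContinuousSMul ℝ (E x)]
  [FiberBundle F E] [VectorBundle ℝ F E]

/-- A smooth complex structure on the fibres of a real vector bundle. -/
structure IsComplexStructure (F : Type*) [NormedAddCommGroup F] [NormedSpace ℝ F]
    {E : M → Type*} [TopologicalSpace (TotalSpace F E)]
    [∀ x, AddCommGroup (E x)] [∀ x, Module ℝ (E x)] [∀ x, TopologicalSpace (E x)]
    [∀ x, IsTopologicalAddGroup (E x)] [∀ x, ContinuousSMul ℝ (E x)]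
    [FiberBundle F E] [VectorBundle ℝ F E] (j : (x : M) → E x →L[ℝ] E x) : Prop where
  smooth : ContMDiff (𝓡 d) ((𝓡 d).prod 𝓘(ℝ, F →L[ℝ] F)) ∞
    (fun x => TotalSpace.mk' (F →L[ℝ] F) (E := fun x : M => E x →L[ℝ] E x) x (j x))
  sq : ∀ (x : M) (e : E x), j x (j x e) = -e

/-- The length of an element of a fibre. -/
def fnorm (h : ContMDiffRiemannianMetric (𝓡 d) ∞ F E) {x : M} (e : E x) : ℝ :=
  √(h.inner x e e)

/-- The section `s` is `η`-transverse to `0`: wherever `|s| ≤ η`, the covariant derivative `∇s`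
has a right inverse of operator norm `< 1/η`. -/
def IsTransverse (g : Tensor2 d M) (h : ContMDiffRiemannianMetric (𝓡 d) ∞ F E)
    (cov : CovariantDerivative (𝓡 d) F E) (η : ℝ) (s : (x : M) → E x) : Prop :=
  ∀ x : M, fnorm h (s x) ≤ η →
    ∃ R : E x →ₗ[ℝ] TangentSpace (𝓡 d) x, (∀ e, cov s x (R e) = e) ∧
      ∃ K : ℝ, K < η⁻¹ ∧ ∀ e, tnorm g (R e) ≤ K * fnorm h e

/-- The `(0,1)`-part `½ (∇s + j ∘ ∇s ∘ J)` of `∇s`. -/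
def dbar (J : EndField d M) (j : (x : M) → E x →L[ℝ] E x)
    (cov : CovariantDerivative (𝓡 d) F E) (s : (x : M) → E x) :
    (x : M) → TangentSpace (𝓡 d) x →L[ℝ] E x :=
  fun x => (1 / 2 : ℝ) • (cov s x + (j x).comp ((cov s x).comp (J x)))

/-- `(∇_u A)(Y)` for an `E`-valued `1`-form `A`, with the connection on `T*M ⊗ E` induced by `D`
and `cov`: it is `∇_u (A(Y)) - A(D_u Y)`, which depends on `Y` only through its value at `x`. -/
def covOneForm (D : CovariantDerivative (𝓡 d) (EuclideanSpace ℝ (Fin d))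
      (fun x : M => TangentSpace (𝓡 d) x))
    (cov : CovariantDerivative (𝓡 d) F E) (A : (x : M) → TangentSpace (𝓡 d) x →L[ℝ] E x)
    (x : M) (u : TangentSpace (𝓡 d) x) (Y : (y : M) → TangentSpace (𝓡 d) y) : E x :=
  cov (fun y => A y (Y y)) x u - A x (D Y x u)

/-- Pointwise bound `|A| ≤ B` (operator norm) for an `E`-valued `1`-form. -/
def OneFormBound (g : Tensor2 d M) (h : ContMDiffRiemannianMetric (𝓡 d) ∞ F E)
    (A : (x : M) → TangentSpace (𝓡 d) x →L[ℝ] E x) (B : ℝ) : Prop :=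
  ∀ (x : M) (v : TangentSpace (𝓡 d) x), fnorm h (A x v) ≤ B * tnorm g v

/-- Pointwise bound `|∇A| ≤ B` (operator norm) for the covariant derivative of an `E`-valued
`1`-form. -/
def CovOneFormBound (g : Tensor2 d M) (h : ContMDiffRiemannianMetric (𝓡 d) ∞ F E)
    (D : CovariantDerivative (𝓡 d) (EuclideanSpace ℝ (Fin d))
      (fun x : M => TangentSpace (𝓡 d) x))
    (cov : CovariantDerivative (𝓡 d) F E)
    (A : (x : M) → TangentSpace (𝓡 d) x →L[ℝ] E x) (B : ℝ) : Prop :=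
  ∀ (x : M) (u : TangentSpace (𝓡 d) x) (Y : (y : M) → TangentSpace (𝓡 d) y),
    ContMDiff (𝓡 d) ((𝓡 d).prod 𝓘(ℝ, EuclideanSpace ℝ (Fin d))) ∞
      (fun y => TotalSpace.mk' (EuclideanSpace ℝ (Fin d)) y (Y y)) →
    fnorm h (covOneForm D cov A x u Y) ≤ B * tnorm g u * tnorm g (Y x)

/-- The section `s` is `C²`-approximately holomorphic with bounds `(C₁, c₁), (C₂, c₂)`:
`|∇^r s| ≤ C_r` and `|∇^{r-1} ∂̄s| ≤ C_r c_r^{-1/2}` for `r = 1, 2`, where `D` is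
the Levi-Civita connection of `g`. -/
structure IsC2ApproxHolomorphic (g : Tensor2 d M)
    (D : CovariantDerivative (𝓡 d) (EuclideanSpace ℝ (Fin d))
      (fun x : M => TangentSpace (𝓡 d) x))
    (J : EndField d M) (h : ContMDiffRiemannianMetric (𝓡 d) ∞ F E)
    (j : (x : M) → E x →L[ℝ] E x) (cov : CovariantDerivative (𝓡 d) F E)
    (C₁ c₁ C₂ c₂ : ℝ) (s : (x : M) → E x) : Prop where
  deriv_one : OneFormBound g h (cov s) C₁
  deriv_two : CovOneFormBound g h D cov (cov s) C₂
  dbar_zero : OneFormBound g h (dbar J j cov s) (C₁ / √c₁)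
  dbar_one : CovOneFormBound g h D cov (dbar J j cov s) (C₂ / √c₂)

end Sections

end SymplecticSections

end

set_option maxSynthPendingDepth 3

open Bundle Manifold
open scoped Manifold ContDiff Topology

noncomputable section

namespace SymplecticSections

-- The form `ω` is a small perturbation of a rational closed form `β`, and an integral multiple `c •
-- β` is the form sought. One almost complex structure `J'` is compatible with both `β` and `c • β`,
-- and `|β - ω| ≤ 1/4` in the metric `β(·, J' ·)`. With `δ = (8C/η)²` the bound on `∂̄s` is `C/√δ =
-- η/8`. At a zero of `s`, let `u ≠ 0` be in the kernel of `∇s`. Then `∇s(J'u) = 2 ∂̄s(J'u)` has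
-- length at most `η/4 |u|`, so the right inverse of norm `< 1/η` gives a vector `w` with `∇s w =
-- ∇s(J'u)` and `|w| ≤ |u|/4`. Now `J'u - w` is in the kernel, and `β` and `ω` are both positive on
-- `(u, J'u - w)`, because `β(u, J'u) = |u|²` dominates all the errors (`exists_pos_of_mem_ker`).
-- Only ratios of lengths occur, so positive multiples of the metric are harmless. The zero set is a
-- submanifold with tangent space `ker ∇s` by the implicit function theorem
-- (`isSymplecticSubmanifold_zeroSet`).
--
-- The rational form comes from the Čech–de Rham correspondence (`exists_integral_perturbation`). On
-- a finite good cover, obtained from an embedding in Euclidean space (`exists_good_cover`), the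
-- Poincaré lemma turns `ω` into a real Čech cocycle `c i j k`. A `ℚ`-linear map from the rational
-- span of these numbers to `ℚ`, close to the inclusion on the generators, replaces them by rational
-- numbers without destroying the cocycle identities. The difference is a small real cocycle, which
-- a partition of unity converts into a small closed form `cechForm`. Adding that form to `ω` gives
-- `β`; a common denominator gives the multiple.
--
-- The structure `J'` is the orthogonal factor `A(-A²)^(-1/2)` of the endomorphism `A` that
-- represents `β` in the metric of `(ω, J)`, the root being a binomial series
-- (`linCompatible_polarEnd`). Compactness of `M` makes the smallness of the perturbation uniform
-- (`eventually_goodTriple`).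

universe u

section Flat

open MeasureTheory intervalIntegral Set Filter

/-! ### Smooth families of alternating forms -/

section Alternating

variable {E F : Type*} [NormedAddCommGroup E] [NormedSpace ℝ E] [FiniteDimensional ℝ E]
  [NormedAddCommGroup F] [NormedSpace ℝ F]
  {X : Type*} [NormedAddCommGroup X] [NormedSpace ℝ X]

/-- Alternatizing the curried form returns `(k + 1) • β`, so `β` depends linearly on its
contractions. This permits induction on the degree. -/
theorem contDiffOn_of_curryLeft {k : ℕ} {m : WithTop ℕ∞} {s : Set X}
    {β : X → E [⋀^Fin (k + 1)]→L[ℝ] ℝ}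
    (h : ∀ v, ContDiffOn ℝ m (fun y => (β y).curryLeft v) s) : ContDiffOn ℝ m β s := by
  have h1 : ContDiffOn ℝ m (fun y => (β y).curryLeft) s := contDiffOn_clm_apply.2 h
  have h2 : ContDiffOn ℝ m (fun y => ((k : ℝ) + 1)⁻¹ •
      ContinuousAlternatingMap.alternatizeUncurryFinCLM ℝ E ℝ (β y).curryLeft) s :=
    ((ContinuousAlternatingMap.alternatizeUncurryFinCLM ℝ E ℝ).contDiff.comp_contDiffOn
      h1).const_smul _
  refine h2.congr fun y _ => ?_
  rw [ContinuousAlternatingMap.alternatizeUncurryFinCLM_apply,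
    ContinuousAlternatingMap.alternatizeUncurryFin_curryLeft]
  have : ((k : ℝ) + 1) ≠ 0 := by positivity
  rw [← Nat.cast_smul_eq_nsmul ℝ, smul_smul]
  push_cast
  rw [inv_mul_cancel₀ this, one_smul]

theorem contDiffOn_compContinuousLinearMap {k : ℕ} {m : WithTop ℕ∞} {s : Set X}
    {β : X → F [⋀^Fin k]→L[ℝ] ℝ} {T : X → E →L[ℝ] F}
    (hβ : ContDiffOn ℝ m β s) (hT : ContDiffOn ℝ m T s) :
    ContDiffOn ℝ m (fun y => (β y).compContinuousLinearMap (T y)) s := by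
  induction k with
  | zero =>
    have : (fun y => (β y).compContinuousLinearMap (T y)) =
        fun y => ContinuousAlternatingMap.constOfIsEmptyLIE ℝ E ℝ (Fin 0)
          ((ContinuousAlternatingMap.constOfIsEmptyLIE ℝ F ℝ (Fin 0)).symm (β y)) := by
      ext y v
      change β y _ = β y _
      congr 1
      exact Subsingleton.elim _ _
    rw [this]
    exact (LinearIsometryEquiv.contDiff _).comp_contDiffOn
      ((LinearIsometryEquiv.contDiff _).comp_contDiffOn hβ)
  | succ k ih =>
    refine contDiffOn_of_curryLeft fun v => ?_
    have h1 : ContDiffOn ℝ m (fun y => (β y).curryLeft (T y v)) s :=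
      ((ContinuousAlternatingMap.curryLeftLI.contDiff.comp_contDiffOn hβ)).clm_apply
        (hT.clm_apply contDiffOn_const)
    refine (ih h1).congr fun y _ => ?_
    simp [ContinuousAlternatingMap.curryLeft_compContinuousLinearMap]

end Alternating

/-! ### Integrals over `[0, 1]` depending smoothly on a parameter -/

section Parametric

variable {E G : Type*} [NormedAddCommGroup E] [NormedSpace ℝ E]
  [NormedAddCommGroup G] [NormedSpace ℝ G]

theorem contDiffAt_partial {F : E → ℝ → G} {y : E} {t : ℝ}
    (hF : ContDiffAt ℝ ∞ (Function.uncurry F) (y, t)) :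
    HasFDerivAt (fun z => F z t)
        ((fderiv ℝ (Function.uncurry F) (y, t)).comp (ContinuousLinearMap.inl ℝ E ℝ)) y ∧
      ContDiffAt ℝ ∞ (fun q : E × ℝ =>
        (fderiv ℝ (Function.uncurry F) q).comp (ContinuousLinearMap.inl ℝ E ℝ)) (y, t) := by
  constructor
  · have h1 := (hF.differentiableAt (by simp)).hasFDerivAt
    exact HasFDerivAt.comp (g := Function.uncurry F) (f := fun z => (z, t)) y h1
      (hasFDerivAt_prodMk_left y t)
  · exact (hF.fderiv_right (m := ∞) (by simp)).clm_comp contDiffAt_const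

/-- Differentiation under the integral sign. Compactness of `[0, 1]` bounds the partial derivative
uniformly for parameters near `y`, which supplies the dominating constant. -/
theorem hasFDerivAt_integral_of_contDiffAt {F : E → ℝ → G} {s : Set E} (hs : IsOpen s)
    (hF : ∀ y ∈ s, ∀ t ∈ Icc (0 : ℝ) 1, ContDiffAt ℝ ∞ (Function.uncurry F) (y, t))
    {y : E} (hy : y ∈ s) :
    IntervalIntegrable
      (fun t => (fderiv ℝ (Function.uncurry F) (y, t)).comp (ContinuousLinearMap.inl ℝ E ℝ))
      volume 0 1 ∧
    HasFDerivAt (fun y => ∫ t in (0 : ℝ)..1, F y t)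
      (∫ t in (0 : ℝ)..1,
        (fderiv ℝ (Function.uncurry F) (y, t)).comp (ContinuousLinearMap.inl ℝ E ℝ)) y := by
  set D : E → ℝ → E →L[ℝ] G := fun z t =>
    (fderiv ℝ (Function.uncurry F) (z, t)).comp (ContinuousLinearMap.inl ℝ E ℝ) with hD
  have hDc : ∀ z ∈ s, ∀ t ∈ Icc (0 : ℝ) 1, ContinuousAt (Function.uncurry D) (z, t) :=
    fun z hz t ht => (contDiffAt_partial (hF z hz t ht)).2.continuousAt
  have hcont : ∀ z ∈ s, ContinuousOn (F z) (Icc 0 1) := fun z hz t ht =>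
    ((hF z hz t ht).continuousAt.comp (f := fun t => (z, t))
      (by fun_prop : Continuous fun t : ℝ => (z, t)).continuousAt).continuousWithinAt
  have hcontD : ∀ z ∈ s, ContinuousOn (D z) (Icc 0 1) := fun z hz t ht =>
    ((hDc z hz t ht).comp (f := fun t => (z, t))
      (by fun_prop : Continuous fun t : ℝ => (z, t)).continuousAt).continuousWithinAt
  have hI : uIoc (0 : ℝ) 1 ⊆ Icc 0 1 := by
    rw [uIoc_of_le zero_le_one]; exact Ioc_subset_Icc_self
  have hIcc : uIcc (0 : ℝ) 1 = Icc 0 1 := uIcc_of_le zero_le_one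
  obtain ⟨B, hB⟩ := isCompact_Icc.exists_bound_of_continuousOn (hcontD y hy)
  have hev : ∀ᶠ z in 𝓝 y, ∀ t ∈ Icc (0 : ℝ) 1, ‖D z t‖ ≤ B + 1 := by
    refine isCompact_Icc.eventually_forall_of_forall_eventually fun t ht => ?_
    have h1 : ∀ᶠ q in 𝓝 (y, t), ‖Function.uncurry D q‖ < B + 1 :=
      (hDc y hy t ht).norm.eventually_lt_const (by
        have := hB t ht
        simp only [Function.uncurry_apply_pair]
        linarith)
    filter_upwards [h1] with q hq using hq.le
  have hsn : {z | z ∈ s ∧ ∀ t ∈ Icc (0 : ℝ) 1, ‖D z t‖ ≤ B + 1} ∈ 𝓝 y :=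
    inter_mem (hs.mem_nhds hy) hev
  have hint : IntervalIntegrable (D y) volume 0 1 :=
    ContinuousOn.intervalIntegrable (by rw [hIcc]; exact hcontD y hy)
  refine ⟨hint, intervalIntegral.hasFDerivAt_integral_of_dominated_of_fderiv_le (F' := D) hsn
    ?_ ?_ ?_ (bound := fun _ => B + 1) ?_ ?_ ?_⟩
  · filter_upwards [hs.mem_nhds hy] with z hz
    exact (ContinuousOn.intervalIntegrable (by rw [hIcc]; exact hcont z hz)).def'.1
  · exact ContinuousOn.intervalIntegrable (by rw [hIcc]; exact hcont y hy)
  · exact hint.def'.1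
  · exact Eventually.of_forall fun t ht z hz => hz.2 t (hI ht)
  · exact intervalIntegrable_const
  · exact Eventually.of_forall fun t ht z hz => (contDiffAt_partial (hF z hz.1 t (hI ht))).1

/-- Induction on the order: the derivative is an integral of the same kind with values in `E →L[ℝ]
G`. Hence `G` varies in the induction, and `E` and `G` share a universe so that the new target stays
in it. -/
theorem contDiffOn_integral_of_contDiffAt {E G : Type u} [NormedAddCommGroup E]
    [NormedSpace ℝ E] [NormedAddCommGroup G] [NormedSpace ℝ G]
    {F : E → ℝ → G} {s : Set E} (hs : IsOpen s)
    (hF : ∀ y ∈ s, ∀ t ∈ Icc (0 : ℝ) 1, ContDiffAt ℝ ∞ (Function.uncurry F) (y, t)) :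
    ContDiffOn ℝ ∞ (fun y => ∫ t in (0 : ℝ)..1, F y t) s := by
  rw [contDiffOn_infty]
  intro m
  induction m generalizing G with
  | zero =>
    exact contDiffOn_zero.2 fun y hy =>
      (hasFDerivAt_integral_of_contDiffAt hs hF hy).2.continuousAt.continuousWithinAt
  | succ m ih =>
    push_cast
    rw [contDiffOn_succ_iff_fderiv_of_isOpen hs]
    refine ⟨fun y hy => (hasFDerivAt_integral_of_contDiffAt hs hF
      hy).2.differentiableAt.differentiableWithinAt, by simp, ?_⟩
    refine (ih (F := fun y t => (fderiv ℝ (Function.uncurry F) (y, t)).comp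
      (ContinuousLinearMap.inl ℝ E ℝ)) fun y hy t ht => (contDiffAt_partial (hF y hy t ht)).2).congr
      fun y hy => (hasFDerivAt_integral_of_contDiffAt hs hF hy).2.fderiv

end Parametric

/-! ### The Poincaré lemma in degrees one and two on convex open sets -/

section Poincare

variable {E : Type*} [NormedAddCommGroup E] [NormedSpace ℝ E]

theorem extDeriv_one_apply {θ : E → E [⋀^Fin 1]→L[ℝ] ℝ} {y : E}
    (u v : E) : extDeriv θ y ![u, v] = fderiv ℝ θ y u ![v] - fderiv ℝ θ y v ![u] := by
  rw [extDeriv, ContinuousAlternatingMap.alternatizeUncurryFin_apply]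
  have : Fin.removeNth 1 ![u, v] = ![u] := by ext i; fin_cases i; rfl
  simp [Fin.sum_univ_two, this, sub_eq_add_neg]

theorem extDeriv_two_apply {Ω : E → E [⋀^Fin 2]→L[ℝ] ℝ} {y : E}
    (u v w : E) : extDeriv Ω y ![u, v, w] =
      fderiv ℝ Ω y u ![v, w] - fderiv ℝ Ω y v ![u, w] + fderiv ℝ Ω y w ![u, v] := by
  rw [extDeriv, ContinuousAlternatingMap.alternatizeUncurryFin_apply]
  have h1 : Fin.removeNth 1 ![u, v, w] = ![u, w] := by ext i; fin_cases i <;> rfl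
  have h2 : Fin.removeNth 2 ![u, v, w] = ![u, v] := by ext i; fin_cases i <;> rfl
  simp [Fin.sum_univ_three, h1, h2, sub_eq_add_neg]

/-- Closedness says that the derivative of the covector field is symmetric, which is the
integrability condition on a convex set. -/
theorem exists_primitive_of_closed_one {θ : E → E [⋀^Fin 1]→L[ℝ] ℝ} {s : Set E}
    (hs : IsOpen s) (hc : Convex ℝ s) (hθ : ContDiffOn ℝ ∞ θ s)
    (h0 : ∀ y ∈ s, extDeriv θ y = 0) :
    ∃ f : E → ℝ, ContDiffOn ℝ ∞ f s ∧ ∀ y ∈ s, ∀ v, fderiv ℝ f y v = θ y ![v] := by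
  let e := (ContinuousAlternatingMap.ofSubsingletonLIE (𝕜 := ℝ) (E := E) (F := ℝ) (0 : Fin 1)).symm
  have he : ∀ α v, e α v = α ![v] := fun α v => by
    change α _ = α _
    congr 1
    ext i; fin_cases i; rfl
  have heθ : ContDiffOn ℝ ∞ (fun y => e (θ y)) s := e.contDiff.comp_contDiffOn hθ
  have hd : ∀ y ∈ s, ∀ u, fderiv ℝ (fun y => e (θ y)) y u = e (fderiv ℝ θ y u) := by
    intro y hy u
    have := (hθ.contDiffAt (hs.mem_nhds hy)).differentiableAt (by simp)
    have h := HasFDerivAt.comp (g := e) y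
      e.toContinuousLinearEquiv.toContinuousLinearMap.hasFDerivAt this.hasFDerivAt
    exact congrArg (fun T => T u) h.fderiv
  obtain ⟨f, hf⟩ := hc.exists_forall_hasFDerivAt_of_fderiv_symmetric hs
    (heθ.differentiableOn (by simp)) (fun y hy u v => by
      have := congrArg (fun α => α ![u, v]) (h0 y hy)
      simp only [extDeriv_one_apply, ContinuousAlternatingMap.coe_zero, Pi.zero_apply] at this
      rw [hd y hy, hd y hy, he, he]
      linarith)
  refine ⟨f, ?_, fun y hy v => by rw [(hf y hy).fderiv, he]⟩
  rw [contDiffOn_infty_iff_fderiv_of_isOpen hs]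
  exact ⟨fun y hy => (hf y hy).differentiableAt.differentiableWithinAt,
    heθ.congr fun y hy => (hf y hy).fderiv⟩

theorem contDiff_curryLeft {k : ℕ} {m : WithTop ℕ∞} :
    ContDiff ℝ m (fun α : E [⋀^Fin (k + 1)]→L[ℝ] ℝ => α.curryLeft) :=
  (ContinuousAlternatingMap.curryLeftLI (𝕜 := ℝ) (E := E) (F := ℝ)
    (n := k)).toContinuousLinearMap.contDiff

theorem hasFDerivAt_curryLeft {k : ℕ} (α : E [⋀^Fin (k + 1)]→L[ℝ] ℝ) :
    HasFDerivAt (fun α : E [⋀^Fin (k + 1)]→L[ℝ] ℝ => α.curryLeft)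
      (ContinuousAlternatingMap.curryLeftLI (𝕜 := ℝ) (E := E) (F := ℝ)
        (n := k)).toContinuousLinearMap α :=
  (ContinuousAlternatingMap.curryLeftLI (𝕜 := ℝ) (E := E) (F := ℝ)
    (n := k)).toContinuousLinearMap.hasFDerivAt

theorem intervalIntegral_apply_apply {T : ℝ → E →L[ℝ] E [⋀^Fin 1]→L[ℝ] ℝ} {a b : ℝ}
    (hT : IntervalIntegrable T volume a b) (u v : E) :
    IntervalIntegrable (fun t => T t u ![v]) volume a b ∧
      (∫ t in a..b, T t) u ![v] = ∫ t in a..b, T t u ![v] := by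
  let ℓ : (E →L[ℝ] E [⋀^Fin 1]→L[ℝ] ℝ) →L[ℝ] ℝ :=
    (ContinuousAlternatingMap.apply ℝ E ℝ ![v]).comp (ContinuousLinearMap.apply ℝ _ u)
  have h : ∀ t, ℓ t = t u ![v] := fun _ => rfl
  have h1 := ℓ.intervalIntegral_comp_comm hT
  simp only [h] at h1
  have h2 := ℓ.integrable_comp hT.1
  have h3 := ℓ.integrable_comp hT.2
  simp only [h] at h2 h3
  exact ⟨⟨h2, h3⟩, h1.symm⟩

/-- The cone formula `θ_y(v) = ∫ t Ω_{p + t(y - p)}(y - p, v) dt` with vertex `p ∈ s`. -/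
theorem exists_primitive_of_closed_two {Ω : E → E [⋀^Fin 2]→L[ℝ] ℝ} {s : Set E}
    (hs : IsOpen s) (hc : Convex ℝ s) (hΩ : ContDiffOn ℝ ∞ Ω s)
    (h0 : ∀ y ∈ s, extDeriv Ω y = 0) :
    ∃ θ : E → E [⋀^Fin 1]→L[ℝ] ℝ, ContDiffOn ℝ ∞ θ s ∧ ∀ y ∈ s, extDeriv θ y = Ω y := by
  rcases s.eq_empty_or_nonempty with rfl | ⟨p, hp⟩
  · exact ⟨0, contDiffOn_empty, by simp⟩
  let q : E → ℝ → E := fun y t => p + t • (y - p)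
  have hq : ∀ y ∈ s, ∀ t ∈ Icc (0 : ℝ) 1, q y t ∈ s := fun y hy t ht =>
    hc.add_smul_sub_mem hp hy ht
  let K : E → ℝ → E [⋀^Fin 1]→L[ℝ] ℝ := fun y t => t • (Ω (q y t)).curryLeft (y - p)
  have hΩd : ∀ y ∈ s, HasFDerivAt Ω (fderiv ℝ Ω y) y := fun y hy =>
    ((hΩ.contDiffAt (hs.mem_nhds hy)).differentiableAt (by simp)).hasFDerivAt
  have hK : ∀ y ∈ s, ∀ t ∈ Icc (0 : ℝ) 1, ContDiffAt ℝ ∞ (Function.uncurry K) (y, t) := by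
    intro y hy t ht
    have h1 : ContDiffAt ℝ ∞ (fun z : E × ℝ => Ω (q z.1 z.2)) (y, t) :=
      (hΩ.contDiffAt (hs.mem_nhds (hq y hy t ht))).comp (f := fun z : E × ℝ => q z.1 z.2) (y, t)
        (by simp only [q]; fun_prop)
    have h2 : ContDiffAt ℝ ∞ (fun z : E × ℝ => (Ω (q z.1 z.2)).curryLeft) (y, t) :=
      contDiff_curryLeft.contDiffAt.comp (f := fun z : E × ℝ => Ω (q z.1 z.2)) (y, t) h1
    exact contDiffAt_snd.smul (h2.clm_apply (contDiffAt_fst.sub contDiffAt_const))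
  have hKd : ∀ y ∈ s, ∀ t ∈ Icc (0 : ℝ) 1, ∀ u v,
      fderiv ℝ (Function.uncurry K) (y, t) (u, 0) ![v] =
        t * (t * fderiv ℝ Ω (q y t) u ![y - p, v] + Ω (q y t) ![u, v]) := by
    intro y hy t ht u v
    have h1 := (contDiffAt_partial (hK y hy t ht)).1
    have h2 : HasFDerivAt (fun z => q z t) (t • ContinuousLinearMap.id ℝ E) y := by
      exact (((hasFDerivAt_id y).sub_const p).const_smul t).const_add p
    have h3 : HasFDerivAt (fun z => (Ω (q z t)).curryLeft) _ y :=
      HasFDerivAt.comp (f := fun z => Ω (q z t)) y (hasFDerivAt_curryLeft _)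
        (HasFDerivAt.comp (g := Ω) (f := fun z => q z t) y (hΩd _ (hq y hy t ht)) h2)
    have h4 : HasFDerivAt (fun z => K z t) _ y :=
      (h3.clm_apply ((hasFDerivAt_id y).sub_const p)).const_smul t
    have h5 := congrArg (fun T => T u ![v]) (h1.unique h4)
    simp only [id] at h5
    generalize y - p = w at h5 ⊢
    simp at h5
    rw [h5]
    ring
  have hKint := fun y hy => hasFDerivAt_integral_of_contDiffAt hs hK (y := y) hy
  refine ⟨fun y => ∫ t in (0 : ℝ)..1, K y t, contDiffOn_integral_of_contDiffAt hs hK,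
    fun y hy => ?_⟩
  ext w
  obtain ⟨u, v, rfl⟩ : ∃ u v, w = ![u, v] := ⟨w 0, w 1, by ext i; fin_cases i <;> rfl⟩
  have happ : ∀ u v, IntervalIntegrable
      (fun t => fderiv ℝ (Function.uncurry K) (y, t) (u, 0) ![v]) volume 0 1 ∧
      (∫ t in (0 : ℝ)..1, (fderiv ℝ (Function.uncurry K) (y, t)).comp
        (ContinuousLinearMap.inl ℝ E ℝ)) u ![v] =
      ∫ t in (0 : ℝ)..1, fderiv ℝ (Function.uncurry K) (y, t) (u, 0) ![v] := by
    intro u v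
    exact intervalIntegral_apply_apply (hKint y hy).1 u v
  rw [extDeriv_one_apply, (hKint y hy).2.fderiv, (happ u v).2, (happ v u).2,
    ← intervalIntegral.integral_sub (happ u v).1 (happ v u).1]
  -- The integrand of `dθ(u, v)` is the `t`-derivative of `t² Ω(u, v)` along the ray; closedness
  -- replaces the terms differentiated along `u` and `v` by the one differentiated along `y - p`.
  have hder : ∀ t ∈ Icc (0 : ℝ) 1, HasDerivAt (fun t => t ^ 2 * Ω (q y t) ![u, v])
      (fderiv ℝ (Function.uncurry K) (y, t) (u, 0) ![v] -
        fderiv ℝ (Function.uncurry K) (y, t) (v, 0) ![u]) t := by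
    intro t ht
    have h1 : HasDerivAt (fun t => q y t) (y - p) t := by
      have := ((hasDerivAt_id t).smul_const (y - p)).const_add p
      rwa [one_smul] at this
    have h2 : HasDerivAt (fun t => Ω (q y t)) _ t :=
      (hΩd _ (hq y hy t ht)).comp_hasDerivAt t h1
    have h3 : HasDerivAt (fun t => Ω (q y t) ![u, v]) _ t :=
      (ContinuousAlternatingMap.apply ℝ E ℝ ![u, v]).hasFDerivAt.comp_hasDerivAt t h2
    have h4 := ((hasDerivAt_id t).pow 2).mul h3
    refine h4.congr_deriv ?_
    rw [hKd y hy t ht, hKd y hy t ht]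
    have hcl := congrArg (fun α => α ![y - p, u, v]) (h0 _ (hq y hy t ht))
    simp only [extDeriv_two_apply, ContinuousAlternatingMap.coe_zero, Pi.zero_apply] at hcl
    have hsk : Ω (q y t) ![v, u] = - Ω (q y t) ![u, v] := by
      have := (Ω (q y t)).toAlternatingMap.map_swap ![u, v] (i := 0) (j := 1) (by decide)
      rw [← show (![u, v] ∘ Equiv.swap (0 : Fin 2) 1) = ![v, u] by
        ext i; fin_cases i <;> rfl]
      exact this
    rw [hsk]
    generalize y - p = w at hcl ⊢
    simp
    linear_combination t ^ 2 * hcl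
  rw [intervalIntegral.integral_eq_sub_of_hasDerivAt (fun t ht => hder t (by
    rwa [uIcc_of_le zero_le_one] at ht)) ((happ u v).1.sub (happ v u).1)]
  simp [q]

end Poincare

end Flat

theorem minSmoothness_two_le_infty : minSmoothness ℝ 2 ≤ (∞ : WithTop ℕ∞) := by
  rw [minSmoothness_of_isRCLikeNormedField]
  exact WithTop.coe_le_coe.2 (le_top : (2 : ℕ∞) ≤ ⊤)

/-! ### Forms in charts, and change of chart -/

section Charts

open Set Filter

variable {d : ℕ} {M : Type*} [TopologicalSpace M] [ChartedSpace (EuclideanSpace ℝ (Fin d)) M]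

/-- The derivative at `x` of the chart of `M` at `p`. -/
def tcoord (p x : M) : TangentSpace (𝓡 d) x →L[ℝ] EuclideanSpace ℝ (Fin d) :=
  mfderiv (𝓡 d) 𝓘(ℝ, EuclideanSpace ℝ (Fin d)) (extChartAt (𝓡 d) p) x

/-- The derivative at `y` of the inverse of the chart of `M` at `p`. -/
def tcoordSymm (p : M) (y : EuclideanSpace ℝ (Fin d)) :
    EuclideanSpace ℝ (Fin d) →L[ℝ] TangentSpace (𝓡 d) ((extChartAt (𝓡 d) p).symm y) :=
  mfderiv 𝓘(ℝ, EuclideanSpace ℝ (Fin d)) (𝓡 d) (extChartAt (𝓡 d) p).symm y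

/-- The transition map from the chart at `p'` to the chart at `p`. -/
def transition (p p' : M) : EuclideanSpace ℝ (Fin d) → EuclideanSpace ℝ (Fin d) :=
  fun y => extChartAt (𝓡 d) p ((extChartAt (𝓡 d) p').symm y)

/-- The image of a subset of `M` in the chart at `p`. -/
def chartImage (p : M) (U : Set M) : Set (EuclideanSpace ℝ (Fin d)) :=
  (extChartAt (𝓡 d) p).target ∩ (extChartAt (𝓡 d) p).symm ⁻¹' U

theorem isOpen_chartImage (p : M) {U : Set M} (hU : IsOpen U) :
    IsOpen (chartImage (d := d) p U) :=
  (continuousOn_extChartAt_symm p).isOpen_inter_preimage (isOpen_extChartAt_target p) hU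

theorem mem_chartImage {p : M} {U : Set M} {x : M} (hx : x ∈ (extChartAt (𝓡 d) p).source)
    (hU : x ∈ U) : extChartAt (𝓡 d) p x ∈ chartImage p U :=
  ⟨(extChartAt (𝓡 d) p).map_source hx, by
    rwa [mem_preimage, (extChartAt (𝓡 d) p).left_inv hx]⟩

theorem inChart_apply {k : ℕ} (α : DForm d k M) (p : M) (y : EuclideanSpace ℝ (Fin d))
    (v : Fin k → EuclideanSpace ℝ (Fin d)) :
    α.inChart p y v = α ((extChartAt (𝓡 d) p).symm y) (fun i => tcoordSymm p y (v i)) := rfl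

theorem transition_mem {p p' : M} {U : Set M} {y : EuclideanSpace ℝ (Fin d)}
    (hy : y ∈ chartImage (d := d) p' U) (hU : U ⊆ (extChartAt (𝓡 d) p).source) :
    transition p p' y ∈ chartImage (d := d) p U :=
  mem_chartImage (hU hy.2) hy.2

theorem inChart_congr {k : ℕ} {α β : DForm d k M} {U : Set M} (h : ∀ x ∈ U, α x = β x) {p : M}
    {y : EuclideanSpace ℝ (Fin d)} (hy : y ∈ chartImage (d := d) p U) :
    α.inChart p y = β.inChart p y := by
  simp only [DForm.inChart]
  rw [h _ hy.2]

section Algebra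

variable {k : ℕ} {α β : DForm d k M} {γ δ : DForm d (k + 1) M} {U V : Set M}

theorem DForm.SmoothOn.mono (h : α.SmoothOn U) (hV : V ⊆ U) : α.SmoothOn V :=
  fun p => (h p).mono (inter_subset_inter_right _ (preimage_mono hV))

theorem DForm.HasExtDerivOn.mono (h : α.HasExtDerivOn γ U) (hV : V ⊆ U) : α.HasExtDerivOn γ V :=
  fun p y hy hyV => h p y hy (hV hyV)

theorem DForm.SmoothOn.contDiffAt (h : α.SmoothOn U) (hU : IsOpen U) {p : M}
    {y : EuclideanSpace ℝ (Fin d)} (hy : y ∈ chartImage p U) :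
    ContDiffAt ℝ ∞ (α.inChart p) y :=
  (h p).contDiffAt ((isOpen_chartImage p hU).mem_nhds hy)

theorem DForm.SmoothOn.differentiableAt (h : α.SmoothOn U) (hU : IsOpen U) {p : M}
    {y : EuclideanSpace ℝ (Fin d)} (hy : y ∈ chartImage p U) :
    DifferentiableAt ℝ (α.inChart p) y :=
  (h.contDiffAt hU hy).differentiableAt (by simp)

theorem DForm.HasExtDerivOn.congr (h : α.HasExtDerivOn γ U) (hU : IsOpen U)
    (hβ : ∀ x ∈ U, β x = α x) (hδ : ∀ x ∈ U, δ x = γ x) : β.HasExtDerivOn δ U := by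
  intro p y hy hyU
  have h1 : β.inChart p =ᶠ[𝓝 y] α.inChart p := by
    filter_upwards [(isOpen_chartImage p hU).mem_nhds ⟨hy, hyU⟩] with z hz
    exact inChart_congr hβ hz
  rw [h1.extDeriv_eq, h p y hy hyU, inChart_congr hδ ⟨hy, hyU⟩]

theorem hasExtDerivOn_of_local (h : ∀ x ∈ U, ∃ V, x ∈ V ∧ α.HasExtDerivOn γ V) :
    α.HasExtDerivOn γ U := by
  intro p y hy hyU
  obtain ⟨V, hxV, hα⟩ := h _ hyU
  exact hα p y hy hxV

theorem DForm.SmoothOn.add (hα : α.SmoothOn U) (hβ : β.SmoothOn U) : (α + β).SmoothOn U :=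
  fun p => ((hα p).add (hβ p)).congr fun _ _ => rfl

theorem DForm.SmoothOn.const_smul (c : ℝ) (hα : α.SmoothOn U) : (c • α).SmoothOn U :=
  fun p => ((hα p).const_smul c).congr fun _ _ => rfl

theorem smoothOn_zero : (0 : DForm d k M).SmoothOn U := fun p =>
  (contDiffOn_const (c := (0 : EuclideanSpace ℝ (Fin d) [⋀^Fin k]→L[ℝ] ℝ))).congr fun _ _ => rfl

theorem smoothOn_sum {ι : Type*} {s : Finset ι} {α : ι → DForm d k M}
    (h : ∀ i ∈ s, (α i).SmoothOn U) : (∑ i ∈ s, α i).SmoothOn U := by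
  classical
  induction s using Finset.induction_on with
  | empty => simpa using smoothOn_zero
  | insert i s hi ih =>
    rw [Finset.sum_insert hi]
    exact (h i (Finset.mem_insert_self _ _)).add (ih fun j hj => h j (Finset.mem_insert_of_mem hj))

theorem DForm.HasExtDerivOn.add (hU : IsOpen U) (hα : α.SmoothOn U) (hβ : β.SmoothOn U)
    (h : α.HasExtDerivOn γ U) (h' : β.HasExtDerivOn δ U) : (α + β).HasExtDerivOn (γ + δ) U := by
  intro p y hy hyU
  have h1 : (α + β).inChart p = α.inChart p + β.inChart p := rfl
  rw [h1, extDeriv_add (hα.differentiableAt hU ⟨hy, hyU⟩) (hβ.differentiableAt hU ⟨hy, hyU⟩),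
    h p y hy hyU, h' p y hy hyU]
  rfl

theorem DForm.HasExtDerivOn.const_smul (c : ℝ) (h : α.HasExtDerivOn γ U) :
    (c • α).HasExtDerivOn (c • γ) U := by
  intro p y hy hyU
  have h1 : (c • α).inChart p = c • α.inChart p := rfl
  rw [h1, extDeriv_smul, h p y hy hyU]
  rfl

theorem hasExtDerivOn_zero : (0 : DForm d k M).HasExtDerivOn 0 U := by
  intro p y _ _
  have h1 : (0 : DForm d k M).inChart p = 0 := rfl
  have h2 : (0 : DForm d (k + 1) M).inChart p = 0 := rfl
  rw [h1, h2, extDeriv]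
  ext v
  simp [ContinuousAlternatingMap.alternatizeUncurryFin_apply]

theorem hasExtDerivOn_sum {ι : Type*} {s : Finset ι} {α : ι → DForm d k M}
    {γ : ι → DForm d (k + 1) M} (hU : IsOpen U) (hα : ∀ i ∈ s, (α i).SmoothOn U)
    (h : ∀ i ∈ s, (α i).HasExtDerivOn (γ i) U) :
    (∑ i ∈ s, α i).HasExtDerivOn (∑ i ∈ s, γ i) U := by
  classical
  induction s using Finset.induction_on with
  | empty => simpa using hasExtDerivOn_zero
  | insert i s hi ih =>
    rw [Finset.sum_insert hi, Finset.sum_insert hi]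
    exact (h i (Finset.mem_insert_self _ _)).add hU (hα i (Finset.mem_insert_self _ _))
      (smoothOn_sum fun j hj => hα j (Finset.mem_insert_of_mem hj))
      (ih (fun j hj => hα j (Finset.mem_insert_of_mem hj))
        fun j hj => h j (Finset.mem_insert_of_mem hj))

/-- Forms which are exterior derivatives are closed. -/
theorem DForm.HasExtDerivOn.closed (hU : IsOpen U) (hα : α.SmoothOn U)
    (h : α.HasExtDerivOn γ U) : γ.HasExtDerivOn 0 U := by
  intro p y hy hyU
  have h1 : γ.inChart p =ᶠ[𝓝 y] extDeriv (α.inChart p) := by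
    filter_upwards [(isOpen_chartImage p hU).mem_nhds ⟨hy, hyU⟩] with z hz
    exact (h p z hz.1 hz.2).symm
  rw [h1.extDeriv_eq, extDeriv_extDeriv_apply (hα.contDiffAt hU ⟨hy, hyU⟩)
    minSmoothness_two_le_infty]
  rfl

end Algebra

variable [IsManifold (𝓡 d) ∞ M]

theorem tcoord_tcoordSymm {p : M} {y : EuclideanSpace ℝ (Fin d)}
    (hy : y ∈ (extChartAt (𝓡 d) p).target) (v : EuclideanSpace ℝ (Fin d)) :
    tcoord p ((extChartAt (𝓡 d) p).symm y) (tcoordSymm p y v) = v := by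
  have : IsManifold (𝓡 d) 1 M := IsManifold.of_le (n := ∞) (by simp)
  have h := mfderiv_extChartAt_comp_mfderivWithin_extChartAt_symm (I := 𝓡 d) hy
  rw [ModelWithCorners.range_eq_univ, mfderivWithin_univ] at h
  exact congrArg (fun T => T v) h

theorem tcoordSymm_tcoord {p : M} {y : EuclideanSpace ℝ (Fin d)}
    (hy : y ∈ (extChartAt (𝓡 d) p).target)
    (v : TangentSpace (𝓡 d) ((extChartAt (𝓡 d) p).symm y)) :
    tcoordSymm p y (tcoord p ((extChartAt (𝓡 d) p).symm y) v) = v := by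
  have : IsManifold (𝓡 d) 1 M := IsManifold.of_le (n := ∞) (by simp)
  have h := mfderivWithin_extChartAt_symm_comp_mfderiv_extChartAt (I := 𝓡 d) hy
  rw [ModelWithCorners.range_eq_univ, mfderivWithin_univ] at h
  exact congrArg (fun T => T v) h

/-- The derivative of the chart at `p`, as an equivalence. -/
def tcoordEquiv (p x : M) (hx : x ∈ (extChartAt (𝓡 d) p).source) :
    TangentSpace (𝓡 d) x ≃L[ℝ] EuclideanSpace ℝ (Fin d) :=
  have : IsManifold (𝓡 d) 1 M := IsManifold.of_le (n := ∞) (by simp)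
  (isInvertible_mfderiv_extChartAt (I := 𝓡 d) hx).choose

theorem tcoordEquiv_apply {p x : M} (hx : x ∈ (extChartAt (𝓡 d) p).source)
    (v : TangentSpace (𝓡 d) x) : tcoordEquiv p x hx v = tcoord p x v := by
  have : IsManifold (𝓡 d) 1 M := IsManifold.of_le (n := ∞) (by simp)
  exact congrArg (fun T => T v) (isInvertible_mfderiv_extChartAt (I := 𝓡 d) hx).choose_spec

theorem form_eq_inChart {k : ℕ} (α : DForm d k M) {p x : M}
    (hx : x ∈ (extChartAt (𝓡 d) p).source) (v : Fin k → TangentSpace (𝓡 d) x) :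
    α x v = α.inChart p (extChartAt (𝓡 d) p x) (fun i => tcoord p x (v i)) := by
  obtain ⟨y, hy, rfl⟩ : ∃ y ∈ (extChartAt (𝓡 d) p).target, (extChartAt (𝓡 d) p).symm y = x :=
    ⟨_, (extChartAt (𝓡 d) p).map_source hx, (extChartAt (𝓡 d) p).left_inv hx⟩
  rw [(extChartAt (𝓡 d) p).right_inv hy, inChart_apply]
  congr 1
  ext1 i
  exact (tcoordSymm_tcoord hy (v i)).symm

theorem contDiffAt_transition {p p' : M} {y : EuclideanSpace ℝ (Fin d)}
    (hy : y ∈ chartImage p' (extChartAt (𝓡 d) p).source) :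
    ContDiffAt ℝ ∞ (transition (d := d) p p') y := by
  have h := contDiffWithinAt_ext_coord_change (I := 𝓡 d) (n := ∞) p p' (y := y)
    (by simpa [chartImage] using hy)
  rwa [ModelWithCorners.range_eq_univ, contDiffWithinAt_univ] at h

theorem fderiv_transition {p p' : M} {y : EuclideanSpace ℝ (Fin d)}
    (hy : y ∈ chartImage p' (extChartAt (𝓡 d) p).source) (v : EuclideanSpace ℝ (Fin d)) :
    fderiv ℝ (transition (d := d) p p') y v =
      tcoord p ((extChartAt (𝓡 d) p').symm y) (tcoordSymm p' y v) := by
  have : IsManifold (𝓡 d) 1 M := IsManifold.of_le (n := ∞) (by simp)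
  have h1 : MDifferentiableAt (𝓡 d) 𝓘(ℝ, EuclideanSpace ℝ (Fin d)) (extChartAt (𝓡 d) p)
      ((extChartAt (𝓡 d) p').symm y) :=
    mdifferentiableAt_extChartAt (by simpa using hy.2)
  have h2 : MDifferentiableAt 𝓘(ℝ, EuclideanSpace ℝ (Fin d)) (𝓡 d)
      (extChartAt (𝓡 d) p').symm y := by
    have := mdifferentiableWithinAt_extChartAt_symm (I := 𝓡 d) hy.1
    rwa [ModelWithCorners.range_eq_univ, mdifferentiableWithinAt_univ] at this
  have h3 := mfderiv_comp y h1 h2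
  rw [← mfderiv_eq_fderiv]
  exact congrArg (fun T => T v) h3

theorem inChart_transition {k : ℕ} (α : DForm d k M) {p p' : M} {y : EuclideanSpace ℝ (Fin d)}
    (hy : y ∈ chartImage p' (extChartAt (𝓡 d) p).source) :
    α.inChart p' y = (α.inChart p (transition p p' y)).compContinuousLinearMap
      (fderiv ℝ (transition p p') y) := by
  ext v
  rw [inChart_apply, form_eq_inChart α hy.2]
  simp only [ContinuousAlternatingMap.compContinuousLinearMap_apply, Function.comp_def,
    fderiv_transition hy]
  rfl

variable {k : ℕ} {α β : DForm d k M} {γ δ : DForm d (k + 1) M} {U V : Set M}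

/-- `SmoothOn` quantifies over all charts. As the transition maps are smooth, one chart whose domain
contains `U` is enough. -/
theorem smoothOn_of_inChart (p : M) (hp : U ⊆ (extChartAt (𝓡 d) p).source)
    (h : ContDiffOn ℝ ∞ (α.inChart p) (chartImage p U)) : α.SmoothOn U := by
  intro p'
  have hsub : ∀ y ∈ chartImage (d := d) p' U,
      y ∈ chartImage p' (extChartAt (𝓡 d) p).source := fun y hy => ⟨hy.1, hp hy.2⟩
  have h1 : ContDiffOn ℝ ∞ (fun y => (α.inChart p (transition p p' y)).compContinuousLinearMap
      (fderiv ℝ (transition p p') y)) (chartImage p' U) := by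
    refine contDiffOn_compContinuousLinearMap (h.comp (fun y hy =>
      (contDiffAt_transition (hsub y hy)).contDiffWithinAt) fun y hy => transition_mem hy hp) ?_
    exact fun y hy => ((contDiffAt_transition (hsub y hy)).fderiv_right
      (m := ∞) (by simp)).contDiffWithinAt
  exact h1.congr fun y hy => inChart_transition α (hsub y hy)

/-- The exterior derivative commutes with pull-back by the transition maps, so it can be verified in
a single chart. -/
theorem hasExtDerivOn_of_inChart (hU : IsOpen U) (p : M)
    (hp : U ⊆ (extChartAt (𝓡 d) p).source)
    (hα : ContDiffOn ℝ ∞ (α.inChart p) (chartImage p U))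
    (h : ∀ y ∈ chartImage (d := d) p U, extDeriv (α.inChart p) y = γ.inChart p y) :
    α.HasExtDerivOn γ U := by
  intro p' y hy hyU
  have hsub : ∀ y ∈ chartImage (d := d) p' U,
      y ∈ chartImage p' (extChartAt (𝓡 d) p).source := fun y hy => ⟨hy.1, hp hy.2⟩
  have hyc : y ∈ chartImage (d := d) p' U := ⟨hy, hyU⟩
  have h1 : α.inChart p' =ᶠ[𝓝 y] fun y => (α.inChart p (transition p p' y)).compContinuousLinearMap
      (fderiv ℝ (transition p p') y) := by
    filter_upwards [(isOpen_chartImage p' hU).mem_nhds hyc] with z hz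
    exact inChart_transition α (hsub z hz)
  have ht := transition_mem hyc hp
  rw [h1.extDeriv_eq, extDeriv_pullback (r := ∞)
    ((hα.contDiffAt ((isOpen_chartImage p hU).mem_nhds ht)).differentiableAt (by simp))
    (contDiffAt_transition (hsub y hyc)) minSmoothness_two_le_infty, h _ ht,
    inChart_transition γ (hsub y hyc)]

end Charts

/-! ### The forms `f dg` and `df ∧ dg` -/

section Wedge

open Set Filter

/-- The exterior product of two linear functionals. -/
def wedge {V : Type*} [AddCommGroup V] [Module ℝ V] [TopologicalSpace V] (a b : V →L[ℝ] ℝ) :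
    V [⋀^Fin 2]→L[ℝ] ℝ where
  toFun v := a (v 0) * b (v 1) - a (v 1) * b (v 0)
  map_update_add' v i x y := by fin_cases i <;> simp <;> ring
  map_update_smul' v i c x := by fin_cases i <;> simp <;> ring
  cont := by fun_prop
  map_eq_zero_of_eq' v i j h hij := by
    fin_cases i <;> fin_cases j <;> simp_all

theorem wedge_apply {V : Type*} [AddCommGroup V] [Module ℝ V] [TopologicalSpace V]
    (a b : V →L[ℝ] ℝ) (v : Fin 2 → V) : wedge a b v = a (v 0) * b (v 1) - a (v 1) * b (v 0) := rfl

/-- A linear functional as a `1`-form. -/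
def oneForm {V : Type*} [AddCommGroup V] [Module ℝ V] [TopologicalSpace V] (a : V →L[ℝ] ℝ) :
    V [⋀^Fin 1]→L[ℝ] ℝ := ContinuousAlternatingMap.ofSubsingleton ℝ V ℝ 0 a

theorem oneForm_apply {V : Type*} [AddCommGroup V] [Module ℝ V] [TopologicalSpace V]
    (a : V →L[ℝ] ℝ) (v : Fin 1 → V) : oneForm a v = a (v 0) := rfl

theorem contDiff_oneForm {V : Type*} [NormedAddCommGroup V] [NormedSpace ℝ V] :
    ContDiff ℝ ∞ (oneForm : (V →L[ℝ] ℝ) → _) :=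
  (ContinuousAlternatingMap.ofSubsingletonLIE (𝕜 := ℝ) (E := V) (F := ℝ) (0 : Fin 1)).contDiff

theorem contDiffOn_wedge {X V : Type*} [NormedAddCommGroup V] [NormedSpace ℝ V]
    [FiniteDimensional ℝ V] [NormedAddCommGroup X] [NormedSpace ℝ X] {a b : X → V →L[ℝ] ℝ}
    {s : Set X} (ha : ContDiffOn ℝ ∞ a s) (hb : ContDiffOn ℝ ∞ b s) :
    ContDiffOn ℝ ∞ (fun y => wedge (a y) (b y)) s := by
  refine contDiffOn_of_curryLeft fun v => ?_
  have h : ContDiffOn ℝ ∞ (fun y => a y v • oneForm (b y) - b y v • oneForm (a y)) s :=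
    ((ha.clm_apply contDiffOn_const).smul (contDiff_oneForm.comp_contDiffOn hb)).sub
      ((hb.clm_apply contDiffOn_const).smul (contDiff_oneForm.comp_contDiffOn ha))
  refine h.congr fun y _ => ?_
  ext w
  simp [wedge_apply, oneForm_apply, mul_comm]

/-- In the antisymmetrization the second derivatives of `b` cancel by symmetry, and only the
products of first derivatives remain. -/
theorem extDeriv_smul_oneForm_fderiv {V : Type*} [NormedAddCommGroup V] [NormedSpace ℝ V]
    {a b : V → ℝ} {y : V} (ha : ContDiffAt ℝ ∞ a y) (hb : ContDiffAt ℝ ∞ b y) :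
    extDeriv (fun z => a z • oneForm (fderiv ℝ b z)) y = wedge (fderiv ℝ a y) (fderiv ℝ b y) := by
  have hb' : ContDiffAt ℝ ∞ (fderiv ℝ b) y := hb.fderiv_right (by simp)
  have had := ha.differentiableAt (by simp)
  have hbd := hb'.differentiableAt (by simp)
  have h : ContDiffAt ℝ ∞ (fun z => a z • oneForm (fderiv ℝ b z)) y :=
    ha.smul (contDiff_oneForm.contDiffAt.comp y hb')
  ext w
  obtain ⟨u, v, rfl⟩ : ∃ u v, w = ![u, v] := ⟨w 0, w 1, by ext i; fin_cases i <;> rfl⟩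
  rw [extDeriv_apply (h.differentiableAt (by simp))]
  have hsymm : fderiv ℝ (fderiv ℝ b) y u v = fderiv ℝ (fderiv ℝ b) y v u :=
    (hb.isSymmSndFDerivAt minSmoothness_two_le_infty).eq u v
  have hd : ∀ u v, fderiv ℝ (fun z => a z * fderiv ℝ b z v) y u =
      a y * fderiv ℝ (fderiv ℝ b) y u v + fderiv ℝ a y u * fderiv ℝ b y v := by
    intro u v
    have h1 := hbd.hasFDerivAt.clm_apply (hasFDerivAt_const v y)
    have h2 : fderiv ℝ (fun z => a z * fderiv ℝ b z v) y = _ := (had.hasFDerivAt.mul h1).fderiv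
    rw [h2]
    simp [mul_comm]
  have e0 : Fin.removeNth 0 ![u, v] 0 = v := rfl
  have e1 : Fin.removeNth 1 ![u, v] 0 = u := rfl
  rw [Fin.sum_univ_two]
  simp only [ContinuousAlternatingMap.smul_apply, oneForm_apply, e0, e1, smul_eq_mul, hd]
  rw [wedge_apply]
  simp [hsymm]
  ring

variable {d : ℕ} {M : Type*} [TopologicalSpace M] [ChartedSpace (EuclideanSpace ℝ (Fin d)) M]

/-- The form `f dg`. -/
def smulDiff (f g : M → ℝ) : DForm d 1 M := fun x => f x • oneForm (mvfderiv (𝓡 d) g x)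

/-- The form `df ∧ dg`. -/
def wedgeDiff (f g : M → ℝ) : DForm d 2 M :=
  fun x => wedge (mvfderiv (𝓡 d) f x) (mvfderiv (𝓡 d) g x)

variable [IsManifold (𝓡 d) ∞ M] {f g : M → ℝ}

theorem contDiffOn_comp_extChartAt_symm (hf : ContMDiff (𝓡 d) 𝓘(ℝ, ℝ) ∞ f) (p : M) :
    ContDiffOn ℝ ∞ (f ∘ (extChartAt (𝓡 d) p).symm) (extChartAt (𝓡 d) p).target := by
  have := hf.comp_contMDiffOn (contMDiffOn_extChartAt_symm (I := 𝓡 d) (n := ∞) p)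
  exact this.contDiffOn

theorem contDiffAt_comp_extChartAt_symm (hf : ContMDiff (𝓡 d) 𝓘(ℝ, ℝ) ∞ f) {p : M}
    {y : EuclideanSpace ℝ (Fin d)} (hy : y ∈ (extChartAt (𝓡 d) p).target) :
    ContDiffAt ℝ ∞ (f ∘ (extChartAt (𝓡 d) p).symm) y :=
  (contDiffOn_comp_extChartAt_symm hf p).contDiffAt
    ((isOpen_extChartAt_target p).mem_nhds hy)

theorem fderiv_comp_extChartAt_symm {p : M} {y : EuclideanSpace ℝ (Fin d)}
    (hy : y ∈ (extChartAt (𝓡 d) p).target)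
    (hf : MDifferentiableAt (𝓡 d) 𝓘(ℝ, ℝ) f ((extChartAt (𝓡 d) p).symm y))
    (v : EuclideanSpace ℝ (Fin d)) :
    fderiv ℝ (f ∘ (extChartAt (𝓡 d) p).symm) y v =
      mvfderiv (𝓡 d) f ((extChartAt (𝓡 d) p).symm y) (tcoordSymm p y v) := by
  have : IsManifold (𝓡 d) 1 M := IsManifold.of_le (n := ∞) (by simp)
  have h2 : MDifferentiableAt 𝓘(ℝ, EuclideanSpace ℝ (Fin d)) (𝓡 d)
      (extChartAt (𝓡 d) p).symm y := by
    have := mdifferentiableWithinAt_extChartAt_symm (I := 𝓡 d) hy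
    rwa [ModelWithCorners.range_eq_univ, mdifferentiableWithinAt_univ] at this
  have h3 := mfderiv_comp y hf h2
  rw [← mfderiv_eq_fderiv]
  exact congrArg (fun T => T v) h3

theorem inChart_smulDiff (hg : ContMDiff (𝓡 d) 𝓘(ℝ, ℝ) ∞ g) {p : M}
    {y : EuclideanSpace ℝ (Fin d)} (hy : y ∈ (extChartAt (𝓡 d) p).target) :
    (smulDiff f g).inChart p y = (f ∘ (extChartAt (𝓡 d) p).symm) y •
      oneForm (fderiv ℝ (g ∘ (extChartAt (𝓡 d) p).symm) y) := by
  ext v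
  simp only [inChart_apply, smulDiff, ContinuousAlternatingMap.smul_apply, oneForm_apply,
    fderiv_comp_extChartAt_symm hy (hg.mdifferentiable (by simp) _)]
  rfl

theorem inChart_wedgeDiff (hf : ContMDiff (𝓡 d) 𝓘(ℝ, ℝ) ∞ f) (hg : ContMDiff (𝓡 d) 𝓘(ℝ, ℝ) ∞ g)
    {p : M} {y : EuclideanSpace ℝ (Fin d)} (hy : y ∈ (extChartAt (𝓡 d) p).target) :
    (wedgeDiff f g).inChart p y = wedge (fderiv ℝ (f ∘ (extChartAt (𝓡 d) p).symm) y)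
      (fderiv ℝ (g ∘ (extChartAt (𝓡 d) p).symm) y) := by
  ext v
  simp only [inChart_apply, wedgeDiff, wedge_apply,
    fderiv_comp_extChartAt_symm hy (hg.mdifferentiable (by simp) _),
    fderiv_comp_extChartAt_symm hy (hf.mdifferentiable (by simp) _)]

theorem contDiffOn_fderiv_comp_extChartAt_symm (hf : ContMDiff (𝓡 d) 𝓘(ℝ, ℝ) ∞ f) (p : M) :
    ContDiffOn ℝ ∞ (fderiv ℝ (f ∘ (extChartAt (𝓡 d) p).symm)) (extChartAt (𝓡 d) p).target :=
  (contDiffOn_comp_extChartAt_symm hf p).fderiv_of_isOpen (isOpen_extChartAt_target p) (by simp)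

theorem smoothOn_smulDiff (hf : ContMDiff (𝓡 d) 𝓘(ℝ, ℝ) ∞ f) (hg : ContMDiff (𝓡 d) 𝓘(ℝ, ℝ) ∞ g)
    (U : Set M) : (smulDiff f g).SmoothOn (d := d) U := by
  refine DForm.SmoothOn.mono (U := univ) (fun p => ?_) (subset_univ _)
  rw [preimage_univ, inter_univ]
  exact ((contDiffOn_comp_extChartAt_symm hf p).smul (contDiff_oneForm.comp_contDiffOn
    (contDiffOn_fderiv_comp_extChartAt_symm hg p))).congr fun y hy => inChart_smulDiff hg hy

theorem smoothOn_smul_wedgeDiff {h : M → ℝ} (hh : ContMDiff (𝓡 d) 𝓘(ℝ, ℝ) ∞ h)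
    (hf : ContMDiff (𝓡 d) 𝓘(ℝ, ℝ) ∞ f) (hg : ContMDiff (𝓡 d) 𝓘(ℝ, ℝ) ∞ g)
    (U : Set M) : DForm.SmoothOn (d := d) (fun x => h x • wedgeDiff f g x) U := by
  refine DForm.SmoothOn.mono (U := univ) (fun p => ?_) (subset_univ _)
  rw [preimage_univ, inter_univ]
  refine ((contDiffOn_comp_extChartAt_symm hh p).smul (contDiffOn_wedge
    (contDiffOn_fderiv_comp_extChartAt_symm hf p)
    (contDiffOn_fderiv_comp_extChartAt_symm hg p))).congr fun y hy => ?_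
  simp only [Pi.smul_apply', ← inChart_wedgeDiff hf hg hy]
  rfl

theorem hasExtDerivOn_smulDiff (hf : ContMDiff (𝓡 d) 𝓘(ℝ, ℝ) ∞ f)
    (hg : ContMDiff (𝓡 d) 𝓘(ℝ, ℝ) ∞ g) (U : Set M) :
    (smulDiff f g).HasExtDerivOn (d := d) (wedgeDiff f g) U := by
  intro p y hy _
  have h : (smulDiff f g).inChart p =ᶠ[𝓝 y] fun y => (f ∘ (extChartAt (𝓡 d) p).symm) y •
      oneForm (fderiv ℝ (g ∘ (extChartAt (𝓡 d) p).symm) y) := by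
    filter_upwards [(isOpen_extChartAt_target p).mem_nhds hy] with z hz
    exact inChart_smulDiff hg hz
  rw [h.extDeriv_eq, extDeriv_smul_oneForm_fderiv (contDiffAt_comp_extChartAt_symm hf hy)
    (contDiffAt_comp_extChartAt_symm hg hy), inChart_wedgeDiff hf hg hy]

end Wedge

/-! ### Good covers from an embedding in Euclidean space -/

section GoodCover

open Set Filter Metric Topology

theorem norm_convexComb_sq {W : Type*} [NormedAddCommGroup W] [InnerProductSpace ℝ W] (P Q : W)
    {a b : ℝ} (h : a + b = 1) :
    ‖a • P + b • Q‖ ^ 2 = a * ‖P‖ ^ 2 + b * ‖Q‖ ^ 2 - a * b * ‖P - Q‖ ^ 2 := by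
  obtain rfl : b = 1 - a := by linarith
  rw [norm_add_sq_real, norm_sub_sq_real, norm_smul, norm_smul, inner_smul_left,
    inner_smul_right, Real.norm_eq_abs, Real.norm_eq_abs, mul_pow, mul_pow, sq_abs, sq_abs]
  simp only [conj_trivial]
  ring

/-- Preimages of small balls under an immersion into a Hilbert space are convex. -/
theorem exists_convex_preimage_ball {V W : Type*} [NormedAddCommGroup V] [NormedSpace ℝ V]
    [FiniteDimensional ℝ V] [NormedAddCommGroup W] [InnerProductSpace ℝ W] {F : V → W} {y₀ : V}
    (hF : ContDiffAt ℝ 2 F y₀) (hinj : Function.Injective (fderiv ℝ F y₀)) {s : Set V}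
    (hs : s ∈ 𝓝 y₀) :
    ∃ ρ > 0, ball y₀ ρ ⊆ s ∧ ∃ r > 0, ∀ q ∈ ball (F y₀) r, ∀ ε : ℝ,
      Convex ℝ {y ∈ ball y₀ ρ | ‖F y - q‖ < ε} := by
  obtain ⟨K, hK0, hK⟩ := (fderiv ℝ F y₀).toLinearMap.exists_antilipschitzWith
    (LinearMap.ker_eq_bot.2 hinj)
  set c : ℝ := (2 * K)⁻¹ with hc
  have hK0' : (0 : ℝ) < K := hK0
  have hc0 : 0 < c := by positivity
  -- An injective derivative bounds `‖F y - F z‖` below by a multiple of `‖y - z‖` near `y₀`; half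
  -- of the linear constant absorbs the remainder.
  have hstrict : ∀ᶠ p : V × V in 𝓝 (y₀, y₀), c * ‖p.1 - p.2‖ ≤ ‖F p.1 - F p.2‖ := by
    have h1 := (hF.hasStrictFDerivAt (by simp)).isLittleO.def hc0
    filter_upwards [h1] with p hp
    have h2 := hK.le_mul_dist p.1 p.2
    simp only [dist_eq_norm] at h2
    have h3 : ‖fderiv ℝ F y₀ (p.1 - p.2)‖ ≤ ‖F p.1 - F p.2‖ + c * ‖p.1 - p.2‖ := by
      have := norm_sub_norm_le (fderiv ℝ F y₀ (p.1 - p.2)) (F p.1 - F p.2)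
      rw [norm_sub_rev (fderiv ℝ F y₀ (p.1 - p.2))] at this
      linarith
    have h4 : ‖p.1 - p.2‖ ≤ K * ‖fderiv ℝ F y₀ (p.1 - p.2)‖ := by
      rw [map_sub]; exact h2
    have h5 : 2 * c * ‖p.1 - p.2‖ ≤ ‖fderiv ℝ F y₀ (p.1 - p.2)‖ := by
      calc 2 * c * ‖p.1 - p.2‖ ≤ 2 * c * (K * ‖fderiv ℝ F y₀ (p.1 - p.2)‖) := by gcongr
        _ = ‖fderiv ℝ F y₀ (p.1 - p.2)‖ := by rw [hc]; field_simp
    linarith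
  obtain ⟨L, t, ht, hL⟩ := (hF.fderiv_right (m := 1) (by norm_num)).exists_lipschitzOnWith
  have hdiff : ∀ᶠ y in 𝓝 y₀, DifferentiableAt ℝ F y :=
    (hF.eventually (by simp)).mono fun y hy => hy.differentiableAt (by simp)
  -- At `m = a y + b z`, convexity of the squared norm gains `ab c²‖y - z‖²`, and the Taylor error
  -- of `F` costs at most `2R · L ab‖y - z‖²` while distances to `q` are at most `R`. The value of
  -- `R` ensures `2RL ≤ c²`.
  set R : ℝ := c ^ 2 / (2 * (L + 1)) with hR
  have hR0 : 0 < R := by positivity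
  have hFc : ∀ᶠ y in 𝓝 y₀, F y ∈ ball (F y₀) (R / 2) :=
    hF.continuousAt.eventually_mem (ball_mem_nhds _ (by positivity))
  rw [nhds_prod_eq] at hstrict
  obtain ⟨pa, hpa, pb, hpb, hab⟩ := Filter.eventually_prod_iff.1 hstrict
  obtain ⟨ρ, hρ, hsub⟩ := Metric.mem_nhds_iff.1
    (inter_mem hs (inter_mem ht (hdiff.and (hFc.and (hpa.and hpb)))))
  refine ⟨ρ, hρ, fun y hy => (hsub hy).1, R / 2, by positivity, ?_⟩
  intro q hq ε y hy z hz a b ha hb hab1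
  have hB : ∀ y ∈ ball y₀ ρ, ‖F y - q‖ ≤ R := fun y hy => by
    have h1 := (hsub hy).2.2.2.1
    rw [mem_ball] at h1 hq
    rw [← dist_eq_norm]
    linarith [dist_triangle_right (F y) q (F y₀)]
  set m := a • y + b • z with hm
  have hmb : m ∈ ball y₀ ρ := convex_ball y₀ ρ hy.1 hz.1 ha hb hab1
  have htay : ∀ y ∈ ball y₀ ρ, ‖F y - F m - fderiv ℝ F m (y - m)‖ ≤ L * ‖y - m‖ ^ 2 := by
    intro y hy
    have h := (convex_segment (𝕜 := ℝ) m y).norm_image_sub_le_of_norm_hasFDerivWithin_le'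
      (f := F) (f' := fderiv ℝ F) (φ := fderiv ℝ F m) (C := L * ‖y - m‖) (fun x hx =>
        (hsub ((convex_ball y₀ ρ).segment_subset hmb hy hx)).2.2.1.hasFDerivAt.hasFDerivWithinAt)
      (fun x hx => by
        have hxb := (convex_ball y₀ ρ).segment_subset hmb hy hx
        have := hL.dist_le_mul x (hsub hxb).2.1 m (hsub hmb).2.1
        rw [dist_eq_norm, dist_eq_norm] at this
        refine this.trans ?_
        gcongr
        obtain ⟨e, ⟨he0, he1⟩, rfl⟩ := (segment_eq_image' ℝ m y ▸ hx)
        simp only [add_sub_cancel_left, norm_smul, Real.norm_eq_abs, abs_of_nonneg he0]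
        exact mul_le_of_le_one_left (norm_nonneg _) he1)
      (left_mem_segment ℝ m y) (right_mem_segment ℝ m y)
    linarith [h, sq ‖y - m‖, mul_assoc (L : ℝ) ‖y - m‖ ‖y - m‖]
  refine ⟨hmb, ?_⟩
  set P := F y - q
  set Q := F z - q
  set D := ‖y - z‖
  have hb1 : b = 1 - a := by linarith
  have hym : y - m = b • (y - z) := by rw [hm, hb1]; module
  have hzm : z - m = -(a • (y - z)) := by rw [hm, hb1]; module
  -- Taylor expansion at `m` itself: the linear terms cancel because `a (y - m) + b (z - m) = 0`,
  -- and the quadratic ones sum to `L ab (a + b) D²`.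
  have hE : ‖F m - q - (a • P + b • Q)‖ ≤ L * (a * b) * D ^ 2 := by
    have h1 := htay y hy.1
    have h2 := htay z hz.1
    have e1 : F m - q - (a • P + b • Q) = -(a • (F y - F m - fderiv ℝ F m (y - m)) +
        b • (F z - F m - fderiv ℝ F m (z - m))) := by
      have h0 : a • fderiv ℝ F m (y - m) + b • fderiv ℝ F m (z - m) = 0 := by
        rw [hym, hzm, map_neg, map_smul, map_smul]; module
      have : F m - q - (a • P + b • Q) = -(a • (F y - F m) + b • (F z - F m)) := by
        simp only [P, Q, hb1]; module
      rw [this, show a • (F y - F m - fderiv ℝ F m (y - m)) + b • (F z - F m -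
        fderiv ℝ F m (z - m)) = a • (F y - F m) + b • (F z - F m) -
        (a • fderiv ℝ F m (y - m) + b • fderiv ℝ F m (z - m)) by module, h0, sub_zero]
    rw [e1, norm_neg]
    refine (norm_add_le _ _).trans ?_
    rw [norm_smul, norm_smul, Real.norm_eq_abs, Real.norm_eq_abs, abs_of_nonneg ha,
      abs_of_nonneg hb]
    rw [hym, norm_smul, Real.norm_eq_abs, abs_of_nonneg hb] at h1
    rw [hzm, norm_neg, norm_smul, Real.norm_eq_abs, abs_of_nonneg ha] at h2
    rw [← hym] at h1
    rw [← hzm] at h2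
    calc _ ≤ a * (L * (b * D) ^ 2) + b * (L * (a * D) ^ 2) := by gcongr
      _ = L * (a * b) * D ^ 2 := by rw [hb1]; ring
  have hcD : c * D ≤ ‖P - Q‖ := by
    have := hab (hsub hy.1).2.2.2.2.1 (hsub hz.1).2.2.2.2.2
    simpa [P, Q] using this
  have hcomb : ‖a • P + b • Q‖ ^ 2 = a * ‖P‖ ^ 2 + b * ‖Q‖ ^ 2 - a * b * ‖P - Q‖ ^ 2 :=
    norm_convexComb_sq P Q hab1
  have hcombR : ‖a • P + b • Q‖ ≤ R := by
    refine (norm_add_le _ _).trans ?_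
    rw [norm_smul, norm_smul, Real.norm_eq_abs, Real.norm_eq_abs, abs_of_nonneg ha,
      abs_of_nonneg hb]
    nlinarith [hB y hy.1, hB z hz.1]
  have hsq : ‖F m - q‖ ^ 2 ≤ ‖a • P + b • Q‖ ^ 2 + 2 * R * (L * (a * b) * D ^ 2) := by
    have h1 := norm_sub_norm_le (F m - q) (a • P + b • Q)
    have h2 := hB m hmb
    have h3 := norm_nonneg (F m - q)
    have h4 := norm_nonneg (a • P + b • Q)
    have h5 : ‖F m - q‖ ^ 2 - ‖a • P + b • Q‖ ^ 2 =
      (‖F m - q‖ - ‖a • P + b • Q‖) * (‖F m - q‖ + ‖a • P + b • Q‖) := by ring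
    have h6 : (‖F m - q‖ - ‖a • P + b • Q‖) * (‖F m - q‖ + ‖a • P + b • Q‖) ≤
      (L * (a * b) * D ^ 2) * (2 * R) := by
      have h7 : ‖F m - q‖ - ‖a • P + b • Q‖ ≤ L * (a * b) * D ^ 2 := h1.trans hE
      refine mul_le_mul h7 (by linarith) (by linarith) ((norm_nonneg _).trans hE)
    linarith
  have h2RL : 2 * R * L ≤ c ^ 2 := by
    have hL0 : (0 : ℝ) ≤ L := L.2
    rw [hR, show 2 * (c ^ 2 / (2 * ((L : ℝ) + 1))) * L = c ^ 2 * (L / (L + 1)) by field_simp]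
    have : (L : ℝ) / (L + 1) ≤ 1 := by rw [div_le_one (by linarith)]; linarith
    nlinarith [sq_nonneg c]
  have hcD2 : (c * D) ^ 2 ≤ ‖P - Q‖ ^ 2 := by gcongr
  have hab0 : 0 ≤ a * b := mul_nonneg ha hb
  have hfin : ‖F m - q‖ ^ 2 ≤ a * ‖P‖ ^ 2 + b * ‖Q‖ ^ 2 := by
    have h1 : a * b * (2 * R * L * D ^ 2) ≤ a * b * ‖P - Q‖ ^ 2 := by
      refine mul_le_mul_of_nonneg_left ?_ hab0
      calc 2 * R * L * D ^ 2 ≤ c ^ 2 * D ^ 2 := by gcongr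
        _ ≤ _ := by rw [← mul_pow]; exact hcD2
    nlinarith
  have hε : 0 < ε := (norm_nonneg _).trans_lt hy.2
  refine lt_of_pow_lt_pow_left₀ 2 hε.le (hfin.trans_lt ?_)
  have hP : ‖P‖ ^ 2 < ε ^ 2 := by gcongr; exact hy.2
  have hQ : ‖Q‖ ^ 2 < ε ^ 2 := by gcongr; exact hz.2
  rcases ha.eq_or_lt with rfl | ha'
  · simp only [zero_add] at hab1
    subst hab1
    linarith
  · nlinarith

variable {d : ℕ} {M : Type*} [TopologicalSpace M] [ChartedSpace (EuclideanSpace ℝ (Fin d)) M]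
  [IsManifold (𝓡 d) ∞ M]

/-- Read in the chart at `p`, the embedding is an immersion, so preimages of small balls are convex
there. They lie inside the chart because the topology of `M` is induced by `e`. -/
theorem exists_convex_chartImage {N : ℕ} {e : M → EuclideanSpace ℝ (Fin N)}
    (he : ContMDiff (𝓡 d) 𝓘(ℝ, EuclideanSpace ℝ (Fin N)) ∞ e) (hemb : IsClosedEmbedding e)
    (hinj : ∀ x, Function.Injective (mfderiv (𝓡 d) 𝓘(ℝ, EuclideanSpace ℝ (Fin N)) e x)) (p : M) :
    ∃ r > 0, ∀ (x : M) (ε : ℝ), 0 < ε → ball (e x) ε ⊆ ball (e p) r →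
      e ⁻¹' ball (e x) ε ⊆ (extChartAt (𝓡 d) p).source ∧
        Convex ℝ (chartImage (d := d) p (e ⁻¹' ball (e x) ε)) := by
  have h1M : IsManifold (𝓡 d) 1 M := IsManifold.of_le (n := ∞) (by simp)
  set y₀ := extChartAt (𝓡 d) p p
  have hy₀ : y₀ ∈ (extChartAt (𝓡 d) p).target := mem_extChartAt_target p
  set F := e ∘ (extChartAt (𝓡 d) p).symm
  have hFon : ContDiffOn ℝ ∞ F (extChartAt (𝓡 d) p).target :=
    (he.comp_contMDiffOn (contMDiffOn_extChartAt_symm (I := 𝓡 d) (n := ∞) p)).contDiffOn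
  have hF : ContDiffAt ℝ 2 F y₀ := (hFon.contDiffAt
    ((isOpen_extChartAt_target p).mem_nhds hy₀)).of_le
      (WithTop.coe_le_coe.2 (le_top : (2 : ℕ∞) ≤ ⊤))
  have hd : ∀ v, fderiv ℝ F y₀ v = mfderiv (𝓡 d) 𝓘(ℝ, EuclideanSpace ℝ (Fin N)) e
      ((extChartAt (𝓡 d) p).symm y₀) (tcoordSymm p y₀ v) := by
    have h2 : MDifferentiableAt 𝓘(ℝ, EuclideanSpace ℝ (Fin d)) (𝓡 d)
        (extChartAt (𝓡 d) p).symm y₀ := by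
      have := mdifferentiableWithinAt_extChartAt_symm (I := 𝓡 d) hy₀
      rwa [ModelWithCorners.range_eq_univ, mdifferentiableWithinAt_univ] at this
    intro v
    rw [← mfderiv_eq_fderiv]
    exact congrArg (fun T => T v) (mfderiv_comp y₀ (he.mdifferentiable (by simp) _) h2)
  have hFinj : Function.Injective (fderiv ℝ F y₀) := by
    intro u v huv
    rw [hd, hd] at huv
    have := congrArg (tcoord p _) (hinj _ huv)
    rwa [tcoord_tcoordSymm hy₀, tcoord_tcoordSymm hy₀] at this
  obtain ⟨ρ, hρ, hρt, r, hr, hconv⟩ := exists_convex_preimage_ball hF hFinj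
    ((isOpen_extChartAt_target p).mem_nhds hy₀)
  have hFy₀ : F y₀ = e p := by simp [F, y₀]
  have hW : (extChartAt (𝓡 d) p).source ∩ extChartAt (𝓡 d) p ⁻¹' ball y₀ ρ ∈ 𝓝 p :=
    inter_mem (extChartAt_source_mem_nhds p)
      ((continuousAt_extChartAt p).preimage_mem_nhds (ball_mem_nhds _ hρ))
  rw [hemb.isInducing.nhds_eq_comap, mem_comap] at hW
  obtain ⟨T, hT, hTW⟩ := hW
  obtain ⟨r', hr', hr'T⟩ := Metric.mem_nhds_iff.1 hT
  refine ⟨min r r', lt_min hr hr', fun x ε hε hb => ?_⟩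
  have hsub : e ⁻¹' ball (e x) ε ⊆
      (extChartAt (𝓡 d) p).source ∩ extChartAt (𝓡 d) p ⁻¹' ball y₀ ρ := fun z hz =>
    hTW (hr'T (ball_subset_ball (min_le_right _ _) (hb hz)))
  refine ⟨fun z hz => (hsub hz).1, ?_⟩
  have hq : e x ∈ ball (F y₀) r := by
    rw [hFy₀]
    exact ball_subset_ball (min_le_left _ _) (hb (mem_ball_self hε))
  convert! hconv (e x) hq ε using 1
  ext y
  constructor
  · rintro ⟨hy, hy'⟩
    have h1 := (hsub hy').2
    rw [mem_preimage, (extChartAt (𝓡 d) p).right_inv hy] at h1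
    exact ⟨h1, by rw [← dist_eq_norm]; exact hy'⟩
  · rintro ⟨hy, hy'⟩
    refine ⟨hρt hy, ?_⟩
    rw [← dist_eq_norm] at hy'
    exact hy'

variable (d M) in
/-- A compact manifold has a finite open cover all of whose members meeting a given member are
convex in a common chart. -/
theorem exists_good_cover [T2Space M] [CompactSpace M] :
    ∃ (m : ℕ) (U : Fin m → Set M) (c : Fin m → M), (∀ i, IsOpen (U i)) ∧ ⋃ i, U i = univ ∧
      (∀ i, (U i).Nonempty) ∧ ∀ i j, (U i ∩ U j).Nonempty →
        U j ⊆ (extChartAt (𝓡 d) (c i)).source ∧ Convex ℝ (chartImage (d := d) (c i) (U j)) := by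
  obtain ⟨N, e, he, hemb, hinj⟩ := exists_embedding_euclidean_of_compact (I := 𝓡 d) (M := M)
  choose r hr hconv using exists_convex_chartImage he hemb hinj
  obtain ⟨δ, hδ, hleb⟩ := lebesgue_number_lemma_of_metric (s := range e)
    (c := fun p : M => ball (e p) (r p)) (isCompact_range hemb.continuous)
    (fun _ => isOpen_ball) (by
      rintro _ ⟨x, rfl⟩
      exact mem_iUnion.2 ⟨x, mem_ball_self (hr x)⟩)
  choose c hc using fun x : M => hleb (e x) (mem_range_self x)
  -- A third of the Lebesgue number: if `U i` meets `U j`, then `U j` lies in the `δ`-ball around `e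
  -- (q i)`, hence in the ball where the chart at `c (q i)` gives convexity.
  have hε : 0 < δ / 3 := by positivity
  obtain ⟨t, ht⟩ := CompactSpace.elim_nhds_subcover (fun x : M => e ⁻¹' ball (e x) (δ / 3))
    fun x => hemb.continuous.continuousAt.preimage_mem_nhds (ball_mem_nhds _ hε)
  let q : Fin t.card → M := fun i => t.equivFin.symm i
  refine ⟨t.card, fun i => e ⁻¹' ball (e (q i)) (δ / 3), fun i => c (q i),
    fun i => isOpen_ball.preimage hemb.continuous, ?_, fun i => ⟨q i, mem_ball_self hε⟩, ?_⟩
  · rw [eq_univ_iff_forall]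
    intro x
    have hx : x ∈ ⋃ y ∈ t, e ⁻¹' ball (e y) (δ / 3) := by rw [ht]; trivial
    obtain ⟨y, hy, hxy⟩ := mem_iUnion₂.1 hx
    refine mem_iUnion.2 ⟨t.equivFin ⟨y, hy⟩, ?_⟩
    simpa [q] using hxy
  · rintro i j ⟨x, hxi, hxj⟩
    refine hconv (c (q i)) (q j) _ hε (Subset.trans (fun z hz => ?_) (hc (q i)))
    rw [mem_preimage, mem_ball] at hxi hxj
    rw [mem_ball] at hz ⊢
    have h1 := dist_triangle z (e (q j)) (e (q i))
    have h2 := dist_triangle_left (e (q j)) (e (q i)) (e x)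
    linarith

end GoodCover

/-! ### Rational approximation preserving rational linear relations -/

section RationalApproximation

/-- Finitely many real numbers can be approximated by rational numbers satisfying the same
rational linear equations. -/
theorem exists_rat_linearMap_approx {T : Type*} [Fintype T] (c : T → ℝ) {ε : ℝ} (hε : 0 < ε) :
    ∃ φ : Submodule.span ℚ (Set.range c) →ₗ[ℚ] ℚ,
      ∀ t, |(φ ⟨c t, Submodule.subset_span ⟨t, rfl⟩⟩ : ℝ) - c t| < ε := by
  have : Module.Finite ℚ (Submodule.span ℚ (Set.range c)) :=
    FiniteDimensional.span_of_finite ℚ (Set.finite_range c)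
  let b := Module.finBasis ℚ (Submodule.span ℚ (Set.range c))
  let v : T → Submodule.span ℚ (Set.range c) := fun t => ⟨c t, Submodule.subset_span ⟨t, rfl⟩⟩
  -- `S` bounds the sum of the absolute coordinates of each `c t`, so an error `ε / S` on the basis
  -- vectors suffices; the summand `1` makes `S` positive and the final inequality strict.
  set S : ℝ := ∑ t, ∑ a, |(b.repr (v t) a : ℝ)| + 1 with hS
  have hS0 : 0 < S := by positivity
  have hb : ∀ a, ∃ q : ℚ, |(q : ℝ) - b a| < ε / S := by
    intro a
    obtain ⟨q, hq1, hq2⟩ := exists_rat_btwn (show (b a : ℝ) < b a + ε / S by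
      have : 0 < ε / S := by positivity
      linarith)
    exact ⟨q, by rw [abs_lt]; constructor <;> linarith [show 0 < ε / S by positivity]⟩
  choose q hq using hb
  refine ⟨b.constr ℚ q, fun t => ?_⟩
  have h1 : (b.constr ℚ q (v t) : ℝ) = ∑ a, (b.repr (v t) a : ℝ) * q a := by
    rw [Module.Basis.constr_apply_fintype]
    simp [Module.Basis.equivFun_apply]
  have h2 : c t = ∑ a, (b.repr (v t) a : ℝ) * (b a : ℝ) := by
    have := congrArg (fun x : Submodule.span ℚ (Set.range c) => (x : ℝ)) (b.sum_repr (v t))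
    simp only [Submodule.coe_sum, Submodule.coe_smul] at this
    rw [← show ((v t : Submodule.span ℚ (Set.range c)) : ℝ) = c t from rfl, ← this]
    exact Finset.sum_congr rfl fun a _ => by rw [Rat.smul_def]
  change |(b.constr ℚ q (v t) : ℝ) - c t| < ε
  rw [h1, h2, ← Finset.sum_sub_distrib]
  calc |∑ a, ((b.repr (v t) a : ℝ) * q a - (b.repr (v t) a : ℝ) * (b a : ℝ))|
      ≤ ∑ a, |(b.repr (v t) a : ℝ)| * (ε / S) := by
        refine (Finset.abs_sum_le_sum_abs _ _).trans (Finset.sum_le_sum fun a _ => ?_)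
        rw [← mul_sub, abs_mul]
        exact mul_le_mul_of_nonneg_left (hq a).le (abs_nonneg _)
    _ = (∑ a, |(b.repr (v t) a : ℝ)|) * (ε / S) := by rw [Finset.sum_mul]
    _ < S * (ε / S) := by
        refine mul_lt_mul_of_pos_right ?_ (by positivity)
        have : ∑ a, |(b.repr (v t) a : ℝ)| ≤ ∑ t, ∑ a, |(b.repr (v t) a : ℝ)| :=
          Finset.single_le_sum (f := fun t => ∑ a, |(b.repr (v t) a : ℝ)|)
            (fun _ _ => by positivity) (Finset.mem_univ t)
        linarith
    _ = ε := by field_simp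

end RationalApproximation

/-! ### Local primitives on sets convex in a chart -/

section LocalPrimitives

open Set Filter

variable {d : ℕ} {M : Type*} [TopologicalSpace M] [ChartedSpace (EuclideanSpace ℝ (Fin d)) M]
  [IsManifold (𝓡 d) ∞ M] {p : M} {V : Set M}

theorem exists_primitive_form (hV : IsOpen V) (hVp : V ⊆ (extChartAt (𝓡 d) p).source)
    (hc : Convex ℝ (chartImage (d := d) p V)) {Ω : DForm d 2 M} (hs : Ω.SmoothOn V)
    (hcl : Ω.HasExtDerivOn 0 V) :
    ∃ θ : DForm d 1 M, θ.SmoothOn V ∧ θ.HasExtDerivOn Ω V := by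
  obtain ⟨ϑ, hϑ, hdϑ⟩ := exists_primitive_of_closed_two (isOpen_chartImage p hV) hc (hs p)
    fun y hy => by rw [hcl p y hy.1 hy.2]; rfl
  let θ : DForm d 1 M := fun x =>
    (ϑ (extChartAt (𝓡 d) p x)).compContinuousLinearMap (tcoord p x)
  have hθ : ∀ y ∈ chartImage (d := d) p V, θ.inChart p y = ϑ y := by
    intro y hy
    ext v
    rw [inChart_apply]
    simp only [θ, ContinuousAlternatingMap.compContinuousLinearMap_apply, Function.comp_def,
      tcoord_tcoordSymm hy.1, (extChartAt (𝓡 d) p).right_inv hy.1]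
  have hθs : ContDiffOn ℝ ∞ (θ.inChart p) (chartImage p V) := hϑ.congr hθ
  refine ⟨θ, smoothOn_of_inChart p hVp hθs, hasExtDerivOn_of_inChart hV p hVp hθs fun y hy => ?_⟩
  have h : θ.inChart p =ᶠ[𝓝 y] ϑ :=
    eventually_of_mem ((isOpen_chartImage p hV).mem_nhds hy) hθ
  rw [h.extDeriv_eq, hdϑ y hy]

theorem exists_primitive_function (hV : IsOpen V) (hVp : V ⊆ (extChartAt (𝓡 d) p).source)
    (hc : Convex ℝ (chartImage (d := d) p V)) {θ : DForm d 1 M} (hs : θ.SmoothOn V)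
    (hcl : θ.HasExtDerivOn 0 V) :
    ∃ f : M → ℝ, ContMDiffOn (𝓡 d) 𝓘(ℝ, ℝ) ∞ f V ∧
      ∀ x ∈ V, ∀ v : TangentSpace (𝓡 d) x, mvfderiv (𝓡 d) f x v = θ x ![v] := by
  have h1M : IsManifold (𝓡 d) 1 M := IsManifold.of_le (n := ∞) (by simp)
  obtain ⟨F, hF, hdF⟩ := exists_primitive_of_closed_one (isOpen_chartImage p hV) hc (hs p)
    fun y hy => by rw [hcl p y hy.1 hy.2]; rfl
  refine ⟨F ∘ extChartAt (𝓡 d) p, ?_, fun x hx v => ?_⟩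
  · refine hF.contMDiffOn.comp ((contMDiffOn_extChartAt (I := 𝓡 d) (n := ∞) (x := p)).mono
      fun x hx => by simpa using hVp hx) fun x hx => mem_chartImage (hVp hx) hx
  · have hxc : extChartAt (𝓡 d) p x ∈ chartImage (d := d) p V := mem_chartImage (hVp hx) hx
    have hFd : MDifferentiableAt 𝓘(ℝ, EuclideanSpace ℝ (Fin d)) 𝓘(ℝ, ℝ) F
        (extChartAt (𝓡 d) p x) :=
      ((hF.contDiffAt ((isOpen_chartImage p hV).mem_nhds hxc)).differentiableAt
        (by simp)).mdifferentiableAt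
    have h := mfderiv_comp x hFd (mdifferentiableAt_extChartAt (I := 𝓡 d) (x := p)
      (by simpa using hVp hx))
    rw [form_eq_inChart θ (hVp hx)]
    have h2 := hdF _ hxc (tcoord p x v)
    rw [← mfderiv_eq_fderiv] at h2
    refine (congrArg (fun T => T v) h).trans (h2.trans ?_)
    congr 1
    ext i; fin_cases i; rfl

theorem eq_of_mvfderiv_eq_zero (hV : IsOpen V) (hVp : V ⊆ (extChartAt (𝓡 d) p).source)
    (hc : Convex ℝ (chartImage (d := d) p V)) {f : M → ℝ}
    (hf : ContMDiffOn (𝓡 d) 𝓘(ℝ, ℝ) ∞ f V) (h : ∀ x ∈ V, mvfderiv (𝓡 d) f x = 0) {x y : M}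
    (hx : x ∈ V) (hy : y ∈ V) : f x = f y := by
  have hd : ∀ z ∈ chartImage (d := d) p V,
      MDifferentiableAt (𝓡 d) 𝓘(ℝ, ℝ) f ((extChartAt (𝓡 d) p).symm z) := fun z hz =>
    (hf.contMDiffAt (hV.mem_nhds hz.2)).mdifferentiableAt (by simp)
  have hdiff : DifferentiableOn ℝ (f ∘ (extChartAt (𝓡 d) p).symm) (chartImage p V) := by
    have := hf.comp ((contMDiffOn_extChartAt_symm (I := 𝓡 d) (n := ∞) p).mono
      (inter_subset_left (t := (extChartAt (𝓡 d) p).symm ⁻¹' V))) fun z hz => hz.2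
    exact this.contDiffOn.differentiableOn (by simp)
  have key := (isOpen_chartImage p hV).is_const_of_fderiv_eq_zero hc.isPreconnected hdiff
    (fun z hz => by
      ext v
      rw [fderiv_comp_extChartAt_symm hz.1 (hd z hz), h _ hz.2]
      rfl) (mem_chartImage (hVp hx) hx) (mem_chartImage (hVp hy) hy)
  simpa only [Function.comp_apply, (extChartAt (𝓡 d) p).left_inv (hVp hx),
    (extChartAt (𝓡 d) p).left_inv (hVp hy)] using key

end LocalPrimitives

/-! ### From a Čech cocycle to a closed form, by a partition of unity -/

section Cech

open Set Filter

/-- The cocycle identity makes differences such as `e l j k - e l i k` split into a term in `k`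
minus a term in `l`, but only on the supports of the weights. The double sums then factor. -/
theorem sum_sum_mul_mul_eq {m : ℕ} {a b p q : Fin m → ℝ} {e : Fin m → Fin m → ℝ}
    (h : ∀ l k, a l ≠ 0 → b k ≠ 0 → e l k = p k - q l) :
    ∑ l, ∑ k, e l k * (a l * b k) =
      (∑ l, a l) * (∑ k, p k * b k) - (∑ l, q l * a l) * (∑ k, b k) := by
  rw [Finset.sum_mul_sum, Finset.sum_mul_sum, ← Finset.sum_sub_distrib]
  refine Finset.sum_congr rfl fun l _ => ?_
  rw [← Finset.sum_sub_distrib]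
  refine Finset.sum_congr rfl fun k _ => ?_
  by_cases hl : a l = 0
  · simp [hl]
  by_cases hk : b k = 0
  · simp [hk]
  rw [h l k hl hk]
  ring

variable {d : ℕ} {M : Type*} [TopologicalSpace M] [ChartedSpace (EuclideanSpace ℝ (Fin d)) M]
  [IsManifold (𝓡 d) ∞ M] {m : ℕ}

/-- The functions of a partition of unity weighted by a Čech cochain. -/
def cechFun (ρ : Fin m → M → ℝ) (e : Fin m → Fin m → Fin m → ℝ) (i j : Fin m) : M → ℝ :=
  fun x => ∑ k, e i j k * ρ k x

variable (d) in
/-- The local primitives of `cechTwo`. -/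
def cechOne (ρ : Fin m → M → ℝ) (e : Fin m → Fin m → Fin m → ℝ) (i : Fin m) : DForm d 1 M :=
  ∑ l, ∑ k, e l i k • smulDiff (ρ l) (ρ k)

variable (d) in
/-- The local expressions of `cechForm`. -/
def cechTwo (ρ : Fin m → M → ℝ) (e : Fin m → Fin m → Fin m → ℝ) (i : Fin m) : DForm d 2 M :=
  ∑ l, ∑ k, e l i k • wedgeDiff (ρ l) (ρ k)

variable (d) in
/-- The closed `2`-form associated with a Čech `2`-cocycle by means of a partition of unity. -/
def cechForm (ρ : Fin m → M → ℝ) (e : Fin m → Fin m → Fin m → ℝ) : DForm d 2 M :=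
  fun x => ∑ i, ρ i x • cechTwo d ρ e i x

variable (d) in
-- In this shape the form is linear in `e`, with fixed smooth forms as coefficients; smoothness and
-- continuity in `e` are read off from it.
theorem cechForm_eq_sum (ρ : Fin m → M → ℝ) (e : Fin m → Fin m → Fin m → ℝ) :
    cechForm d ρ e = ∑ i, ∑ l, ∑ k, e l i k • fun x => ρ i x • wedgeDiff (ρ l) (ρ k) x := by
  ext x v
  simp only [cechForm, cechTwo, Finset.sum_apply, Pi.smul_apply,
    ContinuousAlternatingMap.sum_apply, ContinuousAlternatingMap.smul_apply, Finset.smul_sum]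
  simp only [smul_comm (ρ _ x)]

variable {U : Fin m → Set M} {ρ : Fin m → M → ℝ} {e : Fin m → Fin m → Fin m → ℝ}

theorem sum_mvfderiv_eq_zero (hρ : ∀ i, ContMDiff (𝓡 d) 𝓘(ℝ, ℝ) ∞ (ρ i))
    (hsum : ∀ x, ∑ i, ρ i x = 1) (x : M) (v : TangentSpace (𝓡 d) x) :
    ∑ k, mvfderiv (𝓡 d) (ρ k) x v = 0 := by
  have h1 : ∀ s : Finset (Fin m), MDifferentiableAt (𝓡 d) 𝓘(ℝ, ℝ) (fun x => ∑ i ∈ s, ρ i x) x ∧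
      mvfderiv (𝓡 d) (fun x => ∑ i ∈ s, ρ i x) x v = ∑ k ∈ s, mvfderiv (𝓡 d) (ρ k) x v := by
    intro s
    induction s using Finset.induction_on with
    | empty => exact ⟨by simpa using mdifferentiableAt_const, by simp [mvfderiv_const]⟩
    | insert i s hi ih =>
      have hi' := (hρ i).mdifferentiable (by simp) x
      simp only [Finset.sum_insert hi]
      refine ⟨hi'.add ih.1, ?_⟩
      rw [mvfderiv_fun_add hi' ih.1, ← ih.2]
      rfl
  rw [← (h1 Finset.univ).2]
  simp [hsum, mvfderiv_const]

theorem mvfderiv_eq_zero_of_notMem {f : M → ℝ} {V : Set M} (hf : tsupport f ⊆ V) {x : M}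
    (hx : x ∉ V) : mvfderiv (𝓡 d) f x = 0 := by
  have h : f =ᶠ[𝓝 x] fun _ => 0 := notMem_tsupport_iff_eventuallyEq.1 fun h => hx (hf h)
  have h2 : mfderiv (𝓡 d) 𝓘(ℝ, ℝ) f x = mfderiv (𝓡 d) 𝓘(ℝ, ℝ) (fun _ => (0 : ℝ)) x :=
    h.mfderiv_eq
  have h3 := mvfderiv_const (I := 𝓡 d) (M := M) (0 : ℝ) (x := x)
  ext v
  exact (congrArg (fun T => T v) h2).trans (congrArg (fun T => T v) h3)

theorem cechOne_apply (i : Fin m) (x : M) (v : TangentSpace (𝓡 d) x) :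
    cechOne d ρ e i x ![v] = ∑ l, ∑ k, e l i k * (ρ l x * mvfderiv (𝓡 d) (ρ k) x v) := by
  simp only [cechOne, Finset.sum_apply, Pi.smul_apply, ContinuousAlternatingMap.sum_apply,
    ContinuousAlternatingMap.smul_apply, smulDiff, oneForm_apply, smul_eq_mul]
  rfl

theorem cechTwo_apply (i : Fin m) (x : M) (v : Fin 2 → TangentSpace (𝓡 d) x) :
    cechTwo d ρ e i x v = ∑ l, ∑ k, e l i k *
      (mvfderiv (𝓡 d) (ρ l) x (v 0) * mvfderiv (𝓡 d) (ρ k) x (v 1)) -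
      ∑ l, ∑ k, e l i k *
      (mvfderiv (𝓡 d) (ρ l) x (v 1) * mvfderiv (𝓡 d) (ρ k) x (v 0)) := by
  simp only [cechTwo, Finset.sum_apply, Pi.smul_apply, ContinuousAlternatingMap.sum_apply,
    ContinuousAlternatingMap.smul_apply, wedgeDiff, wedge_apply, smul_eq_mul, mul_sub,
    Finset.sum_sub_distrib]

theorem contMDiff_cechFun (hρ : ∀ i, ContMDiff (𝓡 d) 𝓘(ℝ, ℝ) ∞ (ρ i)) (i j : Fin m) :
    ContMDiff (𝓡 d) 𝓘(ℝ, ℝ) ∞ (cechFun ρ e i j) :=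
  contMDiff_finsetSum fun k _ => contMDiff_const.mul (hρ k)

theorem mvfderiv_cechFun (hρ : ∀ i, ContMDiff (𝓡 d) 𝓘(ℝ, ℝ) ∞ (ρ i)) (i j : Fin m) (x : M)
    (v : TangentSpace (𝓡 d) x) :
    mvfderiv (𝓡 d) (cechFun ρ e i j) x v = ∑ k, e i j k * mvfderiv (𝓡 d) (ρ k) x v := by
  have h1 : ∀ s : Finset (Fin m),
      MDifferentiableAt (𝓡 d) 𝓘(ℝ, ℝ) (fun x => ∑ k ∈ s, e i j k * ρ k x) x ∧
      mvfderiv (𝓡 d) (fun x => ∑ k ∈ s, e i j k * ρ k x) x v =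
        ∑ k ∈ s, e i j k * mvfderiv (𝓡 d) (ρ k) x v := by
    intro s
    induction s using Finset.induction_on with
    | empty => exact ⟨by simpa using mdifferentiableAt_const, by simp [mvfderiv_const]⟩
    | insert a s ha ih =>
      have ha' := (hρ a).mdifferentiable (by simp) x
      have ha2 : MDifferentiableAt (𝓡 d) 𝓘(ℝ, ℝ) (fun x => e i j a * ρ a x) x :=
        mdifferentiableAt_const.mul ha'
      simp only [Finset.sum_insert ha]
      refine ⟨ha2.add ih.1, ?_⟩
      rw [mvfderiv_fun_add ha2 ih.1, ← ih.2]
      have h3 : mvfderiv (𝓡 d) (fun x => e i j a * ρ a x) x =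
          e i j a • mvfderiv (𝓡 d) (ρ a) x := by
        rw [mvfderiv_fun_mul mdifferentiableAt_const ha']
        simp [mvfderiv_const]
      rw [h3]
      rfl
  exact (h1 Finset.univ).2

variable (hρ : ∀ i, ContMDiff (𝓡 d) 𝓘(ℝ, ℝ) ∞ (ρ i)) (hsum : ∀ x, ∑ i, ρ i x = 1)
  (hsupp : ∀ i, tsupport (ρ i) ⊆ U i)
  (he : ∀ i j k l x, x ∈ U i → x ∈ U j → x ∈ U k → x ∈ U l →
    e j k l - e i k l + e i j l - e i j k = 0)

include hsum hsupp he

/-- Wherever `ρ l` is nonzero the cocycle identity for `(i, j, k, l)` applies; its weighted sum over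
`l` uses `∑ ρ l = 1`. -/
theorem cechFun_add_sub {i j k : Fin m} {x : M} (hi : x ∈ U i) (hj : x ∈ U j) (hk : x ∈ U k) :
    cechFun ρ e i j x + cechFun ρ e j k x - cechFun ρ e i k x = e i j k := by
  simp only [cechFun]
  rw [← Finset.sum_add_distrib, ← Finset.sum_sub_distrib]
  calc _ = ∑ l, e i j k * ρ l x := Finset.sum_congr rfl fun l _ => by
        by_cases hl : ρ l x = 0
        · simp [hl]
        · have hlU : x ∈ U l := hsupp l (subset_tsupport _ hl)
          linear_combination (ρ l x) * he i j k l x hi hj hk hlU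
    _ = e i j k := by rw [← Finset.mul_sum, hsum, mul_one]

include hρ

/-- The identity for `(l, i, j, k)` gives `e l j k - e l i k = e i j k - e l i j`. The part in `k`
sums to the differential of `cechFun`, and the part in `l` is killed by `∑ dρ k = 0`. -/
theorem cechOne_sub {i j : Fin m} {x : M} (hi : x ∈ U i) (hj : x ∈ U j)
    (v : TangentSpace (𝓡 d) x) :
    cechOne d ρ e j x ![v] - cechOne d ρ e i x ![v] = mvfderiv (𝓡 d) (cechFun ρ e i j) x v := by
  rw [cechOne_apply, cechOne_apply, mvfderiv_cechFun hρ, ← Finset.sum_sub_distrib]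
  simp only [← Finset.sum_sub_distrib, ← sub_mul]
  rw [sum_sum_mul_mul_eq (p := fun k => e i j k) (q := fun l => e l i j), hsum,
    sum_mvfderiv_eq_zero hρ hsum]
  · ring
  · intro l k hl hk
    have hlU : x ∈ U l := hsupp l (subset_tsupport _ hl)
    have hkU : x ∈ U k := by
      by_contra h
      exact hk (by rw [mvfderiv_eq_zero_of_notMem (hsupp k) h]; rfl)
    linear_combination -he l i j k x hlU hi hj hkU

/-- The same splitting, where now both parts vanish because the differentials `dρ l` and `dρ k` each
sum to zero. -/
theorem cechTwo_eq {i j : Fin m} {x : M} (hi : x ∈ U i) (hj : x ∈ U j) :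
    cechTwo d ρ e i x = cechTwo d ρ e j x := by
  have key : ∀ u v : TangentSpace (𝓡 d) x, ∑ l, ∑ k, (e l i k - e l j k) *
      (mvfderiv (𝓡 d) (ρ l) x u * mvfderiv (𝓡 d) (ρ k) x v) = 0 := by
    intro u v
    rw [sum_sum_mul_mul_eq (p := fun k => e j i k) (q := fun l => e l j i),
      sum_mvfderiv_eq_zero hρ hsum, sum_mvfderiv_eq_zero hρ hsum]
    · ring
    · intro l k hl hk
      have hlU : x ∈ U l := by
        by_contra h
        exact hl (by rw [mvfderiv_eq_zero_of_notMem (hsupp l) h]; rfl)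
      have hkU : x ∈ U k := by
        by_contra h
        exact hk (by rw [mvfderiv_eq_zero_of_notMem (hsupp k) h]; rfl)
      linear_combination -he l j i k x hlU hj hi hkU
  ext v
  have h1 := key (v 0) (v 1)
  have h2 := key (v 1) (v 0)
  simp only [sub_mul, Finset.sum_sub_distrib] at h1 h2
  rw [cechTwo_apply, cechTwo_apply]
  linarith

/-- The local expressions agree on overlaps, so averaging them by the partition of unity changes
nothing. -/
theorem cechForm_eq {j : Fin m} {x : M} (hj : x ∈ U j) : cechForm d ρ e x = cechTwo d ρ e j x := by
  calc cechForm d ρ e x = ∑ i, ρ i x • cechTwo d ρ e j x := by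
        refine Finset.sum_congr rfl fun i _ => ?_
        by_cases h : ρ i x = 0
        · simp [h]
        · rw [cechTwo_eq hρ hsum hsupp he (hsupp i (subset_tsupport _ h)) hj]
    _ = cechTwo d ρ e j x := by rw [← Finset.sum_smul, hsum, one_smul]

omit hsum hsupp he

theorem smoothOn_cechOne (i : Fin m) (V : Set M) : (cechOne d ρ e i).SmoothOn V :=
  smoothOn_sum fun l _ => smoothOn_sum fun k _ => (smoothOn_smulDiff (hρ l) (hρ k) V).const_smul _

theorem hasExtDerivOn_cechOne (i : Fin m) {V : Set M} (hV : IsOpen V) :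
    (cechOne d ρ e i).HasExtDerivOn (cechTwo d ρ e i) V :=
  hasExtDerivOn_sum hV (fun l _ => smoothOn_sum fun k _ =>
      (smoothOn_smulDiff (hρ l) (hρ k) V).const_smul _) fun l _ =>
    hasExtDerivOn_sum hV (fun k _ => (smoothOn_smulDiff (hρ l) (hρ k) V).const_smul _) fun k _ =>
      (hasExtDerivOn_smulDiff (hρ l) (hρ k) V).const_smul _

theorem smoothOn_cechForm (V : Set M) : (cechForm d ρ e).SmoothOn V := by
  rw [cechForm_eq_sum]
  exact smoothOn_sum fun i _ => smoothOn_sum fun l _ => smoothOn_sum fun k _ =>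
    (smoothOn_smul_wedgeDiff (hρ i) (hρ l) (hρ k) V).const_smul _

end Cech

/-! ### Perturbation of a closed form to one with an integral multiple -/

section Integral

open Set Filter

variable {d : ℕ} {M : Type*} [TopologicalSpace M] [ChartedSpace (EuclideanSpace ℝ (Fin d)) M]
  [IsManifold (𝓡 d) ∞ M]

theorem chartImage_inter (p : M) (U V : Set M) :
    chartImage (d := d) p (U ∩ V) = chartImage p U ∩ chartImage p V := by
  rw [chartImage, preimage_inter, inter_inter_distrib_left]; rfl

/-- A closed `2`-form on a compact manifold can be perturbed to a closed form with an integral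
multiple, by adding an arbitrarily small form of the type `cechForm d ρ e`. -/
theorem exists_integral_perturbation [T2Space M] [CompactSpace M] {Ω : DForm d 2 M}
    (hs : Ω.SmoothOn univ) (hcl : Ω.HasExtDerivOn 0 univ) :
    ∃ (m : ℕ) (ρ : Fin m → M → ℝ), (∀ i, ContMDiff (𝓡 d) 𝓘(ℝ, ℝ) ∞ (ρ i)) ∧
      ∀ ε : ℝ, 0 < ε → ∃ e : Fin m → Fin m → Fin m → ℝ, (∀ l i k, |e l i k| < ε) ∧
        (Ω + cechForm d ρ e).SmoothOn univ ∧ (Ω + cechForm d ρ e).HasExtDerivOn 0 univ ∧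
        ∃ N : ℕ, 0 < N ∧ IsIntegral ((N : ℝ) • (Ω + cechForm d ρ e)) := by
  obtain ⟨m, U, p, hU, hcov, hne, hgood⟩ := exists_good_cover d M
  obtain ⟨P, hP⟩ := SmoothPartitionOfUnity.exists_isSubordinate (𝓡 d) isClosed_univ U hU
    (by rw [hcov])
  set ρ : Fin m → M → ℝ := fun i => P i with hρdef
  have hρ : ∀ i, ContMDiff (𝓡 d) 𝓘(ℝ, ℝ) ∞ (ρ i) := fun i => (P i).contMDiff
  have hsum : ∀ x, ∑ i, ρ i x = 1 := fun x => by
    rw [← finsum_eq_sum_of_fintype]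
    exact P.sum_eq_one (mem_univ x)
  have hsupp : ∀ i, tsupport (ρ i) ⊆ U i := hP
  -- The cover and the partition of unity are fixed before `ε`, since the admissible size of `e`
  -- will depend on `ρ`.
  refine ⟨m, ρ, hρ, fun ε hε => ?_⟩
  have hself : ∀ i, U i ⊆ (extChartAt (𝓡 d) (p i)).source ∧
      Convex ℝ (chartImage (d := d) (p i) (U i)) := fun i =>
    hgood i i (by rw [inter_self]; exact hne i)
  choose θ hθs hθd using fun i => exists_primitive_form (hU i) (hself i).1 (hself i).2
    (hs.mono (subset_univ (U i))) (hcl.mono (subset_univ (U i)))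
  have hf : ∀ i j, ∃ f : M → ℝ, ContMDiffOn (𝓡 d) 𝓘(ℝ, ℝ) ∞ f (U i ∩ U j) ∧
      ∀ x ∈ U i ∩ U j, ∀ v : TangentSpace (𝓡 d) x,
        mvfderiv (𝓡 d) f x v = θ j x ![v] - θ i x ![v] := by
    intro i j
    rcases (U i ∩ U j).eq_empty_or_nonempty with h | h
    · exact ⟨0, by simp [h], by simp [h]⟩
    -- Both sets are convex in the one chart attached to `U i`, so their intersection is as well.
    have hcv : Convex ℝ (chartImage (d := d) (p i) (U i ∩ U j)) := by
      rw [chartImage_inter]; exact (hself i).2.inter (hgood i j h).2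
    have hsi := (hθs i).mono (inter_subset_left : U i ∩ U j ⊆ U i)
    have hsj := (hθs j).mono (inter_subset_right : U i ∩ U j ⊆ U j)
    have hd := ((hθd j).mono (inter_subset_right : U i ∩ U j ⊆ U j)).add
      ((hU i).inter (hU j)) hsj (hsi.const_smul (-1))
      (((hθd i).mono (inter_subset_left : U i ∩ U j ⊆ U i)).const_smul (-1))
    rw [neg_one_smul ℝ Ω, add_neg_cancel] at hd
    obtain ⟨f, hf, hdf⟩ := exists_primitive_function ((hU i).inter (hU j))
      (inter_subset_left.trans (hself i).1) hcv (hsj.add (hsi.const_smul (-1))) hd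
    refine ⟨f, hf, fun x hx v => ?_⟩
    rw [hdf x hx v, neg_one_smul]
    exact (sub_eq_add_neg _ _).symm
  choose f hfs hfd using hf
  have hconst : ∀ i j k, ∃ c : ℝ, ∀ x ∈ U i ∩ U j ∩ U k, f i j x + f j k x - f i k x = c := by
    intro i j k
    rcases (U i ∩ U j ∩ U k).eq_empty_or_nonempty with h | ⟨x₀, hx₀⟩
    · exact ⟨0, by simp [h]⟩
    have hij : (U i ∩ U j).Nonempty := ⟨x₀, hx₀.1⟩
    have hik : (U i ∩ U k).Nonempty := ⟨x₀, hx₀.1.1, hx₀.2⟩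
    have hopen := ((hU i).inter (hU j)).inter (hU k)
    have hcv : Convex ℝ (chartImage (d := d) (p i) (U i ∩ U j ∩ U k)) := by
      rw [chartImage_inter, chartImage_inter]
      exact ((hself i).2.inter (hgood i j hij).2).inter (hgood i k hik).2
    have h1 := (hfs i j).mono (fun x (hx : x ∈ U i ∩ U j ∩ U k) => hx.1)
    have h2 := (hfs j k).mono (fun x (hx : x ∈ U i ∩ U j ∩ U k) => ⟨hx.1.2, hx.2⟩)
    have h3 := (hfs i k).mono (fun x (hx : x ∈ U i ∩ U j ∩ U k) => ⟨hx.1.1, hx.2⟩)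
    refine ⟨f i j x₀ + f j k x₀ - f i k x₀, fun x hx => ?_⟩
    refine eq_of_mvfderiv_eq_zero (f := fun x => f i j x + f j k x - f i k x) hopen
      (fun x hx => (hself i).1 hx.1.1) hcv ((h1.add h2).sub h3) (fun x hx => ?_) hx hx₀
    have g1 := (h1.contMDiffAt (hopen.mem_nhds hx)).mdifferentiableAt (by simp)
    have g2 := (h2.contMDiffAt (hopen.mem_nhds hx)).mdifferentiableAt (by simp)
    have g3 := (h3.contMDiffAt (hopen.mem_nhds hx)).mdifferentiableAt (by simp)
    ext v
    have e1 : mvfderiv (𝓡 d) (fun x => f i j x + f j k x - f i k x) x =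
        mvfderiv (𝓡 d) (f i j) x + mvfderiv (𝓡 d) (f j k) x - mvfderiv (𝓡 d) (f i k) x := by
      have g12 : MDifferentiableAt (𝓡 d) 𝓘(ℝ, ℝ) (fun x => f i j x + f j k x) x := g1.add g2
      rw [mvfderiv_fun_sub g12 g3, mvfderiv_fun_add g1 g2]
    rw [e1]
    change mvfderiv (𝓡 d) (f i j) x v + mvfderiv (𝓡 d) (f j k) x v -
      mvfderiv (𝓡 d) (f i k) x v = 0
    rw [hfd i j x hx.1, hfd j k x ⟨hx.1.2, hx.2⟩, hfd i k x ⟨hx.1.1, hx.2⟩]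
    ring
  choose c hc using hconst
  let ct : Fin m × Fin m × Fin m → ℝ := fun t => c t.1 t.2.1 t.2.2
  obtain ⟨φ, hφ⟩ := exists_rat_linearMap_approx ct hε
  let z : Fin m × Fin m × Fin m → Submodule.span ℚ (range ct) :=
    fun t => ⟨ct t, Submodule.subset_span ⟨t, rfl⟩⟩
  have hcocycle : ∀ i j k l x, x ∈ U i → x ∈ U j → x ∈ U k → x ∈ U l →
      c j k l - c i k l + c i j l - c i j k = 0 := by
    intro i j k l x hi hj hk hl
    rw [← hc j k l x ⟨⟨hj, hk⟩, hl⟩, ← hc i k l x ⟨⟨hi, hk⟩, hl⟩, ← hc i j l x ⟨⟨hi, hj⟩, hl⟩,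
      ← hc i j k x ⟨⟨hi, hj⟩, hk⟩]
    ring
  -- The correction `e` turns `c` into the rational `φ (z _)`. It is again a cocycle, since `φ` is
  -- additive and so respects the relations among the `c i j k`.
  let e : Fin m → Fin m → Fin m → ℝ := fun i j k => (φ (z (i, j, k)) : ℝ) - c i j k
  have he : ∀ i j k l x, x ∈ U i → x ∈ U j → x ∈ U k → x ∈ U l →
      e j k l - e i k l + e i j l - e i j k = 0 := by
    intro i j k l x hi hj hk hl
    have h1 := hcocycle i j k l x hi hj hk hl
    have h2 : z (j, k, l) - z (i, k, l) + z (i, j, l) - z (i, j, k) = 0 := by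
      ext; exact h1
    have h3 := congrArg φ h2
    simp only [map_sub, map_add, map_zero] at h3
    have h4 : (φ (z (j, k, l)) : ℝ) - φ (z (i, k, l)) + φ (z (i, j, l)) - φ (z (i, j, k)) = 0 := by
      exact_mod_cast h3
    simp only [e]
    linarith
  have hloc : ∀ i, (θ i + cechOne d ρ e i).SmoothOn (U i) ∧
      (θ i + cechOne d ρ e i).HasExtDerivOn (Ω + cechForm d ρ e) (U i) := by
    intro i
    have h1 := smoothOn_cechOne (e := e) hρ i (U i)
    refine ⟨(hθs i).add h1, ?_⟩
    refine ((hθd i).add (hU i) (hθs i) h1 (hasExtDerivOn_cechOne (e := e) hρ i (hU i))).congr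
      (hU i) (fun _ _ => rfl) fun x hx => ?_
    simp only [Pi.add_apply, cechForm_eq hρ hsum hsupp he hx]
  have hmem : ∀ x, ∃ i, x ∈ U i := fun x => mem_iUnion.1 (by rw [hcov]; trivial)
  refine ⟨e, fun i j k => hφ (i, j, k), hs.add (smoothOn_cechForm hρ _),
    hasExtDerivOn_of_local fun x _ => ?_, ?_⟩
  · obtain ⟨i, hi⟩ := hmem x
    exact ⟨U i, hi, (hloc i).2.closed (hU i) (hloc i).1⟩
  -- A common denominator of all the rational numbers `φ (z t)`.
  · let N : ℕ := ∏ t, (φ (z t)).den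
    have hN : ∀ t, ∃ a : ℤ, (N : ℝ) * φ (z t) = a := by
      intro t
      obtain ⟨b, hb⟩ : (φ (z t)).den ∣ N := Finset.dvd_prod_of_mem _ (Finset.mem_univ t)
      refine ⟨b * (φ (z t)).num, ?_⟩
      have h1 : ((φ (z t)).den : ℝ) * φ (z t) = (φ (z t)).num := by
        exact_mod_cast Rat.den_mul_eq_num (φ (z t))
      rw [hb]
      push_cast
      linear_combination (b : ℝ) * h1
    refine ⟨N, Finset.prod_pos fun t _ => (φ (z t)).den_pos, Fin m, U,
      fun i => (N : ℝ) • (θ i + cechOne d ρ e i),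
      fun i j x => (N : ℝ) * (f i j x + cechFun ρ e i j x), hU, hcov,
      fun i => (hloc i).1.const_smul _, fun i => (hloc i).2.const_smul _, ?_, ?_, ?_⟩
    · exact fun i j => contMDiffOn_const.mul ((hfs i j).add (contMDiff_cechFun hρ i j).contMDiffOn)
    · intro i j x hx v
      have g1 := ((hfs i j).contMDiffAt (((hU i).inter (hU j)).mem_nhds hx)).mdifferentiableAt
        (by simp)
      have g2 := (contMDiff_cechFun (e := e) hρ i j).mdifferentiable (by simp) x
      have h1 : mvfderiv (𝓡 d) (fun x => (N : ℝ) * (f i j x + cechFun ρ e i j x)) x =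
          (N : ℝ) • (mvfderiv (𝓡 d) (f i j) x + mvfderiv (𝓡 d) (cechFun ρ e i j) x) := by
        have g12 : MDifferentiableAt (𝓡 d) 𝓘(ℝ, ℝ) (fun x => f i j x + cechFun ρ e i j x) x :=
          g1.add g2
        rw [mvfderiv_fun_mul mdifferentiableAt_const g12, mvfderiv_fun_add g1 g2]
        simp [mvfderiv_const]
      rw [h1]
      change (N : ℝ) * (θ j x ![v] + cechOne d ρ e j x ![v]) -
        (N : ℝ) * (θ i x ![v] + cechOne d ρ e i x ![v]) =
        (N : ℝ) * (mvfderiv (𝓡 d) (f i j) x v + mvfderiv (𝓡 d) (cechFun ρ e i j) x v)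
      rw [hfd i j x hx, ← cechOne_sub hρ hsum hsupp he hx.1 hx.2]
      ring
    · intro i j k x hx
      obtain ⟨a, ha⟩ := hN (i, j, k)
      refine ⟨a, ?_⟩
      have h1 := hc i j k x hx
      have h2 := cechFun_add_sub hsum hsupp he hx.1.1 hx.1.2 hx.2
      rw [← ha]
      have h3 : e i j k = φ (z (i, j, k)) - c i j k := rfl
      linear_combination (N : ℝ) * (h1 + h2 + h3)

end Integral

/-! ### The binomial series `(1 + y)^(-1/2)` in a Banach algebra -/

section InvSqrt

open Filter Metric

/-- The coefficients of the power series of `(1 + y) ^ (-1/2)`. -/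
def invSqrtCoeff (n : ℕ) : ℝ := Ring.choose (-1 / 2 : ℝ) n

/-- The power series of `(1 + y) ^ (-1/2)`, evaluated in a topological algebra. -/
def invSqrt {A : Type*} [Ring A] [Algebra ℝ A] [TopologicalSpace A] (y : A) : A :=
  ∑' n, invSqrtCoeff n • y ^ n

theorem summable_invSqrtCoeff {r : ℝ} (h0 : 0 ≤ r) (h1 : r < 1) :
    Summable fun n => |invSqrtCoeff n| * r ^ n := by
  have h2 := binomialSeries_radius_ge_one (𝕂 := ℝ) (𝔸 := ℝ) (a := (-1 / 2 : ℝ))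
  lift r to NNReal using h0
  have h3 := (binomialSeries ℝ (-1 / 2 : ℝ)).summable_norm_mul_pow (r := r)
    (lt_of_lt_of_le (by exact_mod_cast h1) h2)
  refine h3.congr fun n => ?_
  rw [binomialSeries, FormalMultilinearSeries.ofScalars_norm]
  rfl

theorem invSqrtCoeff_zero : invSqrtCoeff 0 = 1 := by simp [invSqrtCoeff]

variable {A : Type*} [NormedRing A] [NormedAlgebra ℝ A]

theorem summable_norm_invSqrt {y : A} (hy : ‖y‖ < 1) :
    Summable fun n => ‖invSqrtCoeff n • y ^ n‖ := by
  have h := summable_invSqrtCoeff (norm_nonneg y) hy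
  -- The term of index `0` is dropped because `‖1‖ = 1` is not assumed in `A`: the endomorphisms of
  -- the zero space are allowed.
  rw [← summable_nat_add_iff 1] at h ⊢
  refine Summable.of_nonneg_of_le (fun _ => norm_nonneg _) (fun n => ?_) h
  rw [norm_smul, Real.norm_eq_abs]
  exact mul_le_mul_of_nonneg_left (norm_pow_le' y n.succ_pos) (abs_nonneg _)

theorem invSqrt_zero : invSqrt (0 : A) = 1 := by
  rw [invSqrt, tsum_eq_single 0 fun n hn => by simp [hn]]
  simp [invSqrtCoeff_zero]

theorem commute_invSqrt {a y : A} (h : Commute a y) : Commute a (invSqrt y) :=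
  Commute.tsum_right a fun n => (h.pow_right n).smul_right _

variable [CompleteSpace A]

theorem summable_invSqrt {y : A} (hy : ‖y‖ < 1) : Summable fun n => invSqrtCoeff n • y ^ n :=
  (summable_norm_invSqrt hy).of_norm

theorem tsum_coeff_mul (y : A) {f g : PowerSeries ℝ}
    {F G : ℕ → A} (hF : ∀ n, F n = PowerSeries.coeff n f • y ^ n)
    (hG : ∀ n, G n = PowerSeries.coeff n g • y ^ n)
    (hf : Summable fun n => ‖F n‖) (hg : Summable fun n => ‖G n‖) :
    (Summable fun n => ‖PowerSeries.coeff n (f * g) • y ^ n‖) ∧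
    ∑' n, PowerSeries.coeff n (f * g) • y ^ n =
      (∑' n, F n) * ∑' n, G n := by
  have h : ∀ n, PowerSeries.coeff n (f * g) • y ^ n =
      ∑ kl ∈ Finset.HasAntidiagonal.antidiagonal n, F kl.1 * G kl.2 := fun n => by
    rw [PowerSeries.coeff_mul, Finset.sum_smul]
    refine Finset.sum_congr rfl fun kl hkl => ?_
    rw [hF, hG, smul_mul_smul_comm, ← pow_add, Finset.HasAntidiagonal.mem_antidiagonal.1 hkl]
  rw [funext h, funext fun n => congrArg norm (h n)]
  exact ⟨summable_norm_sum_mul_antidiagonal_of_summable_norm hf hg,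
    (tsum_mul_tsum_eq_tsum_sum_antidiagonal_of_summable_norm hf hg).symm⟩

/-- The formal identity `b · b · (1 + X) = 1` holds because the exponents `-1/2 - 1/2 + 1` add up to
`0`. Cauchy products carry it over to `A`. -/
theorem invSqrt_mul_invSqrt_mul {y : A} (hy : ‖y‖ < 1) :
    invSqrt y * invSqrt y * (1 + y) = 1 := by
  let b : PowerSeries ℝ := PowerSeries.binomialSeries ℝ (-1 / 2 : ℝ)
  have hb : ∀ n, PowerSeries.coeff n b = invSqrtCoeff n := fun n => by
    simp [b, PowerSeries.binomialSeries_coeff, invSqrtCoeff]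
  have h1 : Summable fun n => ‖PowerSeries.coeff n b • y ^ n‖ := by
    simpa only [hb] using summable_norm_invSqrt hy
  have h2 : Summable fun n =>
      ‖PowerSeries.coeff n (1 + PowerSeries.X : PowerSeries ℝ) • y ^ n‖ := by
    refine summable_of_ne_finset_zero (s := {0, 1}) fun n hn => ?_
    simp only [Finset.mem_insert, Finset.mem_singleton, not_or] at hn
    simp [PowerSeries.coeff_one, PowerSeries.coeff_X, hn.1, hn.2]
  have h3 : ∑' n, PowerSeries.coeff n (1 + PowerSeries.X : PowerSeries ℝ) • y ^ n = 1 + y := by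
    rw [tsum_eq_sum (s := {0, 1}) fun n hn => ?_]
    · simp [PowerSeries.coeff_one, PowerSeries.coeff_X]
    · simp only [Finset.mem_insert, Finset.mem_singleton, not_or] at hn
      simp [PowerSeries.coeff_one, PowerSeries.coeff_X, hn.1, hn.2]
  have h4 : b * b * (1 + PowerSeries.X) = 1 := by
    have e1 := PowerSeries.binomialSeries_nat (R := ℝ) (A := ℝ) 1
    rw [Nat.cast_one, pow_one] at e1
    rw [← e1, ← PowerSeries.binomialSeries_add, ← PowerSeries.binomialSeries_add]
    norm_num
  obtain ⟨h5, h6⟩ := tsum_coeff_mul y (fun _ => rfl) (fun _ => rfl) h1 h1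
  obtain ⟨-, h7⟩ := tsum_coeff_mul y (fun _ => rfl) (fun _ => rfl) h5 h2
  rw [h4, h6, h3] at h7
  simp only [hb] at h7
  rw [invSqrt, ← h7, tsum_eq_single 0 fun n hn => by simp [PowerSeries.coeff_one, hn]]
  simp

theorem contDiffOn_invSqrt : ContDiffOn ℝ ∞ (invSqrt : A → A) (ball 0 1) := by
  let p : FormalMultilinearSeries ℝ A A := FormalMultilinearSeries.ofScalars A invSqrtCoeff
  have hr : 1 ≤ p.radius := by
    refine le_of_forall_lt_imp_le_of_dense fun r hr => ?_
    lift r to NNReal using hr.ne_top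
    have hr1 : (r : ℝ) < 1 := by exact_mod_cast hr
    have h := summable_invSqrtCoeff r.2 hr1
    refine p.le_radius_of_summable_norm ?_
    rw [← summable_nat_add_iff 1] at h ⊢
    refine Summable.of_nonneg_of_le (fun n => by positivity) (fun n => ?_) h
    exact mul_le_mul_of_nonneg_right
      (FormalMultilinearSeries.ofScalars_norm_le A _ _ n.succ_pos) (by positivity)
  have hp := p.hasFPowerSeriesOnBall (lt_of_lt_of_le one_pos hr)
  have hs : p.sum = invSqrt := FormalMultilinearSeries.ofScalarsSum_eq_tsum ..
  rw [hs] at hp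
  refine (hp.analyticOnNhd.mono fun y hy => ?_).contDiffOn isOpen_ball.uniqueDiffOn
  rw [Metric.mem_eball, edist_zero_right]
  rw [mem_ball_zero_iff] at hy
  refine lt_of_lt_of_le ?_ hr
  rw [← enorm_norm, Real.enorm_eq_ofReal (norm_nonneg y)]
  exact ENNReal.ofReal_lt_one.2 hy

end InvSqrt

/-! ### Compatible complex structures by polar decomposition -/

section LinearAlgebra

open Filter Metric Topology

variable {V W : Type*} [NormedAddCommGroup V] [NormedSpace ℝ V]
  [NormedAddCommGroup W] [NormedSpace ℝ W]

/-- The bilinear form `(u, v) ↦ B u (J v)`, as a continuous linear map to the dual. -/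
def formMetric (B : V →L[ℝ] V →L[ℝ] ℝ) (J : V →L[ℝ] V) : V →L[ℝ] V →L[ℝ] ℝ :=
  ((ContinuousLinearMap.compL ℝ V V ℝ).flip J).comp B

@[simp] theorem formMetric_apply (B : V →L[ℝ] V →L[ℝ] ℝ) (J : V →L[ℝ] V) (u v : V) :
    formMetric B J u v = B u (J v) := rfl

/-- The endomorphism `A` with `(B + S)(u, v) = g(A u, v)`, where `g(u, v) = B(u, J v)` and `J` is
compatible with `B`. -/
def skewEnd (t : (V →L[ℝ] V →L[ℝ] ℝ) × (V →L[ℝ] V →L[ℝ] ℝ) × (V →L[ℝ] V)) : V →L[ℝ] V :=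
  t.2.2 + (formMetric t.1 t.2.2).inverse.comp t.2.1

/-- The orthogonal part `A (-A²)^(-1/2)` in the polar decomposition of `A = skewEnd t`. -/
def polarEnd (t : (V →L[ℝ] V →L[ℝ] ℝ) × (V →L[ℝ] V →L[ℝ] ℝ) × (V →L[ℝ] V)) : V →L[ℝ] V :=
  skewEnd t * invSqrt (-1 - skewEnd t * skewEnd t)

/-- `J` is a complex structure compatible with the bilinear form `B`. -/
structure LinCompatible (B : V →L[ℝ] V →L[ℝ] ℝ) (J : V →L[ℝ] V) : Prop where
  alt : ∀ u v, B u v = -B v u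
  sq : ∀ u, J (J u) = -u
  invariant : ∀ u v, B (J u) (J v) = B u v
  pos : ∀ u, u ≠ 0 → 0 < B u (J u)

/-- Transport of two bilinear forms and an endomorphism by an isomorphism. -/
def pushTriple (e : V ≃L[ℝ] W) (t : (V →L[ℝ] V →L[ℝ] ℝ) × (V →L[ℝ] V →L[ℝ] ℝ) × (V →L[ℝ] V)) :
    (W →L[ℝ] W →L[ℝ] ℝ) × (W →L[ℝ] W →L[ℝ] ℝ) × (W →L[ℝ] W) :=
  (e.arrowCongr (e.arrowCongr (.refl ℝ ℝ)) t.1, e.arrowCongr (e.arrowCongr (.refl ℝ ℝ)) t.2.1,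
    e.arrowCongr e t.2.2)

theorem contDiff_pushTriple (e : V ≃L[ℝ] W) : ContDiff ℝ ∞ (pushTriple e) := by
  unfold pushTriple
  fun_prop

theorem skewEnd_pushTriple (e : V ≃L[ℝ] W)
    (t : (V →L[ℝ] V →L[ℝ] ℝ) × (V →L[ℝ] V →L[ℝ] ℝ) × (V →L[ℝ] V)) :
    skewEnd (pushTriple e t) = e.arrowCongr e (skewEnd t) := by
  have h : formMetric (pushTriple e t).1 (pushTriple e t).2.2 =
      ((e.arrowCongr (.refl ℝ ℝ) : (V →L[ℝ] ℝ) ≃L[ℝ] (W →L[ℝ] ℝ)) :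
        (V →L[ℝ] ℝ) →L[ℝ] (W →L[ℝ] ℝ)).comp
        ((formMetric t.1 t.2.2).comp (e.symm : W →L[ℝ] V)) := by
    ext u v
    simp [pushTriple]
  rw [skewEnd, h, ContinuousLinearMap.inverse_equiv_comp, ContinuousLinearMap.inverse_comp_equiv]
  ext u
  simp only [pushTriple, skewEnd, ContinuousLinearMap.comp_apply, add_apply,
    ContinuousLinearEquiv.arrowCongr_apply, ContinuousLinearEquiv.coe_coe, map_add]
  congr 3
  ext v
  simp

theorem arrowCongr_mul (e : V ≃L[ℝ] W) (a b : V →L[ℝ] V) :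
    e.arrowCongr e (a * b) = e.arrowCongr e a * e.arrowCongr e b := by
  ext u; simp

theorem arrowCongr_one (e : V ≃L[ℝ] W) : e.arrowCongr e (1 : V →L[ℝ] V) = 1 := by
  ext u; simp

theorem arrowCongr_invSqrt (e : V ≃L[ℝ] W) (a : V →L[ℝ] V) :
    e.arrowCongr e (invSqrt a) = invSqrt (e.arrowCongr e a) := by
  have h : ∀ n : ℕ, e.arrowCongr e (a ^ n) = (e.arrowCongr e a) ^ n := fun n => by
    induction n with
    | zero => simpa using arrowCongr_one e
    | succ n ih => rw [pow_succ, pow_succ, arrowCongr_mul, ih]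
  rw [invSqrt, invSqrt, ContinuousLinearEquiv.map_tsum]
  simp only [map_smul, h]

/-- Naturality under isomorphisms: the polar part computed in a chart is the chart expression of the
pointwise one. -/
theorem polarEnd_pushTriple (e : V ≃L[ℝ] W)
    (t : (V →L[ℝ] V →L[ℝ] ℝ) × (V →L[ℝ] V →L[ℝ] ℝ) × (V →L[ℝ] V)) :
    polarEnd (pushTriple e t) = e.arrowCongr e (polarEnd t) := by
  rw [polarEnd, polarEnd, skewEnd_pushTriple, arrowCongr_mul, arrowCongr_invSqrt, map_sub, map_neg,
    arrowCongr_one, arrowCongr_mul]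

theorem LinCompatible.push {B : V →L[ℝ] V →L[ℝ] ℝ} {J : V →L[ℝ] V} (h : LinCompatible B J)
    (e : V ≃L[ℝ] W) :
    LinCompatible (e.arrowCongr (e.arrowCongr (.refl ℝ ℝ)) B) (e.arrowCongr e J) where
  alt u v := by simpa using h.alt (e.symm u) (e.symm v)
  sq u := by simp [h.sq]
  invariant u v := by simpa using h.invariant (e.symm u) (e.symm v)
  pos u hu := by simpa using h.pos (e.symm u) (by simpa using hu)

section Compatible

variable [FiniteDimensional ℝ V] {B S : V →L[ℝ] V →L[ℝ] ℝ} {J : V →L[ℝ] V}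

theorem LinCompatible.symm (h : LinCompatible B J) (u v : V) :
    formMetric B J u v = formMetric B J v u := by
  rw [formMetric_apply, formMetric_apply, ← h.invariant, h.sq, h.alt]
  simp

theorem LinCompatible.isInvertible (h : LinCompatible B J) : (formMetric B J).IsInvertible := by
  have hinj : Function.Injective (formMetric B J).toLinearMap := by
    refine (injective_iff_map_eq_zero _).2 fun u hu => ?_
    by_contra hne
    have := h.pos u hne
    have h2 : formMetric B J u u = 0 := by
      have : formMetric B J u = 0 := hu
      rw [this]; rfl
    rw [formMetric_apply] at h2
    linarith
  have hfr : Module.finrank ℝ V = Module.finrank ℝ (V →L[ℝ] ℝ) := by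
    rw [← LinearMap.toContinuousLinearMap.finrank_eq]
    exact Subspace.dual_finrank_eq.symm
  let e := (LinearEquiv.ofInjectiveOfFinrankEq _ hinj hfr).toContinuousLinearEquiv
  exact ⟨e, by ext u v; rfl⟩

theorem LinCompatible.metric_skewEnd (h : LinCompatible B J) (u v : V) :
    formMetric B J (skewEnd (B, S, J) u) v = (B + S) u v := by
  have h1 : formMetric B J ((formMetric B J).inverse (S u)) = S u :=
    ContinuousLinearMap.IsInvertible.self_apply_inverse h.isInvertible _
  have h2 : formMetric B J (J u) v = B u v := h.invariant u v
  simp only [skewEnd, add_apply, ContinuousLinearMap.comp_apply, map_add, h1, h2]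

variable (hS : ∀ u v, S u v = -S v u) (hJ : LinCompatible B J)
  (hn : ‖-1 - skewEnd (B, S, J) * skewEnd (B, S, J)‖ < 1)

include hS hJ

/-- `B + S` is alternating and the metric is symmetric, so the endomorphism representing one in the
other is skew. -/
theorem metric_skewEnd_right (u v : V) : formMetric B J u (skewEnd (B, S, J) v) =
    -formMetric B J (skewEnd (B, S, J) u) v := by
  rw [hJ.symm, hJ.metric_skewEnd, hJ.metric_skewEnd]
  simp only [add_apply]
  rw [hS v u, hJ.alt v u]; ring

include hn

/-- The square of a skew endomorphism is self-adjoint, hence so are `-1 - A²`, its powers, and the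
sum of the series. -/
theorem metric_invSqrt (u v : V) :
    formMetric B J (invSqrt (-1 - skewEnd (B, S, J) * skewEnd (B, S, J)) u) v =
      formMetric B J u (invSqrt (-1 - skewEnd (B, S, J) * skewEnd (B, S, J)) v) := by
  set A := skewEnd (B, S, J)
  set y := -1 - A * A
  have hy : ∀ u v, formMetric B J (y u) v = formMetric B J u (y v) := fun u v => by
    have := metric_skewEnd_right hS hJ u (A v)
    have h2 := metric_skewEnd_right hS hJ (A u) v
    simp only [y, sub_apply, neg_apply,
      one_apply_eq_self, mul_apply_eq_comp, map_sub, map_neg]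
    simp only [A] at *
    linarith
  have hyn : ∀ (n : ℕ) u v,
      formMetric B J ((y ^ n) u) v = formMetric B J u ((y ^ n) v) := fun n => by
    induction n with
    | zero => intro u v; rfl
    | succ n ih =>
      intro u v
      rw [pow_succ, mul_apply_eq_comp, ih, hy, ← mul_apply_eq_comp, ← pow_succ',
        pow_succ]
  have hs := (summable_invSqrt hn).hasSum
  have h1 := hs.mapL (((formMetric B J).flip v).comp (ContinuousLinearMap.apply ℝ V u))
  have h2 := hs.mapL ((formMetric B J u).comp (ContinuousLinearMap.apply ℝ V v))
  have h3 : ∀ n, (((formMetric B J).flip v).comp (ContinuousLinearMap.apply ℝ V u))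
      (invSqrtCoeff n • y ^ n) =
      ((formMetric B J u).comp (ContinuousLinearMap.apply ℝ V v)) (invSqrtCoeff n • y ^ n) :=
    fun n => by simpa using Or.inl (hyn n u v)
  rw [← funext h3] at h2
  exact h1.unique h2

/-- With `P = (-A²)^(-1/2)` commuting with `A`, one has `(AP)² = A²P² = -1`. Invariance follows from
`A` skew and `P` self-adjoint. Positivity is left as a hypothesis, to be obtained for small `S` by
continuity. -/
theorem linCompatible_polarEnd (hpos : ∀ u, u ≠ 0 → 0 < (B + S) u (polarEnd (B, S, J) u)) :
    LinCompatible (B + S) (polarEnd (B, S, J)) := by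
  set A := skewEnd (B, S, J) with hA
  set P := invSqrt (-1 - A * A) with hP
  have hJ' : polarEnd (B, S, J) = A * P := rfl
  have hcomm : A * P = P * A :=
    commute_invSqrt (((Commute.one_right A).neg_right).sub_right
      ((Commute.refl A).mul_right (Commute.refl A)))
  have hPP : P * P * (1 + (-1 - A * A)) = 1 := invSqrt_mul_invSqrt_mul hn
  have hsq : (A * P) * (A * P) = -1 := by
    have h1 : A * P * (A * P) = P * P * (A * A) := by
      rw [hcomm, mul_assoc, ← mul_assoc A P A, hcomm, mul_assoc, mul_assoc]
    rw [h1]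
    have h2 : P * P * (1 + (-1 - A * A)) = -(P * P * (A * A)) := by
      rw [← mul_neg]; congr 1; abel
    rw [h2] at hPP
    rw [← hPP, neg_neg]
  have hsqv : ∀ u, A (P (A (P u))) = -u := fun u => congrArg (fun T : V →L[ℝ] V => T u) hsq
  have hcv : ∀ u, A (P u) = P (A u) := fun u => congrArg (fun T : V →L[ℝ] V => T u) hcomm
  refine ⟨fun u v => ?_, fun u => ?_, fun u v => ?_, hpos⟩
  · simp only [add_apply]
    rw [hS u v, hJ.alt u v]; ring
  · rw [hJ']; exact hsqv u
  · rw [hJ', ← hJ.metric_skewEnd, ← hJ.metric_skewEnd]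
    simp only [mul_apply_eq_comp]
    rw [← hA, metric_skewEnd_right hS hJ, ← metric_invSqrt hS hJ hn, ← hA, ← hP, ← hcv,
      hcv, hcv, ← hcv (A _), hsqv]
    simp

end Compatible

/-! ### Smallness of the perturbation, independently of coordinates -/

section Smallness

variable [FiniteDimensional ℝ V]

theorem contDiffAt_skewEnd
    {t : (V →L[ℝ] V →L[ℝ] ℝ) × (V →L[ℝ] V →L[ℝ] ℝ) × (V →L[ℝ] V)}
    (ht : LinCompatible t.1 t.2.2) : ContDiffAt ℝ ∞ skewEnd t := by
  have hi := ht.isInvertible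
  obtain ⟨e, he⟩ := hi
  have h1 : ContDiffAt ℝ ∞ (fun t : (V →L[ℝ] V →L[ℝ] ℝ) × (V →L[ℝ] V →L[ℝ] ℝ) × (V →L[ℝ] V) =>
      formMetric t.1 t.2.2) t := by
    unfold formMetric
    fun_prop
  have h2 : ContDiffAt ℝ ∞ ContinuousLinearMap.inverse (formMetric t.1 t.2.2) := by
    rw [← he]; exact contDiffAt_map_inverse e
  have h3 := ContDiffAt.comp t h2 h1
  have h4 : ContDiffAt ℝ ∞ (fun t : (V →L[ℝ] V →L[ℝ] ℝ) × (V →L[ℝ] V →L[ℝ] ℝ) × (V →L[ℝ] V) =>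
      t.2.1) t := by fun_prop
  have h5 : ContDiffAt ℝ ∞ (fun t : (V →L[ℝ] V →L[ℝ] ℝ) × (V →L[ℝ] V →L[ℝ] ℝ) × (V →L[ℝ] V) =>
      t.2.2) t := by fun_prop
  exact h5.add (h3.clm_comp h4)

theorem contDiffAt_polarEnd
    {t : (V →L[ℝ] V →L[ℝ] ℝ) × (V →L[ℝ] V →L[ℝ] ℝ) × (V →L[ℝ] V)}
    (ht : LinCompatible t.1 t.2.2) (hn : ‖-1 - skewEnd t * skewEnd t‖ < 1) :
    ContDiffAt ℝ ∞ polarEnd t := by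
  have h1 := contDiffAt_skewEnd ht
  have h2 : ContDiffAt ℝ ∞ (fun t => -1 - skewEnd t * skewEnd t) t :=
    contDiffAt_const.sub (h1.mul h1)
  have h3 : ContDiffAt ℝ ∞ (invSqrt : (V →L[ℝ] V) → (V →L[ℝ] V)) (-1 - skewEnd t * skewEnd t) :=
    contDiffOn_invSqrt.contDiffAt (isOpen_ball.mem_nhds (by simpa using hn))
  have h4 : ContDiffAt ℝ ∞ (fun t => invSqrt (-1 - skewEnd t * skewEnd t)) t :=
    ContDiffAt.comp (g := (invSqrt : (V →L[ℝ] V) → (V →L[ℝ] V))) t h3 h2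
  exact h1.mul h4

theorem skewEnd_zero (B : V →L[ℝ] V →L[ℝ] ℝ) (J : V →L[ℝ] V) : skewEnd (B, 0, J) = J := by
  simp [skewEnd]

theorem LinCompatible.sub_skewEnd_mul_self {B : V →L[ℝ] V →L[ℝ] ℝ} {J : V →L[ℝ] V}
    (h : LinCompatible B J) : -1 - skewEnd (B, 0, J) * skewEnd (B, 0, J) = 0 := by
  rw [skewEnd_zero]
  ext u
  simp [h.sq]

theorem LinCompatible.polarEnd_zero {B : V →L[ℝ] V →L[ℝ] ℝ} {J : V →L[ℝ] V}
    (h : LinCompatible B J) : polarEnd (B, 0, J) = J := by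
  rw [polarEnd, h.sub_skewEnd_mul_self, invSqrt_zero, skewEnd_zero, mul_one]

/-- The minimum of `B u (J u)` on the compact unit sphere is positive; the zero space, whose sphere
is empty, is separate. -/
theorem LinCompatible.exists_le {B : V →L[ℝ] V →L[ℝ] ℝ} {J : V →L[ℝ] V} (h : LinCompatible B J) :
    ∃ c > 0, ∀ u, c * ‖u‖ ^ 2 ≤ B u (J u) := by
  have hc : Continuous fun u => B u (J u) := by fun_prop
  rcases (sphere (0 : V) 1).eq_empty_or_nonempty with he | hne
  · refine ⟨1, one_pos, fun u => ?_⟩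
    have hu : u = 0 := by
      by_contra hu
      have : ‖u‖⁻¹ • u ∈ sphere (0 : V) 1 := by
        rw [mem_sphere_zero_iff_norm, norm_smul, norm_inv, norm_norm,
          inv_mul_cancel₀ (norm_ne_zero_iff.2 hu)]
      rw [he] at this
      exact this
    simp [hu]
  · obtain ⟨w, hw, hmin⟩ := (isCompact_sphere (0 : V) 1).exists_isMinOn hne hc.continuousOn
    have hw0 : w ≠ 0 := by
      rintro rfl
      simp at hw
    refine ⟨B w (J w), h.pos w hw0, fun u => ?_⟩
    by_cases hu : u = 0
    · simp [hu]
    · have hmem : ‖u‖⁻¹ • u ∈ sphere (0 : V) 1 := by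
        rw [mem_sphere_zero_iff_norm, norm_smul, norm_inv, norm_norm,
          inv_mul_cancel₀ (norm_ne_zero_iff.2 hu)]
      have h1 : B w (J w) ≤ B (‖u‖⁻¹ • u) (J (‖u‖⁻¹ • u)) := hmin hmem
      simp only [map_smul, smul_apply, smul_eq_mul] at h1
      have h2 : 0 < ‖u‖ := norm_pos_iff.2 hu
      calc _ ≤ (‖u‖⁻¹ * (‖u‖⁻¹ * B u (J u))) * ‖u‖ ^ 2 :=
            mul_le_mul_of_nonneg_right h1 (by positivity)
        _ = B u (J u) := by field_simp

/-- The perturbation `S` of `B` is so small that the polar decomposition converges and `S` is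
dominated by the new metric. -/
def SmallTriple (t : (V →L[ℝ] V →L[ℝ] ℝ) × (V →L[ℝ] V →L[ℝ] ℝ) × (V →L[ℝ] V)) : Prop :=
  ‖-1 - skewEnd t * skewEnd t‖ < 1 ∧ ∃ c > 0, (∀ u, c * ‖u‖ ^ 2 ≤ (t.1 + t.2.1) u (polarEnd t u)) ∧
    ‖t.2.1‖ ≤ c / 4

/-- At `S = 0` the polar part is `J` and the argument of the root is `0`. The conditions are open
there, and half of the coercivity constant of `(B, J)` survives nearby. -/
theorem LinCompatible.eventually_smallTriple {B : V →L[ℝ] V →L[ℝ] ℝ} {J : V →L[ℝ] V}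
    (h : LinCompatible B J) : ∀ᶠ t in 𝓝 (B, 0, J), SmallTriple t := by
  obtain ⟨c, hc, hle⟩ := h.exists_le
  have h1 : ContinuousAt skewEnd (B, 0, J) := (contDiffAt_skewEnd h).continuousAt
  have h2 : ContinuousAt polarEnd (B, 0, J) :=
    (contDiffAt_polarEnd h (by rw [h.sub_skewEnd_mul_self]; simp)).continuousAt
  have h3 : ∀ᶠ t in 𝓝 (B, 0, J), ‖-1 - skewEnd t * skewEnd t‖ < 1 := by
    refine ((continuousAt_const.sub (h1.mul h1)).norm).eventually_lt continuousAt_const ?_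
    change ‖-1 - skewEnd (B, 0, J) * skewEnd (B, 0, J)‖ < 1
    rw [h.sub_skewEnd_mul_self]; simp
  have h4 : ∀ᶠ t : (V →L[ℝ] V →L[ℝ] ℝ) × (V →L[ℝ] V →L[ℝ] ℝ) × (V →L[ℝ] V) in 𝓝 (B, 0, J),
      ‖t.2.1‖ < c / 2 / 4 := by
    refine ContinuousAt.eventually_lt (by fun_prop) continuousAt_const ?_
    simpa using hc
  have h5 : ∀ᶠ t in 𝓝 (B, 0, J),
      ‖formMetric (t.1 + t.2.1) (polarEnd t) - formMetric B J‖ < c / 2 := by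
    refine ContinuousAt.eventually_lt ?_ continuousAt_const ?_
    · unfold formMetric
      have h6 : ContinuousAt (fun t : (V →L[ℝ] V →L[ℝ] ℝ) × (V →L[ℝ] V →L[ℝ] ℝ) × (V →L[ℝ] V) =>
        (ContinuousLinearMap.compL ℝ V V ℝ).flip (polarEnd t)) (B, 0, J) :=
        ContinuousAt.comp (ContinuousLinearMap.continuous _).continuousAt h2
      exact ((h6.clm_comp (by fun_prop)).sub continuousAt_const).norm
    · simpa [h.polarEnd_zero] using hc
  filter_upwards [h3, h4, h5] with t h3 h4 h5
  refine ⟨h3, c / 2, by positivity, fun u => ?_, h4.le⟩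
  have h6 : |(formMetric (t.1 + t.2.1) (polarEnd t) - formMetric B J) u u| ≤ c / 2 * ‖u‖ * ‖u‖ :=
    ((formMetric (t.1 + t.2.1) (polarEnd t) - formMetric B J).le_opNorm₂ u u).trans (by gcongr)
  have h7 := (abs_le.1 h6).1
  have h8 := hle u
  simp only [sub_apply, formMetric_apply] at h7
  nlinarith

/-- A smallness condition invariant under linear isomorphisms. -/
def GoodTriple (t : (V →L[ℝ] V →L[ℝ] ℝ) × (V →L[ℝ] V →L[ℝ] ℝ) × (V →L[ℝ] V)) : Prop :=
  ∃ e : V ≃L[ℝ] V, SmallTriple (pushTriple e t)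

theorem pushTriple_trans (e e' : V ≃L[ℝ] V)
    (t : (V →L[ℝ] V →L[ℝ] ℝ) × (V →L[ℝ] V →L[ℝ] ℝ) × (V →L[ℝ] V)) :
    pushTriple e' (pushTriple e t) = pushTriple (e.trans e') t := by
  simp only [pushTriple, Prod.mk.injEq]
  refine ⟨?_, ?_, ?_⟩ <;> ext <;> simp

theorem GoodTriple.of_push (e : V ≃L[ℝ] V)
    {t : (V →L[ℝ] V →L[ℝ] ℝ) × (V →L[ℝ] V →L[ℝ] ℝ) × (V →L[ℝ] V)}
    (h : GoodTriple (pushTriple e t)) : GoodTriple t := by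
  obtain ⟨e', h⟩ := h
  exact ⟨e.trans e', by rwa [← pushTriple_trans]⟩

theorem pushTriple_refl (t : (V →L[ℝ] V →L[ℝ] ℝ) × (V →L[ℝ] V →L[ℝ] ℝ) × (V →L[ℝ] V)) :
    pushTriple (.refl ℝ V) t = t := by
  simp only [pushTriple]
  refine Prod.ext ?_ (Prod.ext ?_ ?_) <;> ext <;> simp

theorem GoodTriple.push (e : V ≃L[ℝ] V)
    {t : (V →L[ℝ] V →L[ℝ] ℝ) × (V →L[ℝ] V →L[ℝ] ℝ) × (V →L[ℝ] V)}
    (h : GoodTriple t) : GoodTriple (pushTriple e t) := by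
  refine .of_push e.symm ?_
  rwa [pushTriple_trans, ContinuousLinearEquiv.self_trans_symm, pushTriple_refl]

theorem GoodTriple.contDiffAt {t : (V →L[ℝ] V →L[ℝ] ℝ) × (V →L[ℝ] V →L[ℝ] ℝ) × (V →L[ℝ] V)}
    (h : GoodTriple t) (ht : LinCompatible t.1 t.2.2) : ContDiffAt ℝ ∞ polarEnd t := by
  obtain ⟨e, h⟩ := h
  have h1 : ContDiffAt ℝ ∞ (fun t => polarEnd (pushTriple e t)) t :=
    ContDiffAt.comp t (contDiffAt_polarEnd (ht.push e) h.1) (contDiff_pushTriple e).contDiffAt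
  have h2 : polarEnd = fun t => (e.arrowCongr e).symm (polarEnd (pushTriple e t)) := by
    funext t
    rw [polarEnd_pushTriple, ContinuousLinearEquiv.symm_apply_apply]
  rw [h2]
  exact (ContinuousLinearEquiv.contDiff _).contDiffAt.comp t h1

/-- In the good coordinates `‖S‖ ≤ c/4`, while the new metric is at least `c‖·‖²`. The resulting
bound of `S` by the new metric no longer mentions coordinates. -/
theorem GoodTriple.linCompatible {B S : V →L[ℝ] V →L[ℝ] ℝ} {J : V →L[ℝ] V}
    (h : GoodTriple (B, S, J)) (hS : ∀ u v, S u v = -S v u) (hJ : LinCompatible B J) :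
    LinCompatible (B + S) (polarEnd (B, S, J)) ∧
    ∀ u v, |S u v| ≤ 1 / 4 * (√((B + S) u (polarEnd (B, S, J) u)) *
      √((B + S) v (polarEnd (B, S, J) v))) := by
  obtain ⟨e, hn, c, hc, hle, hSc⟩ := h
  have hpush : ∀ u, ((pushTriple e (B, S, J)).1 + (pushTriple e (B, S, J)).2.1) (e u)
      (polarEnd (pushTriple e (B, S, J)) (e u)) = (B + S) u (polarEnd (B, S, J) u) := fun u => by
    rw [polarEnd_pushTriple]
    simp [pushTriple]
  constructor
  · have h1 := linCompatible_polarEnd (S := (pushTriple e (B, S, J)).2.1)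
      (fun u v => by simpa [pushTriple] using hS (e.symm u) (e.symm v)) (hJ.push e) hn fun u hu =>
      lt_of_lt_of_le (by have := norm_pos_iff.2 hu; positivity) (hle u)
    have h2 := h1.push e.symm
    have h3 : polarEnd (pushTriple e (B, S, J)) = e.arrowCongr e (polarEnd (B, S, J)) :=
      polarEnd_pushTriple e _
    change LinCompatible _ (e.symm.arrowCongr e.symm (polarEnd (pushTriple e (B, S, J)))) at h2
    rw [h3] at h2
    convert h2 using 1
    · ext u v; simp [pushTriple]
    · ext u; simp
  · intro u v
    rw [← hpush u, ← hpush v]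
    have hb : ∀ u, √c * ‖e u‖ ≤ √(((pushTriple e (B, S, J)).1 + (pushTriple e (B, S, J)).2.1) (e u)
      (polarEnd (pushTriple e (B, S, J)) (e u))) := fun u => by
      refine Real.le_sqrt_of_sq_le ?_
      rw [mul_pow, Real.sq_sqrt hc.le]
      exact hle _
    have h1 : |S u v| ≤ c / 4 * ‖e u‖ * ‖e v‖ := by
      have h2 : S u v = (pushTriple e (B, S, J)).2.1 (e u) (e v) := by simp [pushTriple]
      rw [h2]
      exact ((pushTriple e (B, S, J)).2.1.le_opNorm₂ _ _).trans (by gcongr)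
    calc |S u v| ≤ c / 4 * ‖e u‖ * ‖e v‖ := h1
      _ = 1 / 4 * ((√c * ‖e u‖) * (√c * ‖e v‖)) := by
        linear_combination (- 1 / 4 * ‖e u‖ * ‖e v‖) * Real.mul_self_sqrt hc.le
      _ ≤ _ := by gcongr <;> exact hb _

end Smallness

end LinearAlgebra

/-! ### The polar construction on a compact manifold -/

section CompatibleFields

open Filter Set

/-- A `2`-form on a vector space as a bilinear form. -/
def bilin (V : Type*) [NormedAddCommGroup V] [NormedSpace ℝ V] :
    (V [⋀^Fin 2]→L[ℝ] ℝ) →L[ℝ] V →L[ℝ] V →L[ℝ] ℝ :=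
  ((ContinuousLinearMap.compL ℝ V (V [×1]→L[ℝ] ℝ) (V →L[ℝ] ℝ))
      (continuousMultilinearCurryFin1 ℝ V ℝ).toContinuousLinearEquiv.toContinuousLinearMap).comp
    (((continuousMultilinearCurryLeftEquiv ℝ (fun _ : Fin 2 => V)
        ℝ).toContinuousLinearEquiv.toContinuousLinearMap).comp
      (ContinuousAlternatingMap.toContinuousMultilinearMapCLM ℝ))

theorem bilin_apply {V : Type*} [NormedAddCommGroup V] [NormedSpace ℝ V] (α : V [⋀^Fin 2]→L[ℝ] ℝ)
    (u v : V) : bilin V α u v = α ![u, v] := by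
  change α (Fin.cons u (Fin.snoc 0 v)) = α ![u, v]
  congr 1
  ext i
  fin_cases i <;> rfl

theorem bilin_alt {V : Type*} [NormedAddCommGroup V] [NormedSpace ℝ V] (α : V [⋀^Fin 2]→L[ℝ] ℝ)
    (u v : V) : bilin V α u v = -bilin V α v u := by
  rw [bilin_apply, bilin_apply, ← ContinuousAlternatingMap.coe_toAlternatingMap,
    ← α.toAlternatingMap.map_swap ![v, u] (i := 0) (j := 1) (by decide)]
  congr 1
  ext1 i
  fin_cases i <;> rfl

variable {d : ℕ} {M : Type*} [TopologicalSpace M] [ChartedSpace (EuclideanSpace ℝ (Fin d)) M]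
  [IsManifold (𝓡 d) ∞ M]

/-- `tcoordEquiv`, with `TangentSpace (𝓡 d) x` unfolded. -/
def modelEquiv (p x : M) (hx : x ∈ (extChartAt (𝓡 d) p).source) :
    EuclideanSpace ℝ (Fin d) ≃L[ℝ] EuclideanSpace ℝ (Fin d) := tcoordEquiv p x hx

/-- The value of a `2`-form at `x` as a bilinear form, with `TangentSpace (𝓡 d) x` unfolded. -/
def bilinAt (α : DForm d 2 M) (x : M) :
    EuclideanSpace ℝ (Fin d) →L[ℝ] EuclideanSpace ℝ (Fin d) →L[ℝ] ℝ :=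
  bilin (EuclideanSpace ℝ (Fin d)) (α x)

theorem bilinAt_apply (α : DForm d 2 M) (x : M) (u v : EuclideanSpace ℝ (Fin d)) :
    bilinAt α x u v = α x (![u, v] : Fin 2 → TangentSpace (𝓡 d) x) := bilin_apply _ _ _

theorem bilinAt_alt (α : DForm d 2 M) (x : M) (u v : EuclideanSpace ℝ (Fin d)) :
    bilinAt α x u v = -bilinAt α x v u := bilin_alt _ u v

/-- The values at `x` of two forms and an endomorphism field, with `TangentSpace (𝓡 d) x`
unfolded. -/
def tripleAt (α τ : DForm d 2 M) (J : EndField d M) (x : M) :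
    (EuclideanSpace ℝ (Fin d) →L[ℝ] EuclideanSpace ℝ (Fin d) →L[ℝ] ℝ) ×
    (EuclideanSpace ℝ (Fin d) →L[ℝ] EuclideanSpace ℝ (Fin d) →L[ℝ] ℝ) ×
    (EuclideanSpace ℝ (Fin d) →L[ℝ] EuclideanSpace ℝ (Fin d)) :=
  (bilinAt α x, bilinAt τ x, J x)

/-- The expression of an endomorphism field in the trivialization at `p`. -/
def endInCoord (J : EndField d M) (p x : M) :
    EuclideanSpace ℝ (Fin d) →L[ℝ] EuclideanSpace ℝ (Fin d) :=
  ContinuousLinearMap.inCoordinates (EuclideanSpace ℝ (Fin d)) (fun x : M => TangentSpace (𝓡 d) x)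
    (EuclideanSpace ℝ (Fin d)) (fun x : M => TangentSpace (𝓡 d) x) p x p x (J x)

theorem contMDiff_endField_iff {J : EndField d M} : ContMDiff (𝓡 d)
    ((𝓡 d).prod 𝓘(ℝ, EuclideanSpace ℝ (Fin d) →L[ℝ] EuclideanSpace ℝ (Fin d))) ∞
    (fun x => TotalSpace.mk' (EuclideanSpace ℝ (Fin d) →L[ℝ] EuclideanSpace ℝ (Fin d))
      (E := fun x : M => TangentSpace (𝓡 d) x →L[ℝ] TangentSpace (𝓡 d) x) x (J x)) ↔
    ∀ p, ContMDiffAt (𝓡 d) 𝓘(ℝ, EuclideanSpace ℝ (Fin d) →L[ℝ] EuclideanSpace ℝ (Fin d)) ∞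
      (endInCoord J p) p := by
  refine forall_congr' fun p => ?_
  rw [contMDiffAt_hom_bundle]
  exact ⟨fun h => h.2, fun h => ⟨contMDiffAt_id, h⟩⟩

theorem endInCoord_eq (J : EndField d M) {p x : M} (hx : x ∈ (extChartAt (𝓡 d) p).source) :
    endInCoord J p x = (modelEquiv p x hx).arrowCongr (modelEquiv p x hx)
      (J x : EuclideanSpace ℝ (Fin d) →L[ℝ] EuclideanSpace ℝ (Fin d)) := by
  have hx' : x ∈ (chartAt (EuclideanSpace ℝ (Fin d)) p).source := by simpa using hx
  have hb : x ∈ (trivializationAt (EuclideanSpace ℝ (Fin d))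
    (TangentSpace (𝓡 d) : M → Type _) p).baseSet := by simpa using hx
  have he : ∀ v : EuclideanSpace ℝ (Fin d), (trivializationAt (EuclideanSpace ℝ (Fin d))
      (TangentSpace (𝓡 d) : M → Type _) p).continuousLinearEquivAt ℝ x hb v =
      modelEquiv p x hx v := fun v => by
    have h1 := congrArg (fun T => T v) (TangentBundle.continuousLinearMapAt_trivializationAt
      (I := 𝓡 d) hx')
    refine Eq.trans ?_ (h1.trans (tcoordEquiv_apply hx v).symm)
    exact congrFun (Trivialization.coe_continuousLinearEquivAt_eq _ hb) v
  have he' : ∀ v : EuclideanSpace ℝ (Fin d), ((trivializationAt (EuclideanSpace ℝ (Fin d))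
      (TangentSpace (𝓡 d) : M → Type _) p).continuousLinearEquivAt ℝ x hb).symm v =
      (modelEquiv p x hx).symm v := fun v => by
    refine (ContinuousLinearEquiv.symm_apply_eq _).2 ?_
    exact ((he _).trans ((modelEquiv p x hx).apply_symm_apply v)).symm
  rw [endInCoord, ContinuousLinearMap.inCoordinates_eq hb hb]
  ext1 v
  refine (he _).trans ?_
  exact congrArg (fun w => modelEquiv p x hx (J x w)) (he' v)

theorem bilin_inChart (α : DForm d 2 M) {p x : M} (hx : x ∈ (extChartAt (𝓡 d) p).source) :
    bilin (EuclideanSpace ℝ (Fin d)) (α.inChart p (extChartAt (𝓡 d) p x)) =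
    (modelEquiv p x hx).arrowCongr ((modelEquiv p x hx).arrowCongr (.refl ℝ ℝ))
      (bilinAt α x) := by
  ext1 u
  ext1 v
  have h : bilinAt α x ((modelEquiv p x hx).symm u)
      ((modelEquiv p x hx).symm v) =
      α x ![(tcoordEquiv p x hx).symm u, (tcoordEquiv p x hx).symm v] :=
    bilinAt_apply _ _ _ _
  refine Eq.trans ?_ h.symm
  rw [bilin_apply, form_eq_inChart α hx]
  congr 1
  ext1 i
  fin_cases i
  · exact (((tcoordEquiv_apply hx _).symm).trans
      ((tcoordEquiv p x hx).apply_symm_apply u)).symm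
  · exact (((tcoordEquiv_apply hx _).symm).trans
      ((tcoordEquiv p x hx).apply_symm_apply v)).symm

/-- The expression of `tripleAt` in the chart at `p`. -/
def chartTriple (α τ : DForm d 2 M) (J : EndField d M) (p x : M) :
    (EuclideanSpace ℝ (Fin d) →L[ℝ] EuclideanSpace ℝ (Fin d) →L[ℝ] ℝ) ×
    (EuclideanSpace ℝ (Fin d) →L[ℝ] EuclideanSpace ℝ (Fin d) →L[ℝ] ℝ) ×
    (EuclideanSpace ℝ (Fin d) →L[ℝ] EuclideanSpace ℝ (Fin d)) :=
  (bilin (EuclideanSpace ℝ (Fin d)) (α.inChart p (extChartAt (𝓡 d) p x)),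
    bilin (EuclideanSpace ℝ (Fin d)) (τ.inChart p (extChartAt (𝓡 d) p x)), endInCoord J p x)

theorem chartTriple_eq (α τ : DForm d 2 M) (J : EndField d M) {p x : M}
    (hx : x ∈ (extChartAt (𝓡 d) p).source) :
    chartTriple α τ J p x = pushTriple (modelEquiv p x hx) (tripleAt α τ J x) := by
  rw [chartTriple, bilin_inChart α hx, bilin_inChart τ hx, endInCoord_eq J hx]
  rfl

theorem contMDiffAt_bilin_inChart {α : DForm d 2 M} (hα : α.SmoothOn univ) (p : M) :
    ContMDiffAt (𝓡 d) 𝓘(ℝ, EuclideanSpace ℝ (Fin d) →L[ℝ] EuclideanSpace ℝ (Fin d) →L[ℝ] ℝ) ∞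
      (fun x => bilin (EuclideanSpace ℝ (Fin d)) (α.inChart p (extChartAt (𝓡 d) p x))) p := by
  have h1 : ContDiffAt ℝ ∞ (fun y => bilin (EuclideanSpace ℝ (Fin d)) (α.inChart p y))
      (extChartAt (𝓡 d) p p) :=
    (ContinuousLinearMap.contDiff _).contDiffAt.comp _ (hα.contDiffAt isOpen_univ
      (mem_chartImage (mem_extChartAt_source p) (mem_univ p)))
  exact h1.contMDiffAt.comp p contMDiffAt_extChartAt

/-- The compatible almost complex structure obtained from `J` after adding `τ` to `α`. -/
def polarField (α τ : DForm d 2 M) (J : EndField d M) : EndField d M :=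
  fun x => (polarEnd (tripleAt α τ J x) : EuclideanSpace ℝ (Fin d) →L[ℝ] EuclideanSpace ℝ (Fin d))

theorem endInCoord_polarField (α τ : DForm d 2 M) (J : EndField d M) {p x : M}
    (hx : x ∈ (extChartAt (𝓡 d) p).source) :
    endInCoord (polarField α τ J) p x = polarEnd (chartTriple α τ J p x) := by
  rw [chartTriple_eq α τ J hx, polarEnd_pushTriple, endInCoord_eq _ hx]
  rfl

theorem IsCompatible.linCompatible {α : DForm d 2 M} {J : EndField d M} (h : IsCompatible α J)
    (x : M) : LinCompatible (bilinAt α x)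
      (J x : EuclideanSpace ℝ (Fin d) →L[ℝ] EuclideanSpace ℝ (Fin d)) where
  alt := bilinAt_alt α x
  sq u := h.sq x u
  invariant u v := by
    rw [bilinAt_apply, bilinAt_apply]; exact h.invariant x u v
  pos u hu := by
    rw [bilinAt_apply]; exact h.pos x u hu

/-- In the trivialization at `p` the field is `polarEnd` of the chart triple, and `polarEnd` is
smooth at good triples whose form and endomorphism are compatible. -/
theorem contMDiff_polarField {α τ : DForm d 2 M} {J : EndField d M} (hα : α.SmoothOn univ)
    (hτ : τ.SmoothOn univ) (hJ : IsCompatible α J) (h : ∀ x, GoodTriple (tripleAt α τ J x)) :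
    ContMDiff (𝓡 d)
    ((𝓡 d).prod 𝓘(ℝ, EuclideanSpace ℝ (Fin d) →L[ℝ] EuclideanSpace ℝ (Fin d))) ∞
    (fun x => TotalSpace.mk' (EuclideanSpace ℝ (Fin d) →L[ℝ] EuclideanSpace ℝ (Fin d))
      (E := fun x : M => TangentSpace (𝓡 d) x →L[ℝ] TangentSpace (𝓡 d) x) x
        (polarField α τ J x)) := by
  refine contMDiff_endField_iff.2 fun p => ?_
  have hp := mem_extChartAt_source (I := 𝓡 d) p
  have h1 : ContMDiffAt (𝓡 d) 𝓘(ℝ, _) ∞ (chartTriple α τ J p) p :=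
    (contMDiffAt_bilin_inChart hα p).prodMk_space ((contMDiffAt_bilin_inChart hτ p).prodMk_space
      (contMDiff_endField_iff.1 hJ.smooth p))
  have h2 : ContDiffAt ℝ ∞ polarEnd (chartTriple α τ J p p) := by
    rw [chartTriple_eq α τ J hp]
    exact ((h p).push _).contDiffAt ((hJ.linCompatible p).push _)
  refine (h2.contMDiffAt.comp p h1).congr_of_eventuallyEq ?_
  filter_upwards [extChartAt_source_mem_nhds (I := 𝓡 d) p] with x hx
  exact endInCoord_polarField α τ J hx

theorem inChart_sum {ι : Type*} {k : ℕ} (s : Finset ι) (α : ι → DForm d k M) (p : M)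
    (y : EuclideanSpace ℝ (Fin d)) : (∑ i ∈ s, α i).inChart p y = ∑ i ∈ s, (α i).inChart p y := by
  classical
  induction s using Finset.induction_on with
  | empty => rfl
  | insert i s hi ih =>
    rw [Finset.sum_insert hi, Finset.sum_insert hi, ← ih]
    rfl

theorem continuousAt_bilin_inChart_cechForm {m : ℕ} {ρ : Fin m → M → ℝ}
    (hρ : ∀ i, ContMDiff (𝓡 d) 𝓘(ℝ, ℝ) ∞ (ρ i)) (e₀ : Fin m → Fin m → Fin m → ℝ) (p : M) :
    ContinuousAt (fun z : (Fin m → Fin m → Fin m → ℝ) × M => bilin (EuclideanSpace ℝ (Fin d))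
      ((cechForm d ρ z.1).inChart p (extChartAt (𝓡 d) p z.2))) (e₀, p) := by
  have h : ∀ z : (Fin m → Fin m → Fin m → ℝ) × M, bilin (EuclideanSpace ℝ (Fin d))
      ((cechForm d ρ z.1).inChart p (extChartAt (𝓡 d) p z.2)) =
      ∑ i, ∑ l, ∑ k, z.1 l i k • bilin (EuclideanSpace ℝ (Fin d))
        ((show DForm d 2 M from fun x => ρ i x • wedgeDiff (ρ l) (ρ k) x).inChart p
          (extChartAt (𝓡 d) p z.2)) := fun z => by
    rw [cechForm_eq_sum]
    simp only [inChart_sum, map_sum, ← map_smul]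
    rfl
  rw [funext h]
  refine tendsto_finsetSum _ fun i _ => tendsto_finsetSum _ fun l _ =>
    tendsto_finsetSum _ fun k _ => Tendsto.smul ?_ ?_
  · exact Continuous.tendsto (by fun_prop) _
  · have h1 := (contMDiffAt_bilin_inChart
      (smoothOn_smul_wedgeDiff (hρ i) (hρ l) (hρ k) univ) p).continuousAt
    exact ContinuousAt.comp (f := Prod.snd) (x := (e₀, p)) h1 continuousAt_snd

/-- The chart triple is continuous in `(e, x)` jointly and has `S = 0` at `e = 0`, so it is small
near `(0, p)` for every `p`. Compactness of `M` makes the neighbourhood of `0` uniform. -/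
theorem eventually_goodTriple [CompactSpace M] {α : DForm d 2 M} {J : EndField d M}
    (hα : α.SmoothOn univ) (hJ : IsCompatible α J) {m : ℕ} {ρ : Fin m → M → ℝ}
    (hρ : ∀ i, ContMDiff (𝓡 d) 𝓘(ℝ, ℝ) ∞ (ρ i)) :
    ∀ᶠ e in 𝓝 (0 : Fin m → Fin m → Fin m → ℝ), ∀ x : M,
      GoodTriple (tripleAt α (cechForm d ρ e) J x) := by
  have h := (isCompact_univ (X := M)).eventually_forall_of_forall_eventually
    (x₀ := (0 : Fin m → Fin m → Fin m → ℝ))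
    (P := fun e x => GoodTriple (tripleAt α (cechForm d ρ e) J x)) fun p _ => ?_
  · simpa using h
  have hp := mem_extChartAt_source (I := 𝓡 d) p
  have h0 : cechForm d ρ (0 : Fin m → Fin m → Fin m → ℝ) = 0 := by
    rw [cechForm_eq_sum]; simp
  have h1 : chartTriple α (cechForm d ρ 0) J p p =
      (bilin (EuclideanSpace ℝ (Fin d)) (α.inChart p (extChartAt (𝓡 d) p p)), 0,
        endInCoord J p p) := by
    rw [h0, chartTriple]
    congr 2
  have hc : LinCompatible (bilin (EuclideanSpace ℝ (Fin d)) (α.inChart p (extChartAt (𝓡 d) p p)))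
      (endInCoord J p p) := by
    rw [bilin_inChart α hp, endInCoord_eq J hp]
    exact (hJ.linCompatible p).push _
  have h2 : ContinuousAt (fun z : (Fin m → Fin m → Fin m → ℝ) × M =>
      chartTriple α (cechForm d ρ z.1) J p z.2) (0, p) :=
    ContinuousAt.prodMk
      (ContinuousAt.comp (f := Prod.snd) (x := ((0 : Fin m → Fin m → Fin m → ℝ), p))
        (contMDiffAt_bilin_inChart hα p).continuousAt continuousAt_snd)
      ((continuousAt_bilin_inChart_cechForm hρ 0 p).prodMk
        (ContinuousAt.comp (f := Prod.snd) (x := ((0 : Fin m → Fin m → Fin m → ℝ), p))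
          (contMDiff_endField_iff.1 hJ.smooth p).continuousAt continuousAt_snd))
  have h3 := h2.eventually (p := SmallTriple) (by
    change ∀ᶠ t in 𝓝 (chartTriple α (cechForm d ρ 0) J p p), SmallTriple t
    rw [h1]
    exact hc.eventually_smallTriple)
  have h4 : ∀ᶠ z : (Fin m → Fin m → Fin m → ℝ) × M in 𝓝 (0, p),
      z.2 ∈ (extChartAt (𝓡 d) p).source :=
    continuousAt_snd.eventually (extChartAt_source_mem_nhds p)
  filter_upwards [h3, h4] with z hz hz2
  rw [chartTriple_eq _ _ _ hz2] at hz
  exact ⟨_, hz⟩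

/-- On a compact symplectic manifold, there are an integral symplectic form and a compatible
almost complex structure such that the given form is a small perturbation of a multiple of the
integral one. -/
theorem exists_integral_symplectic [T2Space M] [CompactSpace M] {α : DForm d 2 M} {J : EndField d M}
    (hα : IsSymplectic α) (hJ : IsCompatible α J) :
    ∃ (β : DForm d 2 M) (c : ℝ) (J' : EndField d M), 0 < c ∧ IsSymplectic (c • β) ∧
      IsIntegral (c • β) ∧ IsCompatible (c • β) J' ∧ IsCompatible β J' ∧
      ∀ (x : M) (u v : TangentSpace (𝓡 d) x), |β x ![u, v] - α x ![u, v]| ≤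
        1 / 4 * (√(β x ![u, J' x u]) * √(β x ![v, J' x v])) := by
  obtain ⟨m, ρ, hρ, h⟩ := exists_integral_perturbation hα.smooth hα.closed
  obtain ⟨ε, hε, hball⟩ := Metric.eventually_nhds_iff.1 (eventually_goodTriple hα.smooth hJ hρ)
  obtain ⟨e, he, hs, hcl, N, hN, hint⟩ := h ε hε
  have hgood : ∀ x, GoodTriple (tripleAt α (cechForm d ρ e) J x) := by
    refine hball ?_
    simp only [dist_zero_right, pi_norm_lt_iff hε, Real.norm_eq_abs]
    exact he
  have hN' : (0 : ℝ) < N := by exact_mod_cast hN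
  have hlin := fun x => (hgood x).linCompatible (bilinAt_alt (cechForm d ρ e) x)
    (hJ.linCompatible x)
  have hadd : ∀ x, bilinAt (α + cechForm d ρ e) x = bilinAt α x + bilinAt (cechForm d ρ e) x :=
    fun x => rfl
  have hcomp : IsCompatible (α + cechForm d ρ e) (polarField α (cechForm d ρ e) J) := by
    refine ⟨contMDiff_polarField hα.smooth (smoothOn_cechForm hρ univ) hJ hgood,
      fun x u => (hlin x).1.sq u, fun x u v => ?_, fun x u hu => ?_⟩
    · exact (bilinAt_apply (α + cechForm d ρ e) x _ _).symm.trans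
        (((hlin x).1.invariant u v).trans (bilinAt_apply (α + cechForm d ρ e) x u v))
    · exact lt_of_lt_of_eq ((hlin x).1.pos u hu) (bilinAt_apply (α + cechForm d ρ e) x _ _)
  -- Compatibility survives a positive factor, so one structure serves both the integral form and
  -- the unscaled one, which is the form close to `α`.
  have hcomp' : IsCompatible ((N : ℝ) • (α + cechForm d ρ e))
      (polarField α (cechForm d ρ e) J) :=
    ⟨hcomp.smooth, hcomp.sq, fun x u v => congrArg ((N : ℝ) * ·) (hcomp.invariant x u v),
      fun x u hu => mul_pos hN' (hcomp.pos x u hu)⟩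
  refine ⟨α + cechForm d ρ e, N, polarField α (cechForm d ρ e) J, hN', ⟨hs.const_smul _, ?_, ?_⟩,
    hint, hcomp', hcomp, fun x u v => ?_⟩
  · have h0 : (0 : DForm d 3 M) = (N : ℝ) • (0 : DForm d 3 M) := (smul_zero _).symm
    rw [h0]
    exact hcl.const_smul _
  · intro x u hu
    by_contra hne
    exact (hcomp'.pos x u hne).ne' (hu _)
  · have h2 : (α + cechForm d ρ e) x ![u, v] - α x ![u, v] = cechForm d ρ e x ![u, v] :=
      add_sub_cancel_left _ _
    rw [h2]
    calc |cechForm d ρ e x ![u, v]| = |bilinAt (cechForm d ρ e) x u v| :=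
          congrArg abs (bilinAt_apply (cechForm d ρ e) x u v).symm
      _ ≤ _ := (hlin x).2 u v
      _ = _ := congrArg (1 / 4 * ·) (congrArg₂ (fun a b => √a * √b)
        (bilinAt_apply (α + cechForm d ρ e) x u _) (bilinAt_apply (α + cechForm d ρ e) x v _))

end CompatibleFields

/-! ### The kernel of `∇s` at a zero is symplectic -/

section Kernel

/-- Cauchy–Schwarz for the metric `B(u, J v)`, using `B(u, v) = -g(u, J v)` and that `J` is an
isometry. -/
theorem LinCompatible.abs_le {V : Type*} [NormedAddCommGroup V] [NormedSpace ℝ V]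
    {B : V →L[ℝ] V →L[ℝ] ℝ} {J : V →L[ℝ] V} (h : LinCompatible B J) (u v : V) :
    |B u v| ≤ √(B u (J u)) * √(B v (J v)) := by
  have hpos : ∀ u, 0 ≤ B u (J u) := fun u => by
    by_cases hu : u = 0
    · simp [hu]
    · exact (h.pos u hu).le
  let g : LinearMap.BilinForm ℝ V :=
    LinearMap.mk₂ ℝ (fun u v => B u (J v)) (by simp) (by simp) (by simp) (by simp)
  have hcs := LinearMap.BilinForm.apply_mul_apply_le_of_forall_zero_le g hpos u (J v)
  have h1 : g u (J v) = -B u v := by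
    change B u (J (J v)) = _
    rw [h.sq, map_neg]
  have h2 : g (J v) u = -B u v := by
    change B (J v) (J u) = _
    rw [h.invariant, h.alt]
  have h3 : g (J v) (J v) = B v (J v) := h.invariant v (J v)
  rw [h1, h2, h3] at hcs
  rw [← Real.sqrt_mul (hpos u)]
  refine Real.abs_le_sqrt ?_
  calc _ = -B u v * -B u v := by ring
    _ ≤ _ := hcs

/-- If `J u - w` is close to `J u`, both `B` and forms close to `B` are positive on
`(u, J u - w)`. -/
theorem LinCompatible.pos_sub {V : Type*} [NormedAddCommGroup V] [NormedSpace ℝ V]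
    {A B : V →L[ℝ] V →L[ℝ] ℝ} {J : V →L[ℝ] V} (h : LinCompatible B J)
    (hA : ∀ u v, |B u v - A u v| ≤ 1 / 4 * (√(B u (J u)) * √(B v (J v)))) {u w : V} (hu : u ≠ 0)
    (hw : √(B w (J w)) ≤ 1 / 4 * √(B u (J u))) :
    0 < A u (J u - w) ∧ 0 < B u (J u - w) := by
  have h0 : 0 < √(B u (J u)) := Real.sqrt_pos.2 (h.pos u hu)
  have h1 : √(B u (J u)) * √(B u (J u)) = B u (J u) := Real.mul_self_sqrt (h.pos u hu).le
  have h2 := h.abs_le u w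
  have h3 := hA u (J u)
  rw [h.invariant u (J u)] at h3
  have h4 := hA u w
  have h5 : √(B u (J u)) * √(B w (J w)) ≤ √(B u (J u)) * (1 / 4 * √(B u (J u))) :=
    mul_le_mul_of_nonneg_left hw h0.le
  have h6 : 0 < √(B u (J u)) * √(B u (J u)) := mul_pos h0 h0
  rw [_root_.abs_le] at h2 h3 h4
  simp only [map_sub]
  -- In units of `B(u, J u)`: the value of `B` is at least `1 - 1/4`, and that of `A` at least `3/4
  -- - (1/4 + 1/16) = 7/16`.
  constructor <;> nlinarith

variable {d : ℕ} {M : Type*} [TopologicalSpace M] [ChartedSpace (EuclideanSpace ℝ (Fin d)) M]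
  [IsManifold (𝓡 d) ∞ M]
  {F : Type*} [NormedAddCommGroup F] [NormedSpace ℝ F]
  {E : M → Type*} [TopologicalSpace (TotalSpace F E)]
  [∀ x, AddCommGroup (E x)] [∀ x, Module ℝ (E x)] [∀ x, TopologicalSpace (E x)]
  [∀ x, IsTopologicalAddGroup (E x)] [∀ x, ContinuousSMul ℝ (E x)]
  [FiberBundle F E] [VectorBundle ℝ F E]

theorem fnorm_smul (h : ContMDiffRiemannianMetric (𝓡 d) ∞ F E) {c : ℝ} (hc : 0 ≤ c) {x : M}
    (e : E x) : fnorm h (c • e) = c * fnorm h e := by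
  simp only [fnorm, map_smul, smul_apply, smul_eq_mul]
  rw [← mul_assoc, Real.sqrt_mul (mul_nonneg hc hc), Real.sqrt_mul_self hc]

theorem fnorm_zero (h : ContMDiffRiemannianMetric (𝓡 d) ∞ F E) {x : M} :
    fnorm h (0 : E x) = 0 := by
  simp [fnorm]

/-- The kernel of the derivative of an approximately holomorphic transverse section is
symplectic at a zero of the section. -/
theorem exists_pos_of_mem_ker {α β : DForm d 2 M} {J : EndField d M} (hJ : IsCompatible β J)
    (hαβ : ∀ (x : M) (u v : TangentSpace (𝓡 d) x), |β x ![u, v] - α x ![u, v]| ≤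
      1 / 4 * (√(β x ![u, J x u]) * √(β x ![v, J x v])))
    {r : ℝ} (hr : 0 < r) {C η δ : ℝ} (hη : 0 < η) (hδ : 8 * (C / √δ) ≤ η)
    {h : ContMDiffRiemannianMetric (𝓡 d) ∞ F E} {j : (x : M) → E x →L[ℝ] E x}
    {cov : CovariantDerivative (𝓡 d) F E} {s : (x : M) → E x}
    (hs : IsTransverse (scaledMetric r β J) h cov η s)
    (hdbar : OneFormBound (scaledMetric r β J) h (dbar J j cov s) (C / √δ))
    {z : M} (hz : s z = 0) {u : TangentSpace (𝓡 d) z} (hu : u ≠ 0) (hker : cov s z u = 0) :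
    ∃ v : TangentSpace (𝓡 d) z, cov s z v = 0 ∧ 0 < α z ![u, v] ∧ 0 < β z ![u, v] := by
  obtain ⟨R, hR, K, hK, hRK⟩ := hs z (by rw [hz, fnorm_zero]; exact hη.le)
  -- The correction that brings `J u - w` back into the kernel of `∇s`.
  set w := R (cov s z (J z u)) with hw
  have htn : ∀ v : TangentSpace (𝓡 d) z, tnorm (scaledMetric r β J) v = √r * √(β z ![v, J z v]) :=
    fun v => Real.sqrt_mul hr.le _
  have hlin := hJ.linCompatible z
  have hJu : tnorm (scaledMetric r β J) (J z u) = tnorm (scaledMetric r β J) u := by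
    rw [htn, htn, hJ.invariant]
  -- At `J u` the second term of `∂̄s` is `½ j ∇s(J J u) = -½ j ∇s(u)`, which vanishes on the
  -- kernel.
  have hL : cov s z (J z u) = (2 : ℝ) • dbar J j cov s z (J z u) := by
    simp only [dbar, smul_apply, add_apply, ContinuousLinearMap.comp_apply, hJ.sq, map_neg, hker,
      map_zero, neg_zero, add_zero, smul_smul]
    norm_num
  have h1 : fnorm h (cov s z (J z u)) ≤ η / 4 * tnorm (scaledMetric r β J) u := by
    rw [hL, fnorm_smul h (by norm_num)]
    have := hdbar z (J z u)
    rw [hJu] at this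
    have h0 : 0 ≤ tnorm (scaledMetric r β J) u := Real.sqrt_nonneg _
    nlinarith
  have h2 : tnorm (scaledMetric r β J) w ≤ 1 / 4 * tnorm (scaledMetric r β J) u := by
    calc _ ≤ K * fnorm h (cov s z (J z u)) := hRK _
      _ ≤ η⁻¹ * fnorm h (cov s z (J z u)) :=
        mul_le_mul_of_nonneg_right hK.le (Real.sqrt_nonneg _)
      _ ≤ η⁻¹ * (η / 4 * tnorm (scaledMetric r β J) u) :=
        mul_le_mul_of_nonneg_left h1 (by positivity)
      _ = _ := by field_simp
  have h3 : √(β z ![w, J z w]) ≤ 1 / 4 * √(β z ![u, J z u]) := by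
    rw [htn, htn] at h2
    have := Real.sqrt_pos.2 hr
    nlinarith
  refine ⟨J z u - w, by rw [map_sub, hR, sub_self], ?_⟩
  have h4 := hlin.pos_sub (A := bilinAt α z) (u := u) (w := w) (fun u v => ?_) hu ?_
  · exact ⟨h4.1.trans_eq (bilinAt_apply α z _ _), h4.2.trans_eq (bilinAt_apply β z _ _)⟩
  · exact (congrArg₂ (fun a b => |a - b|) (bilinAt_apply β z u v)
      (bilinAt_apply α z u v)).trans_le ((hαβ z u v).trans_eq (congrArg₂
        (fun a b => 1 / 4 * (√a * √b)) (bilinAt_apply β z u _) (bilinAt_apply β z v _)).symm)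
  · exact (congrArg Real.sqrt (bilinAt_apply β z w _)).trans_le (h3.trans_eq
      (congrArg (fun a => 1 / 4 * √a) (bilinAt_apply β z u _)).symm)

end Kernel

/-! ### Straightening the zero set of a submersion -/

section Straightening

open Set Filter

variable {V F : Type*} [NormedAddCommGroup V] [NormedSpace ℝ V] [FiniteDimensional ℝ V]
  [NormedAddCommGroup F] [NormedSpace ℝ F] [FiniteDimensional ℝ F]

/-- A map with invertible derivative restricts to a smooth diffeomorphism between open sets. -/
theorem exists_diffeo_of_hasFDerivAt {Φ : V → V} {y₀ : V}
    (h1 : ∀ᶠ y in 𝓝 y₀, ContDiffAt ℝ ∞ Φ y)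
    (hd : HasFDerivAt Φ (ContinuousLinearMap.id ℝ V) y₀) {U : Set V} (hU : U ∈ 𝓝 y₀) :
    ∃ ψ : OpenPartialHomeomorph V V, (ψ : V → V) = Φ ∧ y₀ ∈ ψ.source ∧ ψ.source ⊆ U ∧
      ContDiffOn ℝ ∞ ψ ψ.source ∧ ContDiffOn ℝ ∞ ψ.symm ψ.target := by
  have hΦ := h1.self_of_nhds
  have : CompleteSpace V := FiniteDimensional.complete ℝ V
  have hd' : HasFDerivAt Φ ((ContinuousLinearEquiv.refl ℝ V : V ≃L[ℝ] V) : V →L[ℝ] V) y₀ := hd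
  let ψ₀ := hΦ.toOpenPartialHomeomorph Φ hd' (by simp)
  -- Invertibility of the derivative is an open condition; it is kept on the whole domain so that
  -- the inverse is smooth on the whole target.
  have h2 : ∀ᶠ y in 𝓝 y₀, fderiv ℝ Φ y ∈ range ((↑) : (V ≃L[ℝ] V) → V →L[ℝ] V) := by
    have hc : ContinuousAt (fderiv ℝ Φ) y₀ := (hΦ.fderiv_right (m := 0) (by norm_num)).continuousAt
    refine hc ?_
    rw [hd'.fderiv]
    exact ContinuousLinearEquiv.nhds _
  obtain ⟨W, hW, hWo, hyW⟩ := eventually_nhds_iff.1 ((h1.and h2).and hU)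
  refine ⟨ψ₀.restrOpen W hWo, rfl, ⟨ContDiffAt.mem_toOpenPartialHomeomorph_source hΦ hd' _, hyW⟩,
    fun y hy => (hW y hy.2).2, fun y hy => ((hW y hy.2).1.1).contDiffWithinAt, fun y hy => ?_⟩
  have hy' : (ψ₀.restrOpen W hWo).symm y ∈ W :=
    ((ψ₀.restrOpen W hWo).map_target hy).2
  obtain ⟨e, he⟩ := (hW _ hy').1.2
  have hC := (hW _ hy').1.1
  refine ((ψ₀.restrOpen W hWo).contDiffAt_symm hy (f₀' := e) ?_ hC).contDiffWithinAt
  rw [he]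
  exact (hC.differentiableAt (by simp)).hasFDerivAt

/-- Near a point where it is a submersion, the zero set of a smooth map is straightened by a
diffeomorphism. -/
theorem exists_straightening {f : V → F} {y₀ : V}
    (hf : ∀ᶠ y in 𝓝 y₀, ContDiffAt ℝ ∞ f y) (h0 : f y₀ = 0)
    (hsurj : Function.Surjective (fderiv ℝ f y₀)) {U : Set V} (hU : U ∈ 𝓝 y₀) :
    ∃ ψ : OpenPartialHomeomorph V V, y₀ ∈ ψ.source ∧ ψ.source ⊆ U ∧
      ContDiffOn ℝ ∞ ψ ψ.source ∧ ContDiffOn ℝ ∞ ψ.symm ψ.target ∧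
      HasFDerivAt ψ (ContinuousLinearMap.id ℝ V) y₀ ∧
      ∀ y ∈ ψ.source, f y = 0 ↔ fderiv ℝ f y₀ (ψ y - ψ y₀) = 0 := by
  set L := fderiv ℝ f y₀ with hL
  obtain ⟨R₀, hR₀⟩ := (L : V →ₗ[ℝ] F).exists_rightInverse_of_surjective
    (LinearMap.range_eq_top.2 hsurj)
  let R : F →L[ℝ] V := R₀.toContinuousLinearMap
  have hR : ∀ e, L (R e) = e := fun e => congrArg (fun T => T e) hR₀
  -- The linear part of `f` along the image of the right inverse `R` is replaced by `f` itself.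
  -- Hence the derivative at `y₀` is the identity, and `L (Φ y - Φ y₀) = f y`.
  let Φ : V → V := fun y => y - R (L (y - y₀)) + R (f y)
  have hΦ : ∀ᶠ y in 𝓝 y₀, ContDiffAt ℝ ∞ Φ y := by
    filter_upwards [hf] with y hf
    have h1 : ContDiffAt ℝ ∞ (fun y => R (f y)) y := R.contDiff.contDiffAt.comp y hf
    have h2 : ContDiffAt ℝ ∞ (fun y => y - R (L (y - y₀))) y := by fun_prop
    exact h2.add h1
  have hd : HasFDerivAt Φ (ContinuousLinearMap.id ℝ V) y₀ := by
    have h1 : HasFDerivAt (fun y => R (f y)) (R.comp L) y₀ :=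
      R.hasFDerivAt.comp y₀ (hf.self_of_nhds.differentiableAt (by simp)).hasFDerivAt
    have h2 : HasFDerivAt (fun y => R (L (y - y₀))) (R.comp L) y₀ :=
      (R.comp L).hasFDerivAt.comp y₀ ((hasFDerivAt_id y₀).sub_const y₀)
    have h3 := ((hasFDerivAt_id y₀).sub h2).add h1
    rwa [sub_add_cancel] at h3
  obtain ⟨ψ, hψ, hy₀, hsub, hs1, hs2⟩ := exists_diffeo_of_hasFDerivAt hΦ hd hU
  refine ⟨ψ, hy₀, hsub, hs1, hs2, by rwa [hψ], fun y _ => ?_⟩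
  have h4 : L (ψ y - ψ y₀) = f y := by
    rw [hψ]
    simp only [Φ, h0, sub_self, map_zero, sub_zero, add_zero, map_sub, map_add, hR]
    abel
  rw [h4]

end Straightening

/-! ### Zero sets of transverse sections as symplectic submanifolds -/

section ZeroSet

open Set Filter

variable {d : ℕ} {M : Type*} [TopologicalSpace M] [ChartedSpace (EuclideanSpace ℝ (Fin d)) M]
  [IsManifold (𝓡 d) ∞ M]
  {F : Type*} [NormedAddCommGroup F] [NormedSpace ℝ F] [FiniteDimensional ℝ F]
  {E : M → Type*} [TopologicalSpace (TotalSpace F E)]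
  [∀ x, AddCommGroup (E x)] [∀ x, Module ℝ (E x)] [∀ x, TopologicalSpace (E x)]
  [∀ x, IsTopologicalAddGroup (E x)] [∀ x, ContinuousSMul ℝ (E x)]
  [FiberBundle F E] [VectorBundle ℝ F E] [ContMDiffVectorBundle ∞ F E (𝓡 d)]

/-- A section read in the trivialization at `z`. -/
def localRep (F : Type*) [NormedAddCommGroup F] [NormedSpace ℝ F]
    {E : M → Type*} [TopologicalSpace (TotalSpace F E)] [∀ x, TopologicalSpace (E x)]
    [FiberBundle F E] (s : (x : M) → E x) (z x : M) : F :=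
  (trivializationAt F E z (TotalSpace.mk' F x (s x))).2

theorem contMDiffAt_localRep {s : (x : M) → E x}
    (hs : ContMDiff (𝓡 d) ((𝓡 d).prod 𝓘(ℝ, F)) ∞ (fun x => TotalSpace.mk' F x (s x))) {z x : M}
    (hx : x ∈ (trivializationAt F E z).baseSet) :
    ContMDiffAt (𝓡 d) 𝓘(ℝ, F) ∞ (localRep F s z) x :=
  ((trivializationAt F E z).contMDiffAt_section_iff hx).1 (hs x)

theorem localRep_eq_zero_iff (s : (x : M) → E x) {z x : M}
    (hx : x ∈ (trivializationAt F E z).baseSet) : localRep F s z x = 0 ↔ s x = 0 := by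
  have h : localRep F s z x = (trivializationAt F E z).continuousLinearEquivAt ℝ x hx (s x) := rfl
  rw [h]
  exact map_eq_zero_iff _ (ContinuousLinearEquiv.injective _)

/-- At a zero of a section, its covariant derivative is the derivative of its local
representative. -/
theorem cov_eq_mvfderiv_localRep (cov : CovariantDerivative (𝓡 d) F E) {s : (x : M) → E x}
    (hs : ContMDiff (𝓡 d) ((𝓡 d).prod 𝓘(ℝ, F)) ∞ (fun x => TotalSpace.mk' F x (s x)))
    {z : M} (hz : s z = 0) (v : TangentSpace (𝓡 d) z) :
    (trivializationAt F E z).continuousLinearEquivAt ℝ z (mem_baseSet_trivializationAt F E z)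
      (cov s z v) = mvfderiv (𝓡 d) (localRep F s z) z v := by
  have : ContMDiffVectorBundle 1 F E (𝓡 d) := ContMDiffVectorBundle.of_le (n := ∞) (by simp)
  have hzb := mem_baseSet_trivializationAt F E z
  set e := trivializationAt F E z with he
  -- Expand `s = ∑ c i • e i` in a local frame. By the Leibniz rule the terms `c i • ∇(e i)` vanish
  -- at a zero of `s`, leaving `∑ d(c i) • e i`.
  let b := Module.finBasis ℝ F
  let c : Fin (Module.finrank ℝ F) → M → ℝ := fun i x => b.repr (localRep F s z x) i
  have hf := (contMDiffAt_localRep hs hzb).mdifferentiableAt (by simp)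
  let l : Fin (Module.finrank ℝ F) → F →L[ℝ] ℝ := fun i => (b.coord i).toContinuousLinearMap
  have hc : ∀ i, MDifferentiableAt (𝓡 d) 𝓘(ℝ, ℝ) (c i) z := fun i =>
    (l i).mdifferentiableAt.comp z hf
  have hdc : ∀ i, mvfderiv (𝓡 d) (c i) z v = b.repr (mvfderiv (𝓡 d) (localRep F s z) z v) i := by
    intro i
    have h1 := congrArg (fun T => T v)
      (mfderiv_comp z (g := l i) (I' := 𝓘(ℝ, F)) (l i).mdifferentiableAt hf)
    have h2 := congrArg (fun T => T (mvfderiv (𝓡 d) (localRep F s z) z v))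
      ((l i).mfderiv_eq (x := localRep F s z z))
    exact h1.trans h2
  have hframe : ∀ i, MDifferentiableAt (𝓡 d) ((𝓡 d).prod 𝓘(ℝ, F))
      (fun x => TotalSpace.mk' F x (e.localFrame b i x)) z := fun i =>
    (contMDiffAt_localFrame_of_mem 1 e b i hzb).mdifferentiableAt (by simp)
  have hterm : ∀ i, MDifferentiableAt (𝓡 d) ((𝓡 d).prod 𝓘(ℝ, F))
      (fun x => TotalSpace.mk' F x ((c i • e.localFrame b i) x)) z := fun i =>
    (hc i).smul_section (hframe i)
  have hsum : ∀ S : Finset (Fin (Module.finrank ℝ F)),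
      MDifferentiableAt (𝓡 d) ((𝓡 d).prod 𝓘(ℝ, F))
        (fun x => TotalSpace.mk' F x ((∑ i ∈ S, c i • e.localFrame b i) x)) z ∧
      cov (∑ i ∈ S, c i • e.localFrame b i) z v =
        ∑ i ∈ S, mvfderiv (𝓡 d) (c i) z v • e.localFrame b i z := by
    intro S
    induction S using Finset.induction_on with
    | empty =>
      simp only [Finset.sum_empty]
      refine ⟨(contMDiff_zeroSection ℝ E (n := 1)).mdifferentiable (by simp) z, ?_⟩
      rw [cov.zero]; rfl
    | insert i S hi ih =>
      simp only [Finset.sum_insert hi]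
      refine ⟨mdifferentiableAt_add_section (hterm i) ih.1, ?_⟩
      rw [cov.isCovariantDerivativeOnUniv.add (hterm i) ih.1,
        cov.isCovariantDerivativeOnUniv.leibniz (hframe i) (hc i), add_apply, ih.2]
      have hci : c i z = 0 := by
        simp [c, (localRep_eq_zero_iff (F := F) s hzb).2 hz]
      rw [hci, zero_smul, zero_add]
      rfl
  have hcov : cov s z = cov (∑ i, c i • e.localFrame b i) z := by
    refine cov.isCovariantDerivativeOnUniv.congr_of_eventuallyEq
      ((hs z).mdifferentiableAt (by simp)) (hsum Finset.univ).1 univ_mem ?_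
    filter_upwards [e.open_baseSet.mem_nhds hzb] with x hx
    rw [e.eq_sum_localFrameCoeff_smul (I := 𝓡 d) (b := b) hx (s := s)]
    simp only [Finset.sum_apply, Pi.smul_apply',
      e.localFrameCoeff_eq_coeff (I := 𝓡 d) (b := b) (s := s) hx]
    rfl
  rw [hcov, (hsum Finset.univ).2, map_sum, ← b.sum_repr (mvfderiv (𝓡 d) (localRep F s z) z v)]
  refine Finset.sum_congr rfl fun i _ => ?_
  rw [map_smul, hdc]
  congr 1
  rw [e.localFrame_apply_of_mem_baseSet b hzb]
  exact (e.linearEquivAt ℝ z hzb).apply_symm_apply (b i)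

theorem fderiv_comp_extChartAt_symm_tcoord (f : M → F) {z : M}
    (hf : MDifferentiableAt (𝓡 d) 𝓘(ℝ, F) f z) (v : TangentSpace (𝓡 d) z) :
    fderiv ℝ (f ∘ (extChartAt (𝓡 d) z).symm) (extChartAt (𝓡 d) z z) (tcoord z z v) =
      mvfderiv (𝓡 d) f z v := by
  have : IsManifold (𝓡 d) 1 M := IsManifold.of_le (n := ∞) (by simp)
  have h2 : MDifferentiableAt 𝓘(ℝ, EuclideanSpace ℝ (Fin d)) (𝓡 d)
      (extChartAt (𝓡 d) z).symm (extChartAt (𝓡 d) z z) := by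
    have := mdifferentiableWithinAt_extChartAt_symm (I := 𝓡 d) (mem_extChartAt_target z)
    rwa [ModelWithCorners.range_eq_univ, mdifferentiableWithinAt_univ] at this
  have hf' : MDifferentiableAt (𝓡 d) 𝓘(ℝ, F) f
      ((extChartAt (𝓡 d) z).symm (extChartAt (𝓡 d) z z)) := by rwa [extChartAt_to_inv]
  have h3 := mfderiv_comp z (hf'.comp _ h2)
    (mdifferentiableAt_extChartAt (I := 𝓡 d) (mem_chart_source _ z))
  have h4 : (f ∘ (extChartAt (𝓡 d) z).symm) ∘ extChartAt (𝓡 d) z =ᶠ[𝓝 z] f := by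
    filter_upwards [extChartAt_source_mem_nhds (I := 𝓡 d) z] with x hx
    exact congrArg f ((extChartAt (𝓡 d) z).left_inv hx)
  have h5 : (show TangentSpace (𝓡 d) z →L[ℝ] F from mfderiv (𝓡 d) 𝓘(ℝ, F)
      ((f ∘ (extChartAt (𝓡 d) z).symm) ∘ extChartAt (𝓡 d) z) z) =
      (show TangentSpace (𝓡 d) z →L[ℝ] F from mfderiv (𝓡 d) 𝓘(ℝ, F) f z) := h4.mfderiv_eq
  rw [← mfderiv_eq_fderiv]
  exact (congrArg (fun T => T v) h3).symm.trans (congrArg (fun T => T v) h5)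

/-- The straightening diffeomorphism has derivative the identity, so the new chart has the same
derivative at `z` as the original one. The tangent space of the zero set is thus `ker ∇s`, where
`hpos` gives nondegeneracy. -/
theorem isSymplecticSubmanifold_zeroSet {α : DForm d 2 M} {cov : CovariantDerivative (𝓡 d) F E}
    {s : (x : M) → E x}
    (hs : ContMDiff (𝓡 d) ((𝓡 d).prod 𝓘(ℝ, F)) ∞ (fun x => TotalSpace.mk' F x (s x)))
    (hsurj : ∀ z, s z = 0 → Function.Surjective (cov s z))
    (hpos : ∀ z, s z = 0 → ∀ u : TangentSpace (𝓡 d) z, u ≠ 0 → cov s z u = 0 →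
      ∃ v, cov s z v = 0 ∧ α z ![u, v] ≠ 0) :
    IsSymplecticSubmanifold α {x | s x = 0} (Module.finrank ℝ F) := by
  intro z (hz : s z = 0)
  have : IsManifold (𝓡 d) 1 M := IsManifold.of_le (n := ∞) (by simp)
  have hzb := mem_baseSet_trivializationAt F E z
  let f : EuclideanSpace ℝ (Fin d) → F := localRep F s z ∘ (extChartAt (𝓡 d) z).symm
  set y₀ := extChartAt (𝓡 d) z z with hy₀
  have hzsrc := mem_extChartAt_source (I := 𝓡 d) z
  have hcov : ∀ v : TangentSpace (𝓡 d) z, cov s z v = 0 ↔ fderiv ℝ f y₀ (tcoord z z v) = 0 := by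
    intro v
    rw [fderiv_comp_extChartAt_symm_tcoord _ ((contMDiffAt_localRep hs hzb).mdifferentiableAt
      (by simp)), ← cov_eq_mvfderiv_localRep cov hs hz]
    exact (map_eq_zero_iff _ (ContinuousLinearEquiv.injective _)).symm
  have hfs : Function.Surjective (fderiv ℝ f y₀) := by
    intro e
    obtain ⟨v, hv⟩ := hsurj z hz (((trivializationAt F E z).continuousLinearEquivAt ℝ z hzb).symm e)
    refine ⟨tcoord z z v, ?_⟩
    rw [fderiv_comp_extChartAt_symm_tcoord _ ((contMDiffAt_localRep hs hzb).mdifferentiableAt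
      (by simp)), ← cov_eq_mvfderiv_localRep cov hs hz, hv]
    exact ContinuousLinearEquiv.apply_symm_apply _ _
  let U := chartImage (d := d) z (trivializationAt F E z).baseSet
  have hUo : IsOpen U := isOpen_chartImage z (trivializationAt F E z).open_baseSet
  have hU : U ∈ 𝓝 y₀ := hUo.mem_nhds (mem_chartImage hzsrc hzb)
  have hfU : ∀ᶠ y in 𝓝 y₀, ContDiffAt ℝ ∞ f y := by
    filter_upwards [hU] with y hy
    have h1 := (contMDiffOn_extChartAt_symm (I := 𝓡 d) (n := ∞) z).contMDiffAt
      ((isOpen_extChartAt_target z).mem_nhds hy.1)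
    exact ((contMDiffAt_localRep hs hy.2).comp y h1).contDiffAt
  have hf0 : f y₀ = 0 := by
    change localRep F s z ((extChartAt (𝓡 d) z).symm y₀) = 0
    rw [hy₀, extChartAt_to_inv, localRep_eq_zero_iff s hzb, hz]
  obtain ⟨ψ, hyψ, hψU, hψ1, hψ2, hψd, hψ0⟩ := exists_straightening hfU hf0 hfs hU
  let φ : OpenPartialHomeomorph M (EuclideanSpace ℝ (Fin d)) :=
    (chartAt (EuclideanSpace ℝ (Fin d)) z).trans ψ
  have hzφ : z ∈ φ.source := by
    refine ⟨mem_chart_source _ z, hyψ⟩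
  have hderiv : ∀ v : TangentSpace (𝓡 d) z, mvfderiv (𝓡 d) φ z v = tcoord z z v := by
    intro v
    have h1 := hψd.hasMFDerivAt.comp z
      (mdifferentiableAt_extChartAt (I := 𝓡 d) (mem_chart_source _ z)).hasMFDerivAt
    exact congrArg (fun T => T v) h1.mfderiv
  refine ⟨φ, ?_, hzφ, LinearMap.ker (fderiv ℝ f y₀ : EuclideanSpace ℝ (Fin d) →ₗ[ℝ] F), ?_, ?_, ?_⟩
  · refine OpenPartialHomeomorph.mem_maximalAtlas_of_contMDiffOn φ ?_ ?_
    · exact hψ1.contMDiffOn.comp (contMDiffOn_chart.mono fun x hx => hx.1) fun x hx => hx.2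
    · exact contMDiffOn_chart_symm.comp (hψ2.contMDiffOn.mono fun x hx => hx.1) fun x hx => hx.2
  · have h1 := LinearMap.finrank_range_add_finrank_ker
      (fderiv ℝ f y₀ : EuclideanSpace ℝ (Fin d) →ₗ[ℝ] F)
    rw [LinearMap.range_eq_top.2 hfs, finrank_top, finrank_euclideanSpace_fin] at h1
    omega
  · intro x hx
    have hxψ : extChartAt (𝓡 d) z x ∈ ψ.source := hx.2
    have hxU := hψU hxψ
    have hxs : x ∈ (extChartAt (𝓡 d) z).source := by
      rw [extChartAt_source]; exact hx.1
    have hxe : (extChartAt (𝓡 d) z).symm (extChartAt (𝓡 d) z x) = x :=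
      (extChartAt (𝓡 d) z).left_inv hxs
    have hxb : x ∈ (trivializationAt F E z).baseSet := by
      have := hxU.2
      rwa [mem_preimage, hxe] at this
    have h1 := hψ0 _ hxψ
    have h2 : f (extChartAt (𝓡 d) z x) = localRep F s z x := congrArg (localRep F s z) hxe
    rw [LinearMap.mem_ker]
    refine Iff.trans ?_ h1
    refine Iff.trans (localRep_eq_zero_iff s hxb).symm ?_
    rw [← h2]
  · intro u hu h
    by_contra hne
    rw [LinearMap.mem_ker, hderiv] at hu
    obtain ⟨v, hv, hv2⟩ := hpos z hz u hne ((hcov u).2 hu)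
    refine hv2 (h v ?_)
    rw [LinearMap.mem_ker, hderiv]
    exact (hcov v).1 hv

end ZeroSet

end SymplecticSections

end

/-! ### The theorem -/

theorem lemma2p9 (n : ℕ) (M : Type*) [TopologicalSpace M]
    [ChartedSpace (EuclideanSpace ℝ (Fin (2 * n))) M] [IsManifold (𝓡 (2 * n)) ∞ M]
    [T2Space M] [CompactSpace M]
    (Ω : SymplecticSections.DForm (2 * n) 2 M) (J : SymplecticSections.EndField (2 * n) M)
    (hΩ : SymplecticSections.IsSymplectic Ω) (hJ : SymplecticSections.IsCompatible Ω J)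
    (C η : ℝ) (hC : 0 < C) (hη : 0 < η) :
    ∃ δ : ℝ, 0 < δ ∧
    ∃ (Ω' : SymplecticSections.DForm (2 * n) 2 M) (J' : SymplecticSections.EndField (2 * n) M),
      SymplecticSections.IsSymplectic Ω' ∧ SymplecticSections.IsIntegral Ω' ∧
      SymplecticSections.IsCompatible Ω' J' ∧
      ∀ (t : ℝ), 0 < t →
      ∀ (D : CovariantDerivative (𝓡 (2 * n)) (EuclideanSpace ℝ (Fin (2 * n)))
          (fun x : M => TangentSpace (𝓡 (2 * n)) x)),
        SymplecticSections.IsLeviCivita (SymplecticSections.scaledMetric t Ω' J') D →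
      ∀ (k : ℕ) (E : M → Type*)
        [TopologicalSpace (TotalSpace (EuclideanSpace ℝ (Fin (2 * k))) E)]
        [∀ x, AddCommGroup (E x)] [∀ x, Module ℝ (E x)] [∀ x, TopologicalSpace (E x)]
        [∀ x, IsTopologicalAddGroup (E x)] [∀ x, ContinuousSMul ℝ (E x)]
        [FiberBundle (EuclideanSpace ℝ (Fin (2 * k))) E]
        [VectorBundle ℝ (EuclideanSpace ℝ (Fin (2 * k))) E]
        [ContMDiffVectorBundle ∞ (EuclideanSpace ℝ (Fin (2 * k))) E (𝓡 (2 * n))]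
        (j : (x : M) → E x →L[ℝ] E x)
        (h : ContMDiffRiemannianMetric (𝓡 (2 * n)) ∞ (EuclideanSpace ℝ (Fin (2 * k))) E)
        (cov : CovariantDerivative (𝓡 (2 * n)) (EuclideanSpace ℝ (Fin (2 * k))) E)
        (s : (x : M) → E x),
        SymplecticSections.IsComplexStructure (d := 2 * n) (EuclideanSpace ℝ (Fin (2 * k))) j →
        CovariantDerivative.ContMDiffCovariantDerivative cov ∞ →
        ContMDiff (𝓡 (2 * n)) ((𝓡 (2 * n)).prod 𝓘(ℝ, EuclideanSpace ℝ (Fin (2 * k)))) ∞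
          (fun x => TotalSpace.mk' (EuclideanSpace ℝ (Fin (2 * k))) x (s x)) →
        SymplecticSections.IsTransverse (SymplecticSections.scaledMetric t Ω' J') h cov η s →
        SymplecticSections.IsC2ApproxHolomorphic (SymplecticSections.scaledMetric t Ω' J') D J' h j
          cov C δ C δ s →
        SymplecticSections.IsSymplecticSubmanifold Ω {x | s x = 0} (2 * k) ∧
        SymplecticSections.IsSymplecticSubmanifold Ω' {x | s x = 0} (2 * k) := by
  obtain ⟨β, c, J', hc, hsym, hint, hcomp, hcompβ, hclose⟩ :=
    SymplecticSections.exists_integral_symplectic hΩ hJ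
  have hδ : (0 : ℝ) < 8 * C / η := by positivity
  -- The value of `δ` for which `C / √δ = η / 8`.
  refine ⟨(8 * C / η) ^ 2, by positivity, c • β, J', hsym, hint, hcomp, ?_⟩
  intro t ht D _ k E _ _ _ _ _ _ _ _ _ j h cov s _ _ hs htrans hhol
  -- The integrality factor `c` is absorbed into the scale of the metric, so lengths can be measured
  -- with `β`, to which `Ω` is close.
  have hg : SymplecticSections.scaledMetric t (c • β) J' =
      SymplecticSections.scaledMetric (t * c) β J' := by
    funext x u v
    exact (mul_assoc t c (β x ![u, J' x v])).symm
  have hdbar := hhol.dbar_zero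
  rw [hg] at htrans hdbar
  have hδ' : 8 * (C / √((8 * C / η) ^ 2)) ≤ η := by
    rw [Real.sqrt_sq hδ.le]
    refine le_of_eq ?_
    field_simp
  have hkey : ∀ z, s z = 0 → ∀ u : TangentSpace (𝓡 (2 * n)) z, u ≠ 0 → cov s z u = 0 →
      ∃ v : TangentSpace (𝓡 (2 * n)) z, cov s z v = 0 ∧ 0 < Ω z ![u, v] ∧ 0 < β z ![u, v] :=
    fun z hz u hu hker => SymplecticSections.exists_pos_of_mem_ker hcompβ hclose (mul_pos ht hc) hη
      hδ' htrans hdbar hz hu hker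
  have hsurj : ∀ z, s z = 0 → Function.Surjective (cov s z) := fun z hz e => by
    obtain ⟨R, hR, -⟩ := htrans z (by rw [hz, SymplecticSections.fnorm_zero]; exact hη.le)
    exact ⟨R e, hR e⟩
  have hrank : Module.finrank ℝ (EuclideanSpace ℝ (Fin (2 * k))) = 2 * k :=
    finrank_euclideanSpace_fin
  rw [← hrank]
  constructor
  · refine SymplecticSections.isSymplecticSubmanifold_zeroSet hs hsurj fun z hz u hu hker => ?_
    obtain ⟨v, hv, h1, -⟩ := hkey z hz u hu hker
    exact ⟨v, hv, h1.ne'⟩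
  · refine SymplecticSections.isSymplecticSubmanifold_zeroSet hs hsurj fun z hz u hu hker => ?_
    obtain ⟨v, hv, -, h1⟩ := hkey z hz u hu hker
    exact ⟨v, hv, (mul_pos hc h1).ne'⟩
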